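/- Notation. For $\varphi:\mathbb R\to\mathbb C$ let $\|\varphi\|_{L^\infty}$ be the (essential) supremum norm, $\|\varphi\|_{H^{1,0}}=\|\varphi\|_{L^2}+\|\partial_\xi\varphi\|_{L^2}$ (weak derivative), and $\|\varphi\|_{H^{0,m}}=\sum_{i=0}^m\|\xi^i\varphi\|_{L^2}$. Fix $n\in\mathbb N=\{0,1,2,\dots\}$ and $0<\alpha<\frac1{12}$. For $T\ge1$ and a measurable function $\varphi$ on $[1,T]\times\mathbb R$ put $$\|\varphi\|_{X_T}=\sup_{t\in[1,T]}\|\varphi(t)\|_{L^\infty_\xi}+\sup_{t\in[1,T]}t^{-\alpha}\|\varphi(t)\|_{H^{1,0}_\xi}+\sup_{t\in[1,T]}t^{-\alpha}\|\varphi(t)\|_{H^{0,2n+1}_\xi},$$ and let $X_T$ be the space of those $\varphi$ for which this is finite. Given $\hat w_f,\hat w_g\in X_T$, put $$B_g(t,\xi)=\exp\Big(\tfrac{i}{2\sqrt{2\pi}}\int_1^t\tfrac1s|\hat w_g(s,\xi)|^2ds\Big),\qquad B_f(t,\xi)=\exp\Big(\tfrac{i}{2\sqrt{2\pi}}\int_1^t\tfrac1s|\hat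 w_f(s,\xi)|^2ds\Big),$$ $$\hat f=\hat w_f\,\overline{B_g},\qquad \hat g=\hat w_g\,\overline{B_f},$$ so that $|\hat f|=|\hat w_f|$, $|\hat g|=|\hat w_g|$. For functions $h_1,h_2,h_3$ on $[1,T]\times\mathbb R$ put $$R(h_1,h_2,h_3)(s,\xi)=-\frac{i}{4\pi s}\int_{\mathbb R^2}\big(e^{-i\frac{ab}{2s}}-1\big)\,\mathcal F^{-1}_{\eta,\sigma}\big[h_1(s,\xi-\sigma)\,\overline{h_2}(s,\xi-\eta-\sigma)\,h_3(s,\xi-\eta)\big](a,b)\,da\,db,$$ where $\mathcal F^{-1}_{\eta,\sigma}[F](a,b)=\frac1{2\pi}\int_{\mathbb R^2}e^{i(a\eta+b\sigma)}F(\eta,\sigma)\,d\eta\,d\sigma$. Finally, with $\hat w_f^1=\hat w_f(1,\cdot)$ and $\hat w_g^1=\hat w_g(1,\cdot)$, put $$\Phi_1(\hat w_f,\hat w_g)(t,\xi)=\hat w_f^1(\xi)+\int_1^tB_g(s,\xi)\,R(\hat g,\hat g,\hat f)(s,\xi)\,ds,\qquad \Phi_2(\hat w_f,\hat w_g)(t,\xi)=\hat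 w_g^1(\xi)+\int_1^tB_f(s,\xi)\,R(\hat f,\hat f,\hat g)(s,\xi)\,ds.$$ Proposition. There is a constant $M>0$, depending only on $n$ and $\alpha$, such that for all $T\ge1$, all $\varepsilon\ge0$ and all $\hat w_f,\hat w_g\in X_T$ with $$\|\hat w_f^1\|_{H^{1,0}_\xi}+\|\hat w_f^1\|_{H^{0,2n+1}_\xi}+\|\hat w_g^1\|_{H^{1,0}_\xi}+\|\hat w_g^1\|_{H^{0,2n+1}_\xi}\le\varepsilon,$$ all the integrals in the definition of $\Phi_1(\hat w_f,\hat w_g)$ and $\Phi_2(\hat w_f,\hat w_g)$ converge absolutely (those in the phases for almost every $\xi$), both functions belong to $X_T$, and $$\|\Phi_1(\hat w_f,\hat w_g)\|_{X_T}\le\tfrac32\varepsilon+M\|\hat w_f\|_{X_T}\|\hat w_g\|_{X_T}^2(1+\|\hat w_f\|_{X_T}^4)(1+\|\hat w_g\|_{X_T}^4),$$ $$\|\Phi_2(\hat w_f,\hat w_g)\|_{X_T}\le\tfrac32\varepsilon+M\|\hat w_g\|_{X_T}\|\hat w_f\|_{X_T}^2(1+\|\hat w_g\|_{X_T}^4)(1+\|\hat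 w_f\|_{X_T}^4).$$ -/

import Mathlib

open MeasureTheory Set
open scoped ENNReal NNReal ContDiff ComplexConjugate

noncomputable section

namespace CoupledNLS

/-! ### Norms in the space variable, with values in `[0, ∞]` -/

/-- `ψ` is the weak derivative of order `k` of `φ` on the real line. -/
def IsWeakDeriv (k : ℕ) (φ ψ : ℝ → ℂ) : Prop :=
  LocallyIntegrable φ ∧ LocallyIntegrable ψ ∧
    ∀ θ : ℝ → ℂ, ContDiff ℝ ∞ θ → HasCompactSupport θ →
      ∫ x, φ x * iteratedDeriv k θ x = (-1) ^ k * ∫ x, ψ x * θ x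

/-- The norm `‖∂ᵏφ‖` in `L²`. A weak derivative is unique almost everywhere, so that the infimum
is over one value, or over none; in the latter case it is `∞`. -/
def derivL2 (k : ℕ) (φ : ℝ → ℂ) : ℝ≥0∞ :=
  ⨅ (ψ : ℝ → ℂ) (_ : IsWeakDeriv k φ ψ), eLpNorm ψ 2 volume

/-- The norm of `H^{m,0}`: the sum of `‖∂ⁱφ‖` in `L²` over `0 ≤ i ≤ m`. -/
def normHDeriv (m : ℕ) (φ : ℝ → ℂ) : ℝ≥0∞ :=
  ∑ i ∈ Finset.range (m + 1), derivL2 i φ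

/-- The norm of `H^{0,m}`: the sum of `‖xⁱφ‖` in `L²` over `0 ≤ i ≤ m`. -/
def normHWeight (m : ℕ) (φ : ℝ → ℂ) : ℝ≥0∞ :=
  ∑ i ∈ Finset.range (m + 1), eLpNorm (fun x : ℝ => (x : ℂ) ^ i * φ x) 2 volume

/-- The norm of `L^∞`. For a function in `H^{1,0}` it is the supremum of the modulus of the
continuous representative. -/
def normLinf (φ : ℝ → ℂ) : ℝ≥0∞ := eLpNorm φ ⊤ volume

/-! ### The space `X_T` -/

/-- The norm of `X_T`, with the exponent `α` and the weight `2n+1`. -/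
def normXT (n : ℕ) (α T : ℝ) (φ : ℝ → ℝ → ℂ) : ℝ≥0∞ :=
  (⨆ t ∈ Icc (1 : ℝ) T, normLinf (φ t))
    + (⨆ t ∈ Icc (1 : ℝ) T, ENNReal.ofReal (t ^ (-α)) * normHDeriv 1 (φ t))
    + (⨆ t ∈ Icc (1 : ℝ) T, ENNReal.ofReal (t ^ (-α)) * normHWeight (2 * n + 1) (φ t))

/-- Membership in `X_T`: a (jointly) measurable function on `[1,T] × ℝ` of finite norm. The values
at times outside `[1,T]` play no role. -/
def MemXT (n : ℕ) (α T : ℝ) (φ : ℝ → ℝ → ℂ) : Prop :=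
  Measurable (fun p : Icc (1 : ℝ) T × ℝ => φ p.1 p.2) ∧ normXT n α T φ < ⊤

/-! ### Phases and profiles -/

/-- The phase `B_h(t,ξ) = exp (i / (2√(2π)) ∫₁ᵗ |h(s,ξ)|² ds/s)`. -/
def phase (h : ℝ → ℝ → ℂ) (t ξ : ℝ) : ℂ :=
  Complex.exp (Complex.I *
    ((1 / (2 * Real.sqrt (2 * Real.pi)) * ∫ s in (1 : ℝ)..t, 1 / s * ‖h s ξ‖ ^ 2 : ℝ) : ℂ))

/-- The profile that has the phase-corrected profile `w`, where `v` is the phase-corrected profile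
of the other component. As `v` has the modulus of the other profile, this solves
`ŵ_f = f̂ B_g`, `ŵ_g = ĝ B_f` for `f̂` and `ĝ`; see `profile_mul_phase`. -/
def profile (w v : ℝ → ℝ → ℂ) (t ξ : ℝ) : ℂ := w t ξ * conj (phase v t ξ)

theorem norm_phase (h : ℝ → ℝ → ℂ) (t ξ : ℝ) : ‖phase h t ξ‖ = 1 := by
  unfold phase
  rw [mul_comm]
  exact Complex.norm_exp_ofReal_mul_I _

theorem norm_profile (w v : ℝ → ℝ → ℂ) (t ξ : ℝ) : ‖profile w v t ξ‖ = ‖w t ξ‖ := by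
  unfold profile
  rw [norm_mul, RCLike.norm_conj, norm_phase, mul_one]

theorem phase_profile (w v : ℝ → ℝ → ℂ) : phase (profile w v) = phase w := by
  funext t ξ
  simp only [phase, norm_profile]

/-- With `f̂ = profile ŵ_f ŵ_g` and `ĝ = profile ŵ_g ŵ_f`, one has `f̂ B_g = ŵ_f`. -/
theorem profile_mul_phase (w v : ℝ → ℝ → ℂ) (t ξ : ℝ) :
    profile w v t ξ * phase (profile v w) t ξ = w t ξ := by
  rw [phase_profile, profile, mul_assoc, Complex.conj_mul', norm_phase]
  simp

/-! ### The remainder `R` and the Duhamel maps -/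

/-- `F(s,η,σ,ξ) = h₁(s,ξ-σ) · conj h₂(s,ξ-η-σ) · h₃(s,ξ-η)`, with `p = (η,σ)`. -/
def triple (h₁ h₂ h₃ : ℝ → ℝ → ℂ) (s ξ : ℝ) (p : ℝ × ℝ) : ℂ :=
  h₁ s (ξ - p.2) * conj (h₂ s (ξ - p.1 - p.2)) * h₃ s (ξ - p.1)

/-- The inverse of the unitary Fourier transform on `ℝ²`, at the point `q = (a,b)`. -/
def invFourier₂ (F : ℝ × ℝ → ℂ) (q : ℝ × ℝ) : ℂ :=
  ((1 / (2 * Real.pi) : ℝ) : ℂ) *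
    ∫ p : ℝ × ℝ, Complex.exp (Complex.I * ((q.1 * p.1 + q.2 * p.2 : ℝ) : ℂ)) * F p

/-- The integrand of the remainder, at the point `q = (a,b)`. -/
def remainderIntegrand (h₁ h₂ h₃ : ℝ → ℝ → ℂ) (s ξ : ℝ) (q : ℝ × ℝ) : ℂ :=
  (Complex.exp (-Complex.I * ((q.1 * q.2 / (2 * s) : ℝ) : ℂ)) - 1) *
    invFourier₂ (triple h₁ h₂ h₃ s ξ) q

/-- The remainder `R(h₁,h₂,h₃)(s,ξ)`. -/
def remainder (h₁ h₂ h₃ : ℝ → ℝ → ℂ) (s ξ : ℝ) : ℂ :=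
  -(Complex.I / ((4 * Real.pi * s : ℝ) : ℂ)) *
    ∫ q : ℝ × ℝ, remainderIntegrand h₁ h₂ h₃ s ξ q

/-- The integrand `B_g(s,ξ) R(ĝ,ĝ,f̂)(s,ξ)` of the Duhamel map, where `f̂`, `ĝ` are the profiles
of the pair of phase-corrected profiles `(w, v)`. -/
def duhamelIntegrand (w v : ℝ → ℝ → ℂ) (s ξ : ℝ) : ℂ :=
  phase (profile v w) s ξ * remainder (profile v w) (profile v w) (profile w v) s ξ

/-- The Duhamel map `w(1,ξ) + ∫₁ᵗ B_g(s,ξ) R(ĝ,ĝ,f̂)(s,ξ) ds`. -/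
def duhamel (w v : ℝ → ℝ → ℂ) (t ξ : ℝ) : ℂ :=
  w 1 ξ + ∫ s in (1 : ℝ)..t, duhamelIntegrand w v s ξ

/-- The first Duhamel map `Φ₁(ŵ_f, ŵ_g)`. -/
def Phi₁ (wf wg : ℝ → ℝ → ℂ) : ℝ → ℝ → ℂ := duhamel wf wg

/-- The second Duhamel map `Φ₂(ŵ_f, ŵ_g)`, with the roles of the two components exchanged. -/
def Phi₂ (wf wg : ℝ → ℝ → ℂ) : ℝ → ℝ → ℂ := duhamel wg wf

/-- All integrals in the definition of `duhamel w v` on `[1,T] × ℝ` converge absolutely: the one in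
each of the phases (for almost every `ξ`), the Fourier integral, the integral that defines `R`, and
the one in time. -/
def DuhamelConverges (T : ℝ) (w v : ℝ → ℝ → ℂ) : Prop :=
  (∀ᵐ ξ : ℝ, IntervalIntegrable (fun s => 1 / s * ‖w s ξ‖ ^ 2) volume 1 T ∧
    IntervalIntegrable (fun s => 1 / s * ‖v s ξ‖ ^ 2) volume 1 T) ∧
  (∀ ξ : ℝ, ∀ s ∈ Icc (1 : ℝ) T,
    Integrable (triple (profile v w) (profile v w) (profile w v) s ξ) ∧
    Integrable (remainderIntegrand (profile v w) (profile v w) (profile w v) s ξ)) ∧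
  ∀ ξ : ℝ, IntervalIntegrable (fun s => duhamelIntegrand w v s ξ) volume 1 T

end CoupledNLS

end

open MeasureTheory Set
open scoped ENNReal NNReal ContDiff ComplexConjugate

noncomputable section

namespace CoupledNLS

section

open FourierTransform SchwartzMap

/-! ### The Fourier transform on `L¹ ∩ L²` -/

/-! Put `u = 𝓕⁻ h` for each factor `h`, and `μ = π² / s`. After a rescaling the remainder is
`-i/(2s)` times the integral of `exp (-2iμ q₁q₂) - 1` against the Fourier transform of the trilinear
expression. That transform is the integral over `x` of a unimodular factor times `conj (u₂ x) u₃ (x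
- q₁) u₁ (x - q₂)`. This formula is used in two ways.

Pointwise decay. With `y = x - q₁`, `z = x - q₂` one has `|exp (it) - 1| ≤ 2 |t|^θ`, and `|(x - y)(x
- z)|^θ` is dominated by a product of weights in `x`, `y`, `z`. So the remainder is at most a
multiple of `s^(-1-θ)` times the weighted norms `∫ (1 + x²)^θ |u|`, and Cauchy–Schwarz bounds these
by `H¹` norms when `θ < 1/4`. The profiles may grow like `s^α` in `H¹`; integrability in time thus
asks for `3α < θ < 1/4`, whence `α < 1/12`.

Bounds in `L²`. Completing squares distributes the oscillating factor as chirps `exp (±iμx²)` over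
the three functions and their convolution (`integral_expI_mul_kernel`). By Plancherel the `L²` norm
is that of a product of three Fourier transforms of chirped functions. Each of these has the `L²`
norm of its `h` and is bounded by `L + s^(-θ) N` up to a constant, where `L` is the sup bound and
`N` the `H¹` bound (`exists_remainderBd`). Since `α ≤ θ`, only the factor in `L²` keeps the growth
`s^α`: the total is `s^(α-1)`, which integrates to `t^α / α`.

Regularity and weights come from this trilinear `L²` bound alone (`RemainderBd.exists_bounds`). A
derivative in `L²` is encoded by `TransBd`, and the remainder commutes with translations, so
multilinearity suffices. For the weights, the factors are cut off at radius `r`; their remainder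
vanishes beyond `6r`, so the tail of the remainder is controlled by the tails of the factors, and
the layer-cake formula converts tails into weighted norms.

The phases have modulus one, and their translation bounds follow by Minkowski's inequality in time
(`XBound.transBd_phase`). At the end Plancherel and Fatou convert `TransBd` back into a weak
derivative (`derivL2_one_le`). The `3/2` is `1` for the two Sobolev-type norms of the datum and
`1/2` for its sup norm. -/

theorem integral_schwartz_mul_fourier_Lp (θ : 𝓢(ℝ, ℂ)) (f : Lp (α := ℝ) ℂ 2) :
    ∫ x, θ x * (𝓕 f : Lp (α := ℝ) ℂ 2) x = ∫ x, (𝓕 θ) x * f x := by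
  have h := congrArg (fun T => T θ) (Lp.fourier_toTemperedDistribution_eq f)
  simp only [TemperedDistribution.fourier_apply, Lp.toTemperedDistribution_apply, smul_eq_mul] at h
  exact h.symm

theorem integral_schwartz_mul_fourierInv_Lp (θ : 𝓢(ℝ, ℂ)) (f : Lp (α := ℝ) ℂ 2) :
    ∫ x, θ x * (𝓕⁻ f : Lp (α := ℝ) ℂ 2) x = ∫ x, (𝓕⁻ θ) x * f x := by
  have h := congrArg (fun T => T θ) (Lp.fourierInv_toTemperedDistribution_eq f)
  simp only [TemperedDistribution.fourierInv_apply, Lp.toTemperedDistribution_apply,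
    smul_eq_mul] at h
  exact h.symm

theorem continuous_fourier {f : ℝ → ℂ} (hf : Integrable f) : Continuous (𝓕 f) :=
  VectorFourier.fourierIntegral_continuous Real.continuous_fourierChar
    (by exact continuous_inner) hf

theorem fourierInv_eq_fourier_comp_neg' (f : ℝ → ℂ) : 𝓕⁻ f = 𝓕 (fun x => f (-x)) :=
  Real.fourierInv_eq_fourier_comp_neg f

theorem continuous_fourierInv {f : ℝ → ℂ} (hf : Integrable f) : Continuous (𝓕⁻ f) := by
  rw [fourierInv_eq_fourier_comp_neg']
  exact continuous_fourier hf.comp_neg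

theorem integral_mul_fourier {f g : ℝ → ℂ} (hf : Integrable f) (hg : Integrable g) :
    ∫ x, 𝓕 f x * g x = ∫ x, f x * 𝓕 g x := by
  have := VectorFourier.integral_fourierIntegral_smul_eq_flip (μ := volume) (ν := volume)
    (L := innerₗ ℝ) (f := f) (g := g) Real.continuous_fourierChar continuous_inner hf hg
  rw [flip_innerₗ] at this
  exact this

theorem integral_mul_fourierInv {f g : ℝ → ℂ} (hf : Integrable f) (hg : Integrable g) :
    ∫ x, 𝓕⁻ f x * g x = ∫ x, f x * 𝓕⁻ g x := by
  rw [fourierInv_eq_fourier_comp_neg', integral_mul_fourier hf.comp_neg hg,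
    ← integral_neg_eq_self]
  simp [Real.fourierInv_eq_fourier_neg]

/-- Both sides are locally integrable, so it suffices to pair them with test functions. The
transform moves onto the test function, by duality of tempered distributions on one side and by
Fubini on the other. -/
theorem fourier_toLp_ae_eq {f : ℝ → ℂ} (hf : Integrable f) (hf' : MemLp f 2) :
    (𝓕 (hf'.toLp f) : Lp (α := ℝ) ℂ 2) =ᵐ[volume] 𝓕 f := by
  refine ae_eq_of_integral_contDiff_smul_eq
    ((Lp.memLp _).locallyIntegrable one_le_two) (continuous_fourier hf).locallyIntegrable ?_
  intro g hg hgs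
  set θ : 𝓢(ℝ, ℂ) := HasCompactSupport.toSchwartzMap (f := fun x => (g x : ℂ))
    (hgs.comp_left Complex.ofReal_zero) (Complex.ofRealCLM.contDiff.comp hg)
  have h1 := integral_schwartz_mul_fourier_Lp θ (hf'.toLp f)
  have h2 := integral_mul_fourier θ.integrable hf
  have e : ∀ F : ℝ → ℂ, ∫ x, g x • F x = ∫ x, θ x * F x := fun F => rfl
  rw [e, e, h1, ← h2]
  refine integral_congr_ae ?_
  filter_upwards [hf'.coeFn_toLp] with x hx
  rw [hx, SchwartzMap.fourier_coe]

theorem fourierInv_toLp_ae_eq {f : ℝ → ℂ} (hf : Integrable f) (hf' : MemLp f 2) :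
    (𝓕⁻ (hf'.toLp f) : Lp (α := ℝ) ℂ 2) =ᵐ[volume] 𝓕⁻ f := by
  refine ae_eq_of_integral_contDiff_smul_eq
    ((Lp.memLp _).locallyIntegrable one_le_two) (continuous_fourierInv hf).locallyIntegrable ?_
  intro g hg hgs
  set θ : 𝓢(ℝ, ℂ) := HasCompactSupport.toSchwartzMap (f := fun x => (g x : ℂ))
    (hgs.comp_left Complex.ofReal_zero) (Complex.ofRealCLM.contDiff.comp hg)
  have h1 := integral_schwartz_mul_fourierInv_Lp θ (hf'.toLp f)
  have h2 := integral_mul_fourierInv θ.integrable hf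
  have e : ∀ F : ℝ → ℂ, ∫ x, g x • F x = ∫ x, θ x * F x := fun F => rfl
  rw [e, e, h1, ← h2]
  refine integral_congr_ae ?_
  filter_upwards [hf'.coeFn_toLp] with x hx
  rw [hx, SchwartzMap.fourierInv_coe]

theorem memLp_fourierInv {f : ℝ → ℂ} (hf : Integrable f) (hf' : MemLp f 2) : MemLp (𝓕⁻ f) 2 :=
  (memLp_congr_ae (fourierInv_toLp_ae_eq hf hf')).1 (Lp.memLp _)

theorem eLpNorm_fourier {f : ℝ → ℂ} (hf : Integrable f) (hf' : MemLp f 2) :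
    eLpNorm (𝓕 f) 2 = eLpNorm f 2 := by
  rw [← eLpNorm_congr_ae (fourier_toLp_ae_eq hf hf'), ← eLpNorm_congr_ae hf'.coeFn_toLp,
    ← Lp.enorm_def, ← Lp.enorm_def, ← ofReal_norm, ← ofReal_norm, Lp.norm_fourier_eq]

theorem eLpNorm_fourierInv {f : ℝ → ℂ} (hf : Integrable f) (hf' : MemLp f 2) :
    eLpNorm (𝓕⁻ f) 2 = eLpNorm f 2 := by
  rw [← eLpNorm_congr_ae (fourierInv_toLp_ae_eq hf hf'), ← eLpNorm_congr_ae hf'.coeFn_toLp,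
    ← Lp.enorm_def, ← Lp.enorm_def, ← ofReal_norm, ← ofReal_norm]
  congr 1
  exact (Lp.fourierTransformₗᵢ ℝ ℂ).symm.norm_map _

theorem toLp_fourierInv {f : ℝ → ℂ} (hf : Integrable f) (hf' : MemLp f 2) :
    (memLp_fourierInv hf hf').toLp (𝓕⁻ f) = 𝓕⁻ (hf'.toLp f) := by
  apply Lp.ext
  exact (MemLp.coeFn_toLp _).trans (fourierInv_toLp_ae_eq hf hf').symm

theorem fourier_fourierInv_toLp {f : ℝ → ℂ} (hf : Integrable f) (hf' : MemLp f 2) :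
    𝓕 ((memLp_fourierInv hf hf').toLp (𝓕⁻ f)) = hf'.toLp f := by
  rw [toLp_fourierInv hf hf', fourier_fourierInv_eq]

/-- Fourier inversion on `L¹ ∩ L²`. -/
theorem fourier_fourierInv_ae_eq {f : ℝ → ℂ} (hf : Integrable f) (hf' : MemLp f 2)
    (hi : Integrable (𝓕⁻ f)) : 𝓕 (𝓕⁻ f) =ᵐ[volume] f := by
  have h1 := fourier_toLp_ae_eq hi (memLp_fourierInv hf hf')
  rw [fourier_fourierInv_toLp hf hf'] at h1
  exact h1.symm.trans hf'.coeFn_toLp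

end

/-! ### `H¹` through translations and through the Fourier transform -/

section

open FourierTransform SchwartzMap

/-! ### Inequalities for `L²` norms -/

theorem eLpNorm_two_sq {β E : Type*} [MeasurableSpace β] [NormedAddCommGroup E] (f : β → E)
    (μ : Measure β) : eLpNorm f 2 μ ^ 2 = ∫⁻ x, ‖f x‖ₑ ^ 2 ∂μ := by
  have := eLpNorm_nnreal_pow_eq_lintegral (μ := μ) (f := f) (p := 2) two_ne_zero
  simpa using this

theorem eLpNorm_two_le_iff {β E : Type*} [MeasurableSpace β] [NormedAddCommGroup E] {f : β → E}
    {μ : Measure β} {c : ℝ≥0∞} : eLpNorm f 2 μ ≤ c ↔ ∫⁻ x, ‖f x‖ₑ ^ 2 ∂μ ≤ c ^ 2 := by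
  rw [← eLpNorm_two_sq]
  exact (ENNReal.pow_right_strictMono two_ne_zero).le_iff_le.symm

theorem sq_lintegral_mul_le {β : Type*} [MeasurableSpace β] {μ : Measure β} {f g : β → ℝ≥0∞}
    (hf : AEMeasurable f μ) (hg : AEMeasurable g μ) :
    (∫⁻ x, f x * g x ∂μ) ^ 2 ≤ (∫⁻ x, f x ^ 2 ∂μ) * ∫⁻ x, g x ^ 2 ∂μ := by
  have h := ENNReal.lintegral_mul_le_Lp_mul_Lq μ Real.HolderConjugate.two_two hf hg
  simp only [ENNReal.rpow_ofNat, Pi.mul_apply] at h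
  have h2 := pow_le_pow_left' h 2
  refine h2.trans_eq ?_
  rw [mul_pow, ← ENNReal.rpow_natCast, ← ENNReal.rpow_natCast, ← ENNReal.rpow_mul,
    ← ENNReal.rpow_mul]
  norm_num

theorem lintegral_mul_le_eLpNorm_two {β E F : Type*} [MeasurableSpace β] [NormedAddCommGroup E]
    [NormedAddCommGroup F] {μ : Measure β} {f : β → E} {g : β → F}
    (hf : AEStronglyMeasurable f μ) (hg : AEStronglyMeasurable g μ) :
    ∫⁻ x, ‖f x‖ₑ * ‖g x‖ₑ ∂μ ≤ eLpNorm f 2 μ * eLpNorm g 2 μ := by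
  rw [← (ENNReal.pow_right_strictMono two_ne_zero).le_iff_le, mul_pow, eLpNorm_two_sq,
    eLpNorm_two_sq]
  exact sq_lintegral_mul_le hf.enorm hg.enorm

/-- Minkowski's integral inequality in `L²`. -/
theorem eLpNorm_integral_le {β γ E : Type*} [MeasurableSpace β] [MeasurableSpace γ]
    [NormedAddCommGroup E] [NormedSpace ℝ E] {μ : Measure β} {ν : Measure γ} [SFinite μ]
    [SFinite ν] {F : β → γ → E} (hF : StronglyMeasurable (Function.uncurry F)) :
    eLpNorm (fun x => ∫ s, F s x ∂μ) 2 ν ≤ ∫⁻ s, eLpNorm (F s) 2 ν ∂μ := by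
  have hm : Measurable fun p : β × γ => ‖F p.1 p.2‖ₑ := hF.enorm
  have hsec : ∀ s, Measurable fun x => ‖F s x‖ₑ := fun s => hm.comp measurable_prodMk_left
  have hsec' : ∀ x, Measurable fun s => ‖F s x‖ₑ := fun x => hm.comp measurable_prodMk_right
  have hN : Measurable fun s => eLpNorm (F s) 2 ν := by
    have : (fun s => eLpNorm (F s) 2 ν) = fun s => (∫⁻ x, ‖F s x‖ₑ ^ (2 : ℝ) ∂ν) ^ (1 / 2 : ℝ) := by
      funext s
      rw [eLpNorm_eq_lintegral_rpow_enorm_toReal two_ne_zero ENNReal.ofNat_ne_top]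
      simp
    rw [this]
    exact (hm.pow_const _).lintegral_prod_right'.pow_const _
  rw [eLpNorm_two_le_iff]
  -- The square of the inner integral is a double integral over `s` and `r`; after Tonelli,
  -- Cauchy–Schwarz in `x` separates the two variables.
  calc ∫⁻ x, ‖∫ s, F s x ∂μ‖ₑ ^ 2 ∂ν
      ≤ ∫⁻ x, (∫⁻ s, ‖F s x‖ₑ ∂μ) ^ 2 ∂ν :=
        lintegral_mono fun x => pow_le_pow_left' (enorm_integral_le_lintegral_enorm _) 2
    _ = ∫⁻ x, ∫⁻ s, ∫⁻ r, ‖F s x‖ₑ * ‖F r x‖ₑ ∂μ ∂μ ∂ν := by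
        refine lintegral_congr fun x => ?_
        rw [sq, ← lintegral_mul_const _ (hsec' x)]
        exact lintegral_congr fun s => (lintegral_const_mul _ (hsec' x)).symm
    _ = ∫⁻ s, ∫⁻ x, ∫⁻ r, ‖F s x‖ₑ * ‖F r x‖ₑ ∂μ ∂ν ∂μ := by
        refine lintegral_lintegral_swap ?_
        refine Measurable.aemeasurable ?_
        refine Measurable.lintegral_prod_right' (f := fun p : (γ × β) × β =>
          ‖F p.1.2 p.1.1‖ₑ * ‖F p.2 p.1.1‖ₑ) ?_
        exact (hm.comp (f := fun p : (γ × β) × β => (p.1.2, p.1.1)) (by fun_prop)).mul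
          (hm.comp (f := fun p : (γ × β) × β => (p.2, p.1.1)) (by fun_prop))
    _ = ∫⁻ s, ∫⁻ r, ∫⁻ x, ‖F s x‖ₑ * ‖F r x‖ₑ ∂ν ∂μ ∂μ := by
        refine lintegral_congr fun s => lintegral_lintegral_swap ?_
        refine Measurable.aemeasurable ?_
        exact ((hsec s).comp measurable_fst).mul (hm.comp measurable_swap)
    _ ≤ ∫⁻ s, ∫⁻ r, eLpNorm (F s) 2 ν * eLpNorm (F r) 2 ν ∂μ ∂μ := by
        refine lintegral_mono fun s => lintegral_mono fun r => ?_
        exact lintegral_mul_le_eLpNorm_two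
          (hF.comp_measurable measurable_prodMk_left).aestronglyMeasurable
          (hF.comp_measurable measurable_prodMk_left).aestronglyMeasurable
    _ = (∫⁻ s, eLpNorm (F s) 2 ν ∂μ) ^ 2 := by
        rw [sq, ← lintegral_mul_const _ hN]
        exact lintegral_congr fun s => lintegral_const_mul _ hN

/-! ### Weak derivatives and translations -/

/-- The translates of `h` differ from `h` by at most `D` times the shift, in `L²`. -/
def TransBd (h : ℝ → ℂ) (D : ℝ≥0∞) : Prop :=
  ∀ k : ℝ, eLpNorm (fun x => h (x + k) - h x) 2 volume ≤ ENNReal.ofReal |k| * D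

theorem TransBd.mono {h : ℝ → ℂ} {D D' : ℝ≥0∞} (H : TransBd h D) (hD : D ≤ D') : TransBd h D' :=
  fun k => (H k).trans (by gcongr)

/-- `x ↦ ∫₀ᵏ g (x - r) dr`, whose derivative is `g x - g (x - k)`. -/
theorem exists_primitive_difference {g : ℝ → ℝ} (hg : ContDiff ℝ ∞ g) (hgs : HasCompactSupport g)
    (k : ℝ) : ∃ θ : ℝ → ℝ, ContDiff ℝ ∞ θ ∧ HasCompactSupport θ ∧
      (∀ x, deriv θ x = g x - g (x - k)) ∧ ∀ x, θ x = ∫ r in (0 : ℝ)..k, g (x - r) := by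
  have hc := hg.continuous
  have hG : ∀ x, HasDerivAt (fun y => ∫ t in (0 : ℝ)..y, g t) (g x) x := fun x =>
    intervalIntegral.integral_hasDerivAt_right (hc.intervalIntegrable _ _)
      hc.stronglyMeasurable.stronglyMeasurableAtFilter hc.continuousAt
  have hGs : ContDiff ℝ ∞ fun y => ∫ t in (0 : ℝ)..y, g t := by
    rw [contDiff_infty_iff_deriv]
    refine ⟨fun x => (hG x).differentiableAt, ?_⟩
    rwa [show deriv (fun y => ∫ t in (0 : ℝ)..y, g t) = g from funext fun x => (hG x).deriv]
  have e : ∀ x, (∫ t in (0 : ℝ)..x, g t) - (∫ t in (0 : ℝ)..(x - k), g t) =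
      ∫ r in (0 : ℝ)..k, g (x - r) := by
    intro x
    rw [intervalIntegral.integral_interval_sub_left (hc.intervalIntegrable _ _)
      (hc.intervalIntegrable _ _), intervalIntegral.integral_comp_sub_left (fun t => g t) x]
    simp
  refine ⟨fun x => (∫ t in (0 : ℝ)..x, g t) - ∫ t in (0 : ℝ)..(x - k), g t, ?_, ?_, ?_, e⟩
  · exact hGs.sub (hGs.comp (contDiff_id.sub contDiff_const))
  · obtain ⟨A, hA⟩ := hgs.isCompact.isBounded.subset_closedBall (0 : ℝ)
    refine HasCompactSupport.of_support_subset_isCompact (isCompact_closedBall (0 : ℝ) (A + |k|)) ?_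
    intro x hx
    by_contra hx'
    apply hx
    change (∫ t in (0 : ℝ)..x, g t) - (∫ t in (0 : ℝ)..(x - k), g t) = 0
    rw [e]
    refine (intervalIntegral.integral_congr (g := fun _ => (0 : ℝ)) fun r hr => ?_).trans (by simp)
    by_contra hne
    have h1 := hA (subset_tsupport g hne)
    simp only [Metric.mem_closedBall, dist_zero_right, Real.norm_eq_abs, not_le] at h1 hx'
    have h2 : |r| ≤ |k| := by
      rcases le_total 0 k with hk | hk
      · rw [uIcc_of_le hk] at hr
        rw [abs_of_nonneg hr.1, abs_of_nonneg hk]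
        exact hr.2
      · rw [uIcc_of_ge hk] at hr
        rw [abs_of_nonpos hr.2, abs_of_nonpos hk]
        linarith [hr.1]
    have h3 := abs_sub_abs_le_abs_sub x r
    linarith
  · intro x
    have h2 : HasDerivAt (fun y => ∫ t in (0 : ℝ)..(y - k), g t) (g (x - k)) x := by
      have := (hG (x - k)).comp x ((hasDerivAt_id x).sub_const k)
      rwa [mul_one] at this
    exact ((hG x).sub h2).deriv

/-- The weak derivative is tested against `x ↦ ∫₀ᵏ g (x - r) dr`, whose derivative is a difference
of translates of `g`; Fubini then carries the average over the segment from `g` to `ψ`. -/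
theorem IsWeakDeriv.sub_translate_ae_eq {φ ψ : ℝ → ℂ} (H : IsWeakDeriv 1 φ ψ)
    (hψ : MemLp ψ 2) (k : ℝ) :
    (fun x => φ (x + k) - φ x) =ᵐ[volume] fun x => ∫ r in (0 : ℝ)..k, ψ (x + r) := by
  have hψi : ∀ a b : ℝ, IntervalIntegrable ψ volume a b := fun a b =>
    (H.2.1.integrableOn_isCompact isCompact_uIcc).intervalIntegrable
  have hφ' : LocallyIntegrable fun x => φ (x + k) := by
    have := (locallyIntegrable_map_homeomorph (μ := volume) (f := φ) (Homeomorph.addRight k)).1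
    rw [Homeomorph.coe_addRight, map_add_right_eq_self] at this
    exact this H.1
  have hR : Continuous fun x => ∫ r in (0 : ℝ)..k, ψ (x + r) := by
    have e : (fun x => ∫ r in (0 : ℝ)..k, ψ (x + r)) =
        fun x => (∫ t in (0 : ℝ)..(x + k), ψ t) - ∫ t in (0 : ℝ)..x, ψ t := by
      funext x
      rw [intervalIntegral.integral_interval_sub_left (hψi _ _) (hψi _ _),
        intervalIntegral.integral_comp_add_left (fun t => ψ t) x, add_zero]
    have hc := intervalIntegral.continuous_primitive hψi 0
    rw [e]
    exact (hc.comp (continuous_id.add continuous_const)).sub hc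
  refine ae_eq_of_integral_contDiff_smul_eq (hφ'.sub H.1) hR.locallyIntegrable ?_
  intro g hg hgs
  obtain ⟨θ, h1, h2, h3, h4⟩ := exists_primitive_difference hg hgs k
  have hw := H.2.2 (fun x => (θ x : ℂ)) (Complex.ofRealCLM.contDiff.comp h1)
    (h2.comp_left Complex.ofReal_zero)
  have hd : ∀ x, iteratedDeriv 1 (fun x => (θ x : ℂ)) x = ((g x - g (x - k) : ℝ) : ℂ) := by
    intro x
    rw [iteratedDeriv_one, ← h3 x]
    exact ((h1.differentiable (by simp) x).hasDerivAt.ofReal_comp).deriv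
  simp only [hd, pow_one, neg_mul, one_mul] at hw
  have i1 : Integrable fun x => g x • φ (x + k) :=
    hφ'.integrable_smul_left_of_hasCompactSupport hg.continuous hgs
  have i2 : Integrable fun x => g x • φ x :=
    H.1.integrable_smul_left_of_hasCompactSupport hg.continuous hgs
  set ρ : Measure ℝ := volume.restrict (uIoc 0 k) with hρ
  have : IsFiniteMeasure ρ := by
    rw [hρ]
    exact isFiniteMeasure_restrict.2 (by simp)
  obtain ⟨C, hC⟩ := hgs.exists_bound_of_continuous hg.continuous
  obtain ⟨A, hA⟩ := hgs.isCompact.isBounded.subset_closedBall (0 : ℝ)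
  have hG : Integrable (fun p : ℝ × ℝ => ψ p.2 * (g (p.2 - p.1) : ℂ)) (ρ.prod volume) := by
    -- For `|r| ≤ |k|` every translate `g (x - r)` vanishes outside this ball, on which `ψ` is
    -- integrable.
    have hK : Integrable (indicator (Metric.closedBall (0 : ℝ) (A + |k|)) ψ) :=
      (integrable_indicator_iff measurableSet_closedBall).2
        (H.2.1.integrableOn_isCompact (isCompact_closedBall _ _))
    refine ((integrable_const C : Integrable (fun _ => C) ρ).mul_prod hK.norm).mono' ?_ ?_
    · exact hψ.1.comp_snd.mul (by
        have := hg.continuous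
        exact Continuous.aestronglyMeasurable (by fun_prop))
    · have hmem : ∀ᵐ p : ℝ × ℝ ∂(ρ.prod volume), p.1 ∈ uIoc 0 k := by
        have h0 : ∀ᵐ r ∂ρ, r ∈ uIoc 0 k := ae_restrict_mem measurableSet_uIoc
        exact Measure.quasiMeasurePreserving_fst.ae h0
      filter_upwards [hmem] with p hp
      rw [norm_mul, mul_comm]
      by_cases hx : p.2 ∈ Metric.closedBall (0 : ℝ) (A + |k|)
      · rw [indicator_of_mem hx]
        gcongr
        simpa using hC (p.2 - p.1)
      · have hz : g (p.2 - p.1) = 0 := by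
          by_contra hne
          have h1 := hA (subset_tsupport g hne)
          simp only [Metric.mem_closedBall, dist_zero_right, Real.norm_eq_abs, not_le] at h1 hx
          have h2 : |p.1| ≤ |k| := by
            have := abs_sub_left_of_mem_uIcc (uIoc_subset_uIcc hp)
            simpa using this
          have h3 := abs_sub_abs_le_abs_sub p.2 p.1
          linarith
        rw [hz, indicator_of_notMem hx]
        simp
  have hF : Integrable (fun p : ℝ × ℝ => ψ (p.1 + p.2) * (g p.2 : ℂ)) (ρ.prod volume) := by
    have := (measurePreserving_prod_add ρ volume).integrable_comp_of_integrable hG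
    refine this.congr (.of_forall fun p => ?_)
    simp
  have hk : ∀ f : ℝ → ℂ, ∫ r in (0 : ℝ)..k, f r = (if 0 ≤ k then (1 : ℂ) else -1) * ∫ r, f r ∂ρ := by
    intro f
    rw [intervalIntegral.intervalIntegral_eq_integral_uIoc]
    split_ifs <;> simp [ρ]
  calc ∫ x, g x • (φ (x + k) - φ x)
      = (∫ x, g x • φ (x + k)) - ∫ x, g x • φ x := by
        rw [← integral_sub i1 i2]
        exact integral_congr_ae (.of_forall fun x => smul_sub _ _ _)
    _ = (∫ x, g (x - k) • φ x) - ∫ x, g x • φ x := by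
        rw [← integral_add_right_eq_self (fun x => g (x - k) • φ x) k]
        simp
    _ = -∫ x, φ x * ((g x - g (x - k) : ℝ) : ℂ) := by
        have i3 : Integrable fun x => g (x - k) • φ x := by
          have := i1.comp_sub_right k
          simpa using this
        rw [← integral_sub i3 i2, ← integral_neg]
        refine integral_congr_ae (.of_forall fun x => ?_)
        simp only [Complex.real_smul]
        push_cast
        ring
    _ = ∫ x, ψ x * (θ x : ℂ) := by rw [hw, neg_neg]
    _ = (if 0 ≤ k then (1 : ℂ) else -1) * ∫ x, ∫ r, ψ x * (g (x - r) : ℂ) ∂ρ := by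
        rw [← integral_const_mul]
        refine integral_congr_ae (.of_forall fun x => ?_)
        simp only
        rw [h4, ← intervalIntegral.integral_ofReal, hk, integral_const_mul]
        ring
    _ = (if 0 ≤ k then (1 : ℂ) else -1) * ∫ x, ∫ r, ψ (r + x) * (g x : ℂ) ∂ρ := by
        congr 1
        rw [integral_integral_swap (f := fun x r => ψ x * (g (x - r) : ℂ)) hG.swap,
          integral_integral_swap (f := fun x r => ψ (r + x) * (g x : ℂ)) hF.swap]
        refine integral_congr_ae (.of_forall fun r => ?_)
        simp only
        rw [← integral_add_left_eq_self (fun x => ψ x * (g (x - r) : ℂ)) r]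
        simp
    _ = ∫ x, g x • ∫ r in (0 : ℝ)..k, ψ (x + r) := by
        rw [← integral_const_mul]
        refine integral_congr_ae (.of_forall fun x => ?_)
        simp only
        rw [hk, integral_mul_const, Complex.real_smul]
        simp only [add_comm x]
        ring

theorem IsWeakDeriv.transBd {φ ψ : ℝ → ℂ} (H : IsWeakDeriv 1 φ ψ) :
    TransBd φ (eLpNorm ψ 2) := by
  intro k
  rcases eq_or_ne k 0 with rfl | hk
  · simp
  rcases eq_or_ne (eLpNorm ψ 2) ⊤ with ht | ht
  · rw [ht, ENNReal.mul_top (by simpa using hk)]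
    exact le_top
  have hψ : MemLp ψ 2 := ⟨H.2.1.aestronglyMeasurable, ht.lt_top⟩
  -- Minkowski's inequality needs joint measurability of `(r, x) ↦ ψ (x + r)`, hence a measurable
  -- representative.
  set ψ' := hψ.1.mk ψ
  have hm : StronglyMeasurable ψ' := hψ.1.stronglyMeasurable_mk
  have he : ψ =ᵐ[volume] ψ' := hψ.1.ae_eq_mk
  have H' : IsWeakDeriv 1 φ ψ' := by
    refine ⟨H.1, (hψ.ae_eq he).locallyIntegrable one_le_two, fun θ h1 h2 => ?_⟩
    rw [H.2.2 θ h1 h2]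
    congr 1
    refine integral_congr_ae ?_
    filter_upwards [he] with x hx
    rw [hx]
  rw [eLpNorm_congr_ae (H'.sub_translate_ae_eq (hψ.ae_eq he) k), eLpNorm_congr_ae he]
  have e : ∀ x, ‖∫ r in (0 : ℝ)..k, ψ' (x + r)‖ = ‖∫ r in uIoc 0 k, ψ' (x + r)‖ := fun x =>
    intervalIntegral.norm_intervalIntegral_eq _ _ _ _
  rw [eLpNorm_congr_norm_ae (.of_forall e)]
  refine (eLpNorm_integral_le (F := fun r x => ψ' (x + r)) (μ := volume.restrict (uIoc 0 k)) ?_).trans ?_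
  · exact hm.comp_measurable (measurable_snd.add measurable_fst)
  · have : ∀ r, eLpNorm (fun x => ψ' (x + r)) 2 volume = eLpNorm ψ' 2 := fun r =>
      eLpNorm_comp_measurePreserving (g := ψ') hm.aestronglyMeasurable
        (measurePreserving_add_right volume r)
    simp only [this, lintegral_const, Measure.restrict_apply_univ, Real.volume_uIoc, sub_zero]
    rw [mul_comm]

theorem transBd_derivL2 (φ : ℝ → ℂ) : TransBd φ (derivL2 1 φ) := by
  intro k
  -- The factor `|k|` passes through the infimum only when it is nonzero: the infimum over no weak
  -- derivative is `⊤`, and `0 * ⊤ = 0`.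
  rcases eq_or_ne k 0 with rfl | hk
  · simp
  unfold derivL2
  have h0 : ENNReal.ofReal |k| ≠ 0 := by simpa using hk
  rw [ENNReal.mul_iInf_of_ne h0 ENNReal.ofReal_ne_top]
  refine le_iInf fun ψ => ?_
  rw [ENNReal.mul_iInf_of_ne h0 ENNReal.ofReal_ne_top]
  exact le_iInf fun H => H.transBd k

theorem isWeakDeriv_zero_iff {φ ψ : ℝ → ℂ} :
    IsWeakDeriv 0 φ ψ ↔ LocallyIntegrable φ ∧ φ =ᵐ[volume] ψ := by
  constructor
  · rintro ⟨h1, h2, h3⟩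
    refine ⟨h1, ae_eq_of_integral_contDiff_smul_eq h1 h2 fun g hg hgs => ?_⟩
    have := h3 (fun x => (g x : ℂ)) (Complex.ofRealCLM.contDiff.comp hg)
      (hgs.comp_left Complex.ofReal_zero)
    simpa [Complex.real_smul, mul_comm] using this
  · rintro ⟨h1, h2⟩
    refine ⟨h1, ?_, fun θ _ _ => ?_⟩
    · intro x
      obtain ⟨s, hs, hi⟩ := h1 x
      exact ⟨s, hs, hi.congr_fun_ae (ae_restrict_of_ae h2)⟩
    · simp only [iteratedDeriv_zero, pow_zero, one_mul]
      refine integral_congr_ae ?_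
      filter_upwards [h2] with x hx
      rw [hx]

theorem eLpNorm_le_derivL2_zero (φ : ℝ → ℂ) : eLpNorm φ 2 ≤ derivL2 0 φ := by
  refine le_iInf fun ψ => le_iInf fun H => ?_
  rw [eLpNorm_congr_ae (isWeakDeriv_zero_iff.1 H).2]

theorem derivL2_zero_le {φ : ℝ → ℂ} (h : LocallyIntegrable φ) : derivL2 0 φ ≤ eLpNorm φ 2 :=
  iInf_le_of_le φ (iInf_le _ (isWeakDeriv_zero_iff.2 ⟨h, .rfl⟩))

/-! ### The Fourier side of `H¹` -/

theorem fourierInv_translate (f : ℝ → ℂ) (k x : ℝ) :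
    𝓕⁻ (fun y => f (y + k)) x = Complex.exp (-(2 * Real.pi * k * x : ℝ) * Complex.I) * 𝓕⁻ f x := by
  rw [Real.fourierInv_eq', Real.fourierInv_eq', ← integral_const_mul,
    ← integral_sub_right_eq_self _ k]
  refine integral_congr_ae (.of_forall fun y => ?_)
  simp only [smul_eq_mul, sub_add_cancel, ← mul_assoc, ← Complex.exp_add]
  congr 2
  simp
  ring

theorem fourierInv_sub {f g : ℝ → ℂ} (hf : Integrable f) (hg : Integrable g) (x : ℝ) :
    𝓕⁻ (fun y => f y - g y) x = 𝓕⁻ f x - 𝓕⁻ g x := by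
  rw [Real.fourierInv_eq', Real.fourierInv_eq', Real.fourierInv_eq', ← integral_sub]
  · simp only [smul_sub]
  all_goals
    refine Integrable.bdd_mul (c := 1) (by assumption) ?_ (.of_forall fun y => ?_)
    · exact Continuous.aestronglyMeasurable (by fun_prop)
    · exact (Complex.norm_exp_ofReal_mul_I _).le

/-- By Plancherel the difference quotient of step `k` becomes the multiplier `(exp (-2πikx) - 1) /
k`. As `k → 0` it tends to `-2πix`, and Fatou's lemma preserves the bound. -/
theorem TransBd.eLpNorm_mul_fourierInv_le {h : ℝ → ℂ} {D : ℝ≥0∞} (hi : Integrable h)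
    (h2 : MemLp h 2) (H : TransBd h D) :
    eLpNorm (fun x : ℝ => ((2 * Real.pi * x : ℝ) : ℂ) * 𝓕⁻ h x) 2 ≤ D := by
  set k : ℕ → ℝ := fun n => 1 / ((n : ℝ) + 1)
  have hk : ∀ n, 0 < k n := fun n => by positivity
  set F : ℕ → ℝ → ℝ≥0∞ := fun n x =>
    ‖((k n : ℂ))⁻¹ * (Complex.exp (-(2 * Real.pi * k n * x : ℝ) * Complex.I) - 1) * 𝓕⁻ h x‖ₑ ^ 2
  have hu := continuous_fourierInv hi
  have hFm : ∀ n, Measurable (F n) := fun n =>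
    Continuous.measurable (by fun_prop)
  have hF : ∀ n, ∫⁻ x, F n x ≤ D ^ 2 := by
    intro n
    have hi' : Integrable fun x => h (x + k n) := hi.comp_add_right _
    have h2' : MemLp (fun x => h (x + k n)) 2 :=
      h2.comp_measurePreserving (measurePreserving_add_right volume (k n))
    have e := eLpNorm_fourierInv (hi'.sub hi) (h2'.sub h2)
    have e1 : 𝓕⁻ ((fun x => h (x + k n)) - h) =
        fun x => (Complex.exp (-(2 * Real.pi * k n * x : ℝ) * Complex.I) - 1) * 𝓕⁻ h x := by
      funext x
      rw [show ((fun x => h (x + k n)) - h) = fun x => h (x + k n) - h x from rfl,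
        fourierInv_sub hi' hi, fourierInv_translate]
      ring
    rw [e1] at e
    have hT : eLpNorm ((fun x => h (x + k n)) - h) 2 volume ≤ ENNReal.ofReal |k n| * D := H (k n)
    rw [← e, eLpNorm_two_le_iff] at hT
    have : ∀ x, F n x = ENNReal.ofReal (k n)⁻¹ ^ 2 *
        ‖(Complex.exp (-(2 * Real.pi * k n * x : ℝ) * Complex.I) - 1) * 𝓕⁻ h x‖ₑ ^ 2 := by
      intro x
      simp only [F]
      rw [mul_assoc, enorm_mul, mul_pow]
      congr 2
      rw [← Complex.ofReal_inv, ← ofReal_norm, Complex.norm_real, Real.norm_of_nonneg]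
      exact (inv_pos.2 (hk n)).le
    simp only [this]
    rw [lintegral_const_mul' _ _ (by finiteness)]
    calc _ ≤ ENNReal.ofReal (k n)⁻¹ ^ 2 * (ENNReal.ofReal |k n| * D) ^ 2 := by gcongr
      _ = D ^ 2 := by
        rw [← mul_pow, ← mul_assoc, ← ENNReal.ofReal_mul (inv_pos.2 (hk n)).le,
          abs_of_pos (hk n), inv_mul_cancel₀ (hk n).ne']
        simp
  rw [eLpNorm_two_le_iff]
  have hlim : ∀ x, Filter.Tendsto (fun n => F n x) Filter.atTop
      (nhds (‖((2 * Real.pi * x : ℝ) : ℂ) * 𝓕⁻ h x‖ₑ ^ 2)) := by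
    intro x
    have hd : HasDerivAt (fun y : ℝ => Complex.exp (-(2 * Real.pi * y * x : ℝ) * Complex.I))
        (-(2 * Real.pi * x : ℝ) * Complex.I) 0 := by
      have h1 : HasDerivAt (fun y : ℝ => (-(2 * Real.pi * y * x : ℝ) : ℂ) * Complex.I)
          (-(2 * Real.pi * x : ℝ) * Complex.I) 0 := by
        have h0 : HasDerivAt (fun y : ℝ => 2 * Real.pi * y * x) (2 * Real.pi * x) 0 := by
          simpa using ((hasDerivAt_id (0 : ℝ)).const_mul (2 * Real.pi)).mul_const x
        simpa using h0.ofReal_comp.neg.mul_const Complex.I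
      simpa using h1.cexp
    have hs := hd.tendsto_slope_zero_right
    have hkt : Filter.Tendsto k Filter.atTop (nhdsWithin 0 (Ioi 0)) := by
      refine tendsto_nhdsWithin_iff.2 ⟨tendsto_one_div_add_atTop_nhds_zero_nat, .of_forall hk⟩
    have h1 := hs.comp hkt
    have h2 := (ENNReal.continuous_pow 2).continuousAt.tendsto.comp (h1.mul_const (𝓕⁻ h x)).enorm
    have e : ‖((2 * Real.pi * x : ℝ) : ℂ) * 𝓕⁻ h x‖ₑ =
        ‖-((2 * Real.pi * x : ℝ) : ℂ) * Complex.I * 𝓕⁻ h x‖ₑ := by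
      simp [enorm_mul, show ‖Complex.I‖ₑ = 1 by simp [← ofReal_norm]]
    rw [e]
    refine h2.congr fun n => ?_
    simp [F, Complex.real_smul, mul_assoc]
  calc ∫⁻ x, ‖((2 * Real.pi * x : ℝ) : ℂ) * 𝓕⁻ h x‖ₑ ^ 2
      = ∫⁻ x, Filter.liminf (fun n => F n x) Filter.atTop :=
        lintegral_congr fun x => (hlim x).liminf_eq.symm
    _ ≤ Filter.liminf (fun n => ∫⁻ x, F n x) Filter.atTop := lintegral_liminf_le hFm
    _ ≤ D ^ 2 := Filter.liminf_le_of_le (by isBoundedDefault) fun b hb => by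
        obtain ⟨n, hn⟩ := hb.exists
        exact hn.trans (hF n)

/-- Converse of `transBd_derivL2`. The candidate derivative is the `L²` Fourier transform of `-2πix
𝓕⁻ h`. Paired with a test function, the transform moves onto the latter, where the multiplier
becomes a derivative. -/
theorem derivL2_one_le {h : ℝ → ℂ} {D : ℝ≥0∞} (hi : Integrable h) (h2 : MemLp h 2)
    (H : TransBd h D) (hD : D ≠ ⊤) : derivL2 1 h ≤ D := by
  have hle := H.eLpNorm_mul_fourierInv_le hi h2
  set m : ℝ → ℂ := fun x => -((2 * Real.pi * x : ℝ) : ℂ) * Complex.I * 𝓕⁻ h x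
  have hmn : eLpNorm m 2 = eLpNorm (fun x : ℝ => ((2 * Real.pi * x : ℝ) : ℂ) * 𝓕⁻ h x) 2 :=
    eLpNorm_congr_norm_ae (.of_forall fun x => by simp [m])
  have hm : MemLp m 2 := by
    refine ⟨Continuous.aestronglyMeasurable ?_, (hmn.trans_le hle).trans_lt hD.lt_top⟩
    have := continuous_fourierInv hi
    fun_prop
  set ψ : Lp ℂ 2 (volume : Measure ℝ) := 𝓕 (hm.toLp m)
  have hψ : eLpNorm (ψ : ℝ → ℂ) 2 volume ≤ D := by
    have e : eLpNorm (ψ : ℝ → ℂ) 2 volume = eLpNorm (hm.toLp m : ℝ → ℂ) 2 volume := by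
      rw [← Lp.enorm_def, ← Lp.enorm_def, ← ofReal_norm, ← ofReal_norm, Lp.norm_fourier_eq]
    rw [e, eLpNorm_congr_ae hm.coeFn_toLp, hmn]
    exact hle
  unfold derivL2
  refine le_trans (iInf₂_le (ψ : ℝ → ℂ) ?_) hψ
  refine ⟨hi.locallyIntegrable, (Lp.memLp _).locallyIntegrable one_le_two, fun θ hθ hθs => ?_⟩
  set Θ : 𝓢(ℝ, ℂ) := HasCompactSupport.toSchwartzMap hθs hθ
  have hΘ : ∀ x, Θ x = θ x := fun x => rfl
  have hd : ∀ x, (SchwartzMap.derivCLM ℂ ℂ Θ) x = iteratedDeriv 1 θ x := fun x => by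
    rw [iteratedDeriv_one]
    rfl
  have hu2 := memLp_fourierInv hi h2
  calc ∫ x, h x * iteratedDeriv 1 θ x
      = ∫ x, (SchwartzMap.derivCLM ℂ ℂ Θ) x *
          (𝓕 (hu2.toLp (𝓕⁻ h)) : Lp ℂ 2 (volume : Measure ℝ)) x := by
        rw [fourier_fourierInv_toLp hi h2]
        refine integral_congr_ae ?_
        filter_upwards [h2.coeFn_toLp] with x hx
        rw [hx, hd, mul_comm]
    _ = ∫ x, (𝓕 (SchwartzMap.derivCLM ℂ ℂ Θ)) x * (hu2.toLp (𝓕⁻ h)) x :=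
        integral_schwartz_mul_fourier_Lp _ _
    _ = ∫ x, -((𝓕 Θ) x * (hm.toLp m) x) := by
        refine integral_congr_ae ?_
        filter_upwards [hu2.coeFn_toLp, hm.coeFn_toLp] with x hx hx'
        have hF : 𝓕 (deriv Θ) x = (2 * Real.pi * Complex.I * x) • 𝓕 Θ x := by
          rw [Real.fourier_deriv (Θ.integrable (μ := volume)) Θ.differentiable
            ((SchwartzMap.derivCLM ℂ ℂ Θ).integrable (μ := volume)), SchwartzMap.fourier_coe]
        rw [hx, hx', SchwartzMap.fourier_coe,
          show ⇑(SchwartzMap.derivCLM ℂ ℂ Θ) = deriv Θ from rfl, hF, smul_eq_mul]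
        simp only [m]
        push_cast
        ring
    _ = (-1) ^ 1 * ∫ x, ψ x * θ x := by
        rw [integral_neg, ← integral_schwartz_mul_fourier_Lp]
        simp only [pow_one, neg_mul, one_mul, hΘ, mul_comm, ψ]

end

/-! ### The Sobolev inequality and weighted `L¹` norms on the Fourier side -/

section

open FourierTransform SchwartzMap

/-! ### Weighted bounds for the inverse Fourier transform of a function in `H¹` -/

/-- Plancherel, with `π²x² = (2πx)²/4`. The coefficient `π²` makes the integral of the reciprocal
weight equal to `1`; the resulting Sobolev constants `1` and `1/2` are the ones that lead to the
`3/2` of the main estimate. -/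
theorem lintegral_weight_mul_fourierInv_sq_le {h : ℝ → ℂ} {D : ℝ≥0∞} (hi : Integrable h)
    (h2 : MemLp h 2) (H : TransBd h D) :
    ∫⁻ x, ENNReal.ofReal (1 + Real.pi ^ 2 * x ^ 2) * ‖𝓕⁻ h x‖ₑ ^ 2 ≤
      (eLpNorm h 2 + 2⁻¹ * D) ^ 2 := by
  have hu := continuous_fourierInv hi
  have e : ∀ x : ℝ, ENNReal.ofReal (1 + Real.pi ^ 2 * x ^ 2) * ‖𝓕⁻ h x‖ₑ ^ 2 =
      ‖𝓕⁻ h x‖ₑ ^ 2 + (2⁻¹) ^ 2 * ‖((2 * Real.pi * x : ℝ) : ℂ) * 𝓕⁻ h x‖ₑ ^ 2 := by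
    intro x
    have : ENNReal.ofReal (Real.pi ^ 2 * x ^ 2) =
        (2⁻¹) ^ 2 * ‖((2 * Real.pi * x : ℝ) : ℂ)‖ₑ ^ 2 := by
      have h2 : (2⁻¹ : ℝ≥0∞) = ENNReal.ofReal (2⁻¹) := by
        rw [ENNReal.ofReal_inv_of_pos two_pos]
        simp
      rw [← ofReal_norm, Complex.norm_real, h2,
        ← ENNReal.ofReal_pow (by norm_num), ← ENNReal.ofReal_pow (by positivity),
        ← ENNReal.ofReal_mul (by norm_num)]
      congr 1
      rw [Real.norm_eq_abs, sq_abs]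
      ring
    rw [ENNReal.ofReal_add zero_le_one (by positivity), this, enorm_mul, ENNReal.ofReal_one]
    ring
  simp only [e]
  rw [lintegral_add_left (hu.measurable.enorm.pow_const 2),
    lintegral_const_mul' _ _ (by finiteness), ← eLpNorm_two_sq, ← eLpNorm_two_sq,
    eLpNorm_fourierInv hi h2, ← mul_pow]
  have := H.eLpNorm_mul_fourierInv_le hi h2
  refine (add_le_add le_rfl (pow_le_pow_left' (mul_le_mul_right this _) 2)).trans ?_
  rw [add_sq]
  exact add_le_add_left le_self_add _

/-- Cauchy–Schwarz for `∫ κ |u|` with the weight `1 + π² x²`. -/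
theorem lintegral_mul_fourierInv_le {h : ℝ → ℂ} {D : ℝ≥0∞} (hi : Integrable h)
    (h2 : MemLp h 2) (H : TransBd h D) {κ : ℝ → ℝ} (hκ : Continuous κ) (hκ0 : ∀ x, 0 ≤ κ x) :
    (∫⁻ x, ENNReal.ofReal (κ x) * ‖𝓕⁻ h x‖ₑ) ^ 2 ≤
      (∫⁻ x, ENNReal.ofReal (κ x ^ 2 * (1 + Real.pi ^ 2 * x ^ 2)⁻¹)) *
        (eLpNorm h 2 + 2⁻¹ * D) ^ 2 := by
  have hu := continuous_fourierInv hi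
  set g : ℝ → ℝ := fun x => 1 + Real.pi ^ 2 * x ^ 2
  have hg : ∀ x, 0 < g x := fun x => by positivity
  have hgc : Continuous g := by fun_prop
  have e : ∀ x, ENNReal.ofReal (κ x) * ‖𝓕⁻ h x‖ₑ =
      ENNReal.ofReal (κ x * (√(g x))⁻¹) * (ENNReal.ofReal √(g x) * ‖𝓕⁻ h x‖ₑ) := by
    intro x
    rw [← mul_assoc, ← ENNReal.ofReal_mul (mul_nonneg (hκ0 x) (by positivity)), mul_assoc,
      inv_mul_cancel₀ (Real.sqrt_pos.2 (hg x)).ne', mul_one]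
  simp only [e]
  refine (sq_lintegral_mul_le ?_ ?_).trans ?_
  · refine (Continuous.measurable ?_).ennreal_ofReal.aemeasurable
    exact hκ.mul ((Real.continuous_sqrt.comp hgc).inv₀ fun x => (Real.sqrt_pos.2 (hg x)).ne')
  · exact ((Real.continuous_sqrt.comp hgc).measurable.ennreal_ofReal.mul
      hu.measurable.enorm).aemeasurable
  · refine mul_le_mul' (lintegral_mono fun x => ?_)
      ((lintegral_mono fun x => ?_).trans (lintegral_weight_mul_fourierInv_sq_le hi h2 H))
    · rw [← ENNReal.ofReal_pow (mul_nonneg (hκ0 x) (by positivity)), mul_pow, inv_pow,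
        Real.sq_sqrt (hg x).le]
    · simp only
      rw [mul_pow, ← ENNReal.ofReal_pow (Real.sqrt_nonneg _), Real.sq_sqrt (hg x).le]

theorem lintegral_inv_one_add_pi_sq :
    ∫⁻ x : ℝ, ENNReal.ofReal (1 ^ 2 * (1 + Real.pi ^ 2 * x ^ 2)⁻¹) = 1 := by
  have h1 : ∀ x : ℝ, 1 ^ 2 * (1 + Real.pi ^ 2 * x ^ 2)⁻¹ = (1 + (Real.pi * x) ^ 2)⁻¹ := by
    intro x
    rw [one_pow, one_mul, mul_pow]
  simp only [h1]
  rw [← ofReal_integral_eq_lintegral_ofReal]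
  · rw [Measure.integral_comp_mul_left (fun y : ℝ => (1 + y ^ 2)⁻¹),
      integral_univ_inv_one_add_sq, abs_of_pos (by positivity), smul_eq_mul,
      inv_mul_cancel₀ Real.pi_ne_zero, ENNReal.ofReal_one]
  · exact integrable_inv_one_add_sq.comp_mul_left' Real.pi_ne_zero
  · exact .of_forall fun x => by positivity

theorem lintegral_fourierInv_le {h : ℝ → ℂ} {D : ℝ≥0∞} (hi : Integrable h)
    (h2 : MemLp h 2) (H : TransBd h D) :
    ∫⁻ x, ‖𝓕⁻ h x‖ₑ ≤ eLpNorm h 2 + 2⁻¹ * D := by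
  have := lintegral_mul_fourierInv_le hi h2 H (κ := fun _ => 1) continuous_const
    fun _ => zero_le_one
  rw [lintegral_inv_one_add_pi_sq] at this
  simpa [(ENNReal.pow_right_strictMono two_ne_zero).le_iff_le] using this

theorem integrable_fourierInv {h : ℝ → ℂ} {D : ℝ≥0∞} (hi : Integrable h)
    (h2 : MemLp h 2) (H : TransBd h D) (hD : D ≠ ⊤) : Integrable (𝓕⁻ h) := by
  refine ⟨(continuous_fourierInv hi).aestronglyMeasurable, ?_⟩
  refine (lintegral_fourierInv_le hi h2 H).trans_lt ?_
  exact ENNReal.add_lt_top.2 ⟨h2.2, ENNReal.mul_lt_top (by simp) hD.lt_top⟩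

/-- The Sobolev bound of `H¹` in `L^∞`. -/
theorem normLinf_le {h : ℝ → ℂ} {D : ℝ≥0∞} (hi : Integrable h)
    (h2 : MemLp h 2) (H : TransBd h D) : normLinf h ≤ eLpNorm h 2 + 2⁻¹ * D := by
  rcases eq_or_ne D ⊤ with rfl | hD
  · simp
  have hu := integrable_fourierInv hi h2 H hD
  unfold normLinf
  rw [← eLpNorm_congr_ae (fourier_fourierInv_ae_eq hi h2 hu), eLpNorm_exponent_top]
  refine (eLpNormEssSup_le_of_ae_enorm_bound (.of_forall fun ξ => ?_)).trans
    (lintegral_fourierInv_le hi h2 H)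
  rw [Real.fourier_eq]
  refine (enorm_integral_le_lintegral_enorm _).trans_eq (lintegral_congr fun x => ?_)
  rw [← ofReal_norm, ← ofReal_norm, Circle.norm_smul]

/-! ### Functions with bounds in `L^∞` and `H¹` -/

/-- `h` is integrable, bounded by `L`, and of `H¹` size at most `N`. -/
structure ProfileBd (h : ℝ → ℂ) (L N : ℝ) : Prop where
  integrable : Integrable h
  L_nonneg : 0 ≤ L
  N_nonneg : 0 ≤ N
  linf : normLinf h ≤ ENNReal.ofReal L
  l2 : eLpNorm h 2 ≤ ENNReal.ofReal N
  trans : TransBd h (ENNReal.ofReal N)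

namespace ProfileBd

variable {h : ℝ → ℂ} {L N : ℝ}

theorem memLp (H : ProfileBd h L N) : MemLp h 2 :=
  ⟨H.integrable.1, H.l2.trans_lt ENNReal.ofReal_lt_top⟩

theorem integrable_fourierInv (H : ProfileBd h L N) : Integrable (𝓕⁻ h) :=
  CoupledNLS.integrable_fourierInv H.integrable H.memLp H.trans ENNReal.ofReal_ne_top

theorem fourier_ae_eq (H : ProfileBd h L N) : 𝓕 (𝓕⁻ h) =ᵐ[volume] h :=
  fourier_fourierInv_ae_eq H.integrable H.memLp H.integrable_fourierInv

theorem ae_norm_le (H : ProfileBd h L N) : ∀ᵐ x, ‖h x‖ ≤ L := by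
  have h1 := enorm_ae_le_eLpNormEssSup h volume
  filter_upwards [h1] with x hx
  have h2 := hx.trans ((eLpNorm_exponent_top (f := h) (μ := volume)).symm.trans_le H.linf)
  rwa [← ofReal_norm, ENNReal.ofReal_le_ofReal_iff H.L_nonneg] at h2

end ProfileBd

/-- The weighted `L¹` norm of the inverse Fourier transform is bounded by the `H¹` norm. -/
theorem exists_lintegral_rpow_fourierInv_le {θ : ℝ} (hθ0 : 0 ≤ θ) (hθ : θ < 1 / 4) :
    ∃ C : ℝ, 0 ≤ C ∧ ∀ (h : ℝ → ℂ) (L N : ℝ), ProfileBd h L N →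
      ∫⁻ x, ENNReal.ofReal ((1 + x ^ 2) ^ θ) * ‖𝓕⁻ h x‖ₑ ≤ ENNReal.ofReal (C * N) := by
  set I : ℝ≥0∞ := ∫⁻ x : ℝ, ENNReal.ofReal (((1 + x ^ 2) ^ θ) ^ 2 * (1 + Real.pi ^ 2 * x ^ 2)⁻¹)
  have hI : I ≠ ⊤ := by
    -- At infinity the integrand is of order `|x|^(4θ - 2)`, which is integrable because `θ < 1/4`.
    have hi : Integrable fun x : ℝ => (1 + ‖x‖ ^ 2) ^ (-(2 - 4 * θ) / 2) :=
      integrable_rpow_neg_one_add_norm_sq (by simp; linarith)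
    refine (lt_of_le_of_lt (lintegral_mono fun x => ?_) hi.lintegral_lt_top).ne
    refine ENNReal.ofReal_le_ofReal ?_
    have hx : (0 : ℝ) < 1 + x ^ 2 := by positivity
    rw [Real.norm_eq_abs, sq_abs, show -(2 - 4 * θ) / 2 = θ * 2 + (-1) by ring,
      Real.rpow_add hx, Real.rpow_mul hx.le, Real.rpow_neg_one, Real.rpow_two]
    gcongr
    have := Real.pi_gt_three
    exact le_mul_of_one_le_left (sq_nonneg x) (one_le_pow₀ (by linarith))
  refine ⟨2 * √I.toReal, by positivity, fun h L N H => ?_⟩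
  have h1 := lintegral_mul_fourierInv_le H.integrable H.memLp H.trans
    (κ := fun x => (1 + x ^ 2) ^ θ)
    (Continuous.rpow_const (by fun_prop) fun x => .inr hθ0)
    fun x => by positivity
  rw [← (ENNReal.pow_right_strictMono two_ne_zero).le_iff_le]
  have h2 : eLpNorm h 2 + 2⁻¹ * ENNReal.ofReal N ≤ ENNReal.ofReal (2 * N) := by
    rw [two_mul, ENNReal.ofReal_add H.N_nonneg H.N_nonneg]
    refine add_le_add H.l2 ?_
    exact mul_le_of_le_one_left' (by simp)
  refine h1.trans ((mul_le_mul_right (pow_le_pow_left' h2 2) I).trans_eq ?_)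
  have := H.N_nonneg
  rw [← ENNReal.ofReal_toReal hI, ← ENNReal.ofReal_pow (by positivity),
    ← ENNReal.ofReal_mul (by positivity), ← ENNReal.ofReal_pow (by positivity)]
  congr 1
  rw [ENNReal.toReal_ofReal (by positivity), mul_pow, mul_pow, mul_pow,
    Real.sq_sqrt (by positivity)]
  ring

end

/-! ### The oscillatory integral of the remainder and its pointwise decay -/

section

open FourierTransform SchwartzMap

/-! ### The remainder on the Fourier side -/

/-- The character `t ↦ exp (i t)`. -/
def expI (t : ℝ) : ℂ := Complex.exp (t * Complex.I)

@[simp] theorem norm_expI (t : ℝ) : ‖expI t‖ = 1 := Complex.norm_exp_ofReal_mul_I t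

@[simp] theorem enorm_expI (t : ℝ) : ‖expI t‖ₑ = 1 := by simp [← ofReal_norm]

theorem expI_add (s t : ℝ) : expI (s + t) = expI s * expI t := by
  simp only [expI, ← Complex.exp_add]
  congr 1
  push_cast
  ring

theorem conj_expI (t : ℝ) : conj (expI t) = expI (-t) := by
  simp only [expI, ← Complex.exp_conj]
  congr 1
  simp

@[simp] theorem expI_zero : expI 0 = 1 := by simp [expI]

@[fun_prop] theorem continuous_expI : Continuous expI := by
  unfold expI
  fun_prop

theorem fourier_eq_expI (f : ℝ → ℂ) (ξ : ℝ) :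
    𝓕 f ξ = ∫ x, expI (-(2 * Real.pi * x * ξ)) * f x := by
  rw [Real.fourier_eq']
  refine integral_congr_ae (.of_forall fun x => ?_)
  simp only [expI, smul_eq_mul]
  congr 3
  simp
  ring

theorem fourierInv_eq_expI (f : ℝ → ℂ) (x : ℝ) :
    𝓕⁻ f x = ∫ ξ, expI (2 * Real.pi * x * ξ) * f ξ := by
  rw [Real.fourierInv_eq']
  refine integral_congr_ae (.of_forall fun ξ => ?_)
  simp only [expI, smul_eq_mul]
  congr 3
  simp
  ring

theorem integrable_mul_of_norm_le_one {β : Type*} [MeasurableSpace β] {μ : Measure β}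
    {f g : β → ℂ} (hg : Integrable g μ) (hf : AEStronglyMeasurable f μ) (hb : ∀ x, ‖f x‖ ≤ 1) :
    Integrable (fun x => f x * g x) μ :=
  hg.bdd_mul hf (.of_forall hb)

/-- The integrand, in `x`, of the Fourier transform of the trilinear expression at frequency
`2π q`. -/
def wave (u₁ u₂ u₃ : ℝ → ℂ) (ξ x : ℝ) (q : ℝ × ℝ) : ℂ :=
  expI (2 * Real.pi * (q.1 + q.2 - x) * ξ) * (conj (u₂ x) * (u₃ (x - q.1) * u₁ (x - q.2)))

theorem measurePreserving_shift :
    MeasurePreserving (fun p : ℝ × (ℝ × ℝ) => (p.1, ((p.1, p.1) : ℝ × ℝ) - p.2)) := by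
  refine MeasurePreserving.skew_product (f := id) (g := fun x q => ((x, x) : ℝ × ℝ) - q)
    (MeasurePreserving.id _) (by fun_prop) (.of_forall fun x => ?_)
  exact (Measure.measurePreserving_sub_left volume ((x, x) : ℝ × ℝ)).map_eq

section wave

variable {u₁ u₂ u₃ : ℝ → ℂ}

theorem integrable_conj {f : ℝ → ℂ} (hf : Integrable f) : Integrable fun x => conj (f x) := by
  refine hf.mono (Complex.continuous_conj.comp_aestronglyMeasurable hf.1) (.of_forall fun x => ?_)
  simp

theorem integrable_triple_product (h₁ : Integrable u₁) (h₂ : Integrable u₂) (h₃ : Integrable u₃) :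
    Integrable (fun p : ℝ × (ℝ × ℝ) => conj (u₂ p.1) * (u₃ p.2.1 * u₁ p.2.2)) :=
  (integrable_conj h₂).mul_prod (h₃.mul_prod h₁)

theorem integrable_wave (h₁ : Integrable u₁) (h₂ : Integrable u₂) (h₃ : Integrable u₃) (ξ : ℝ) :
    Integrable (fun p : ℝ × (ℝ × ℝ) => wave u₁ u₂ u₃ ξ p.1 p.2) := by
  have h := measurePreserving_shift.integrable_comp_of_integrable (integrable_triple_product h₁ h₂ h₃)
  refine integrable_mul_of_norm_le_one h ?_ fun p => by simp
  exact Continuous.aestronglyMeasurable (by fun_prop)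

theorem integral_expI_mul_reflect (h : ℝ → ℂ) (c ξ : ℝ) :
    ∫ η, expI (2 * Real.pi * c * η) * h (ξ - η) = expI (2 * Real.pi * c * ξ) * 𝓕⁻ h (-c) := by
  rw [← integral_sub_left_eq_self _ _ ξ, fourierInv_eq_expI, ← integral_const_mul]
  refine integral_congr_ae (.of_forall fun η => ?_)
  simp only [sub_sub_cancel, ← mul_assoc, ← expI_add]
  congr 2
  ring

theorem quasiMeasurePreserving_sub_sub (ξ : ℝ) :
    Measure.QuasiMeasurePreserving (fun p : ℝ × ℝ => ξ - p.1 - p.2) := by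
  have h1 : MeasurePreserving (fun p : ℝ × ℝ => (p.1, (ξ - p.1) - p.2)) :=
    MeasurePreserving.skew_product (f := id) (g := fun x y => (ξ - x) - y)
      (MeasurePreserving.id _) (by fun_prop)
      (.of_forall fun x => (Measure.measurePreserving_sub_left volume (ξ - x)).map_eq)
  exact Measure.quasiMeasurePreserving_snd.comp h1.quasiMeasurePreserving

/-- The Fourier transform of the trilinear expression, through the inverse Fourier transforms of
the factors. -/
theorem invFourier₂_triple {h₁ h₂ h₃ : ℝ → ℂ} (i₁ : Integrable h₁) (i₃ : Integrable h₃)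
    (i₂ : Integrable u₂) (e₂ : 𝓕 u₂ =ᵐ[volume] h₂) (s ξ : ℝ) (q : ℝ × ℝ) :
    invFourier₂ (triple (fun _ => h₁) (fun _ => h₂) (fun _ => h₃) s ξ) ((2 * Real.pi) • q) =
      ((1 / (2 * Real.pi) : ℝ) : ℂ) * ∫ x, wave (𝓕⁻ h₁) u₂ (𝓕⁻ h₃) ξ x q := by
  unfold invFourier₂
  congr 1
  -- Only the middle factor is expanded as a Fourier integral, in `x`. For fixed `x` the integrals
  -- in `η` and `σ` decouple into inverse transforms of `h₃` and `h₁`, so inversion is needed for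
  -- `h₂` alone.
  set G : ℝ × ℝ → ℝ → ℂ := fun p x => expI (2 * Real.pi * (q.1 * p.1 + q.2 * p.2) +
    2 * Real.pi * x * (ξ - p.1 - p.2)) * ((h₃ (ξ - p.1) * h₁ (ξ - p.2)) * conj (u₂ x))
  have hG : Integrable (Function.uncurry G) := by
    have := ((i₃.comp_sub_left ξ).mul_prod (i₁.comp_sub_left ξ)).mul_prod (integrable_conj i₂)
    refine integrable_mul_of_norm_le_one this ?_ fun p => by simp
    exact Continuous.aestronglyMeasurable (by fun_prop)
  calc ∫ p : ℝ × ℝ, Complex.exp (Complex.I * ((((2 * Real.pi) • q).1 * p.1 +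
        ((2 * Real.pi) • q).2 * p.2 : ℝ) : ℂ)) *
          triple (fun _ => h₁) (fun _ => h₂) (fun _ => h₃) s ξ p
      = ∫ p, ∫ x, G p x := by
        refine integral_congr_ae ?_
        filter_upwards [(quasiMeasurePreserving_sub_sub ξ).ae e₂] with p hp
        rw [triple, ← hp, fourier_eq_expI, ← integral_conj]
        rw [mul_assoc, mul_comm (h₁ _), mul_assoc, ← integral_mul_const, ← integral_const_mul]
        refine integral_congr_ae (.of_forall fun x => ?_)
        simp only [G, map_mul, conj_expI, neg_neg]
        rw [expI_add, show Complex.exp (Complex.I * ((((2 * Real.pi) • q).1 * p.1 +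
          ((2 * Real.pi) • q).2 * p.2 : ℝ) : ℂ)) = expI (2 * Real.pi * (q.1 * p.1 + q.2 * p.2)) by
            rw [expI, mul_comm]
            congr 3
            simp only [Prod.smul_fst, Prod.smul_snd, smul_eq_mul]
            ring]
        ring
    _ = ∫ x, ∫ p, G p x := integral_integral_swap hG
    _ = ∫ x, wave (𝓕⁻ h₁) u₂ (𝓕⁻ h₃) ξ x q := by
        refine integral_congr_ae (.of_forall fun x => ?_)
        have e : ∀ p : ℝ × ℝ, G p x = (expI (2 * Real.pi * (x * ξ)) * conj (u₂ x)) *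
            ((expI (2 * Real.pi * (q.1 - x) * p.1) * h₃ (ξ - p.1)) *
              (expI (2 * Real.pi * (q.2 - x) * p.2) * h₁ (ξ - p.2))) := by
          intro p
          simp only [G]
          rw [show 2 * Real.pi * (q.1 * p.1 + q.2 * p.2) + 2 * Real.pi * x * (ξ - p.1 - p.2) =
            2 * Real.pi * (x * ξ) + 2 * Real.pi * (q.1 - x) * p.1 +
              2 * Real.pi * (q.2 - x) * p.2 by ring, expI_add, expI_add]
          ring
        simp only [e]
        rw [integral_const_mul]
        erw [integral_prod_mul (fun η => expI (2 * Real.pi * (q.1 - x) * η) * h₃ (ξ - η))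
          (fun σ => expI (2 * Real.pi * (q.2 - x) * σ) * h₁ (ξ - σ))]
        rw [integral_expI_mul_reflect, integral_expI_mul_reflect, wave, neg_sub, neg_sub,
          show 2 * Real.pi * (q.1 + q.2 - x) * ξ = 2 * Real.pi * (x * ξ) +
            2 * Real.pi * (q.1 - x) * ξ + 2 * Real.pi * (q.2 - x) * ξ by ring, expI_add, expI_add]
        ring

theorem norm_fourier_le {f : ℝ → ℂ} (ξ : ℝ) : ‖𝓕 f ξ‖ ≤ ∫ x, ‖f x‖ := by
  rw [Real.fourier_eq]
  refine (norm_integral_le_integral_norm _).trans_eq ?_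
  simp only [Circle.norm_smul]

theorem integrable_triple {h₁ h₂ h₃ : ℝ → ℂ} (i₁ : Integrable h₁) (i₃ : Integrable h₃)
    (i₂ : Integrable u₂) (e₂ : 𝓕 u₂ =ᵐ[volume] h₂) (s ξ : ℝ) :
    Integrable (triple (fun _ => h₁) (fun _ => h₂) (fun _ => h₃) s ξ) := by
  have h := (i₃.comp_sub_left ξ).mul_prod (i₁.comp_sub_left ξ)
  have hc := continuous_fourier i₂
  have hb : Integrable fun p : ℝ × ℝ =>
      conj (𝓕 u₂ (ξ - p.1 - p.2)) * (h₃ (ξ - p.1) * h₁ (ξ - p.2)) := by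
    refine h.bdd_mul (c := ∫ x, ‖u₂ x‖) ?_ (.of_forall fun p => ?_)
    · exact Continuous.aestronglyMeasurable
        (Complex.continuous_conj.comp (hc.comp (by fun_prop)))
    · rw [RCLike.norm_conj]
      exact norm_fourier_le _
  refine hb.congr ?_
  filter_upwards [(quasiMeasurePreserving_sub_sub ξ).ae e₂] with p hp
  rw [triple, ← hp]
  ring

/-- The Fourier transform of the trilinear expression, as a function of the frequency. -/
def kernel (u₁ u₂ u₃ : ℝ → ℂ) (ξ : ℝ) (q : ℝ × ℝ) : ℂ := ∫ x, wave u₁ u₂ u₃ ξ x q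

theorem integrable_kernel (h₁ : Integrable u₁) (h₂ : Integrable u₂) (h₃ : Integrable u₃) (ξ : ℝ) :
    Integrable (kernel u₁ u₂ u₃ ξ) :=
  (integrable_wave h₁ h₂ h₃ ξ).integral_prod_right

/-- The dilation by `2π` passes from the unitary transform to the one with `2π` in the exponent; the
phase `ab/(2s)` becomes `2μ q₁q₂` with `μ = π²/s`. -/
theorem remainderIntegrand_smul {h₁ h₂ h₃ : ℝ → ℂ} (i₁ : Integrable h₁) (i₃ : Integrable h₃)
    (i₂ : Integrable u₂) (e₂ : 𝓕 u₂ =ᵐ[volume] h₂) (s ξ : ℝ) (q : ℝ × ℝ) :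
    remainderIntegrand (fun _ => h₁) (fun _ => h₂) (fun _ => h₃) s ξ ((2 * Real.pi) • q) =
      ((1 / (2 * Real.pi) : ℝ) : ℂ) * ((expI (-(2 * (Real.pi ^ 2 / s)) * (q.1 * q.2)) - 1) *
        kernel (𝓕⁻ h₁) u₂ (𝓕⁻ h₃) ξ q) := by
  rw [remainderIntegrand, invFourier₂_triple i₁ i₃ i₂ e₂, kernel]
  have : Complex.exp (-Complex.I * ((((2 * Real.pi) • q).1 * ((2 * Real.pi) • q).2 / (2 * s) : ℝ)
      : ℂ)) = expI (-(2 * (Real.pi ^ 2 / s)) * (q.1 * q.2)) := by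
    rw [expI, neg_mul, mul_comm, ← neg_mul]
    congr 2
    rw [← Complex.ofReal_neg]
    congr 1
    simp only [Prod.smul_fst, Prod.smul_snd, smul_eq_mul]
    rcases eq_or_ne s 0 with rfl | hs
    · simp
    · field_simp
  rw [this]
  ring

theorem aestronglyMeasurable_expI_mul (c : ℝ) :
    AEStronglyMeasurable (fun q : ℝ × ℝ => expI (c * (q.1 * q.2))) volume :=
  Continuous.aestronglyMeasurable (by fun_prop)

theorem integrable_expI_mul_kernel (h₁ : Integrable u₁) (h₂ : Integrable u₂) (h₃ : Integrable u₃)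
    (c ξ : ℝ) : Integrable fun q : ℝ × ℝ => expI (c * (q.1 * q.2)) * kernel u₁ u₂ u₃ ξ q :=
  integrable_mul_of_norm_le_one (integrable_kernel h₁ h₂ h₃ ξ) (aestronglyMeasurable_expI_mul c)
    fun q => by simp

theorem integrable_remainderIntegrand {h₁ h₂ h₃ : ℝ → ℂ} (i₁ : Integrable h₁)
    (i₃ : Integrable h₃) (j₁ : Integrable (𝓕⁻ h₁)) (j₃ : Integrable (𝓕⁻ h₃))
    (i₂ : Integrable u₂) (e₂ : 𝓕 u₂ =ᵐ[volume] h₂) (s ξ : ℝ) :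
    Integrable (remainderIntegrand (fun _ => h₁) (fun _ => h₂) (fun _ => h₃) s ξ) := by
  rw [← integrable_comp_smul_iff volume _ (show (2 * Real.pi) ≠ 0 by positivity)]
  simp only [remainderIntegrand_smul i₁ i₃ i₂ e₂, sub_mul, one_mul]
  exact ((integrable_expI_mul_kernel j₁ i₂ j₃ _ ξ).sub (integrable_kernel j₁ i₂ j₃ ξ)).const_mul _

theorem remainder_eq_integral_kernel {h₁ h₂ h₃ : ℝ → ℂ} (i₁ : Integrable h₁)
    (i₃ : Integrable h₃) (i₂ : Integrable u₂) (e₂ : 𝓕 u₂ =ᵐ[volume] h₂) (s ξ : ℝ) :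
    remainder (fun _ => h₁) (fun _ => h₂) (fun _ => h₃) s ξ =
      -(Complex.I / (2 * s : ℝ)) *
        ∫ q : ℝ × ℝ, (expI (-(2 * (Real.pi ^ 2 / s)) * (q.1 * q.2)) - 1) *
          kernel (𝓕⁻ h₁) u₂ (𝓕⁻ h₃) ξ q := by
  have h := Measure.integral_comp_smul (volume : Measure (ℝ × ℝ))
    (remainderIntegrand (fun _ => h₁) (fun _ => h₂) (fun _ => h₃) s ξ) (2 * Real.pi)
  simp only [remainderIntegrand_smul i₁ i₃ i₂ e₂] at h
  rw [integral_const_mul, Module.finrank_prod, Module.finrank_self, abs_of_pos (by positivity),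
    Complex.real_smul] at h
  have h' : ∫ q, remainderIntegrand (fun _ => h₁) (fun _ => h₂) (fun _ => h₃) s ξ q =
      (2 * Real.pi : ℂ) * ∫ q : ℝ × ℝ, (expI (-(2 * (Real.pi ^ 2 / s)) * (q.1 * q.2)) - 1) *
          kernel (𝓕⁻ h₁) u₂ (𝓕⁻ h₃) ξ q := by
    have hpi : (Real.pi : ℂ) ≠ 0 := by exact_mod_cast Real.pi_ne_zero
    generalize (∫ q : ℝ × ℝ, (expI (-(2 * (Real.pi ^ 2 / s)) * (q.1 * q.2)) - 1) *
      kernel (𝓕⁻ h₁) u₂ (𝓕⁻ h₃) ξ q) = J at h ⊢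
    push_cast at h
    field_simp at h
    linear_combination -h
  rw [remainder, h', ← mul_assoc]
  congr 1
  have hpi : (Real.pi : ℂ) ≠ 0 := by exact_mod_cast Real.pi_ne_zero
  rcases eq_or_ne s 0 with rfl | hs
  · simp
  · have : (s : ℂ) ≠ 0 := by exact_mod_cast hs
    push_cast
    field_simp
    ring

/-! ### Decay of the remainder in `L^∞` -/

theorem norm_expI_sub_one_le {θ : ℝ} (h0 : 0 ≤ θ) (h1 : θ ≤ 1) (t : ℝ) :
    ‖expI t - 1‖ ≤ 2 * |t| ^ θ := by
  have a : ‖expI t - 1‖ ≤ |t| := by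
    have := Real.norm_exp_I_mul_ofReal_sub_one_le (x := t)
    rwa [mul_comm] at this
  have b : ‖expI t - 1‖ ≤ 2 := by
    refine (norm_sub_le _ _).trans ?_
    rw [norm_expI, norm_one]
    norm_num
  rcases le_total |t| 1 with ht | ht
  · have : |t| ≤ |t| ^ θ := by
      rcases eq_or_lt_of_le (abs_nonneg t) with h | h
      · rw [← h]
        positivity
      · simpa using Real.rpow_le_rpow_of_exponent_ge h ht h1
    have : 0 ≤ |t| ^ θ := by positivity
    linarith
  · have := Real.one_le_rpow ht h0
    linarith

/-- Separates the variables of the phase, so that the triple integral splits into three weighted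
`L¹` norms. -/
theorem abs_mul_shift_rpow_le {θ : ℝ} (h0 : 0 ≤ θ) (x y z : ℝ) :
    |(x - y) * (x - z)| ^ θ ≤
      2 ^ θ * ((1 + x ^ 2) ^ θ * (1 + y ^ 2) ^ θ * (1 + z ^ 2) ^ θ) := by
  rw [← Real.mul_rpow (by positivity) (by positivity), ← Real.mul_rpow (by positivity)
    (by positivity), ← Real.mul_rpow (by positivity) (by positivity)]
  refine Real.rpow_le_rpow (abs_nonneg _) (abs_le_of_sq_le_sq ?_ (by positivity)) h0
  have a : (x - y) ^ 2 ≤ 2 * ((1 + x ^ 2) * (1 + y ^ 2)) := by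
    nlinarith [sq_nonneg (x + y), mul_nonneg (sq_nonneg x) (sq_nonneg y)]
  have b : (x - z) ^ 2 ≤ 2 * ((1 + x ^ 2) * (1 + z ^ 2)) := by
    nlinarith [sq_nonneg (x + z), mul_nonneg (sq_nonneg x) (sq_nonneg z)]
  have c : ((x - y) * (x - z)) ^ 2 ≤
      2 * ((1 + x ^ 2) * (1 + y ^ 2)) * (2 * ((1 + x ^ 2) * (1 + z ^ 2))) := by
    rw [mul_pow]
    exact mul_le_mul a b (sq_nonneg _) (by positivity)
  refine c.trans ?_
  -- The variable `x` occurs in both factors and needs its full weight; `y` and `z` need only half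
  -- the power, which is raised for symmetry.
  have d : (1 + y ^ 2) * (1 + z ^ 2) ≤ ((1 + y ^ 2) * (1 + z ^ 2)) ^ 2 :=
    le_self_pow₀ (one_le_mul_of_one_le_of_one_le (by linarith [sq_nonneg y])
      (by linarith [sq_nonneg z])) two_ne_zero
  calc _ = 4 * (1 + x ^ 2) ^ 2 * ((1 + y ^ 2) * (1 + z ^ 2)) := by ring
    _ ≤ 4 * (1 + x ^ 2) ^ 2 * ((1 + y ^ 2) * (1 + z ^ 2)) ^ 2 := by gcongr
    _ = _ := by ring

theorem norm_expI_shift_sub_one_le {θ : ℝ} (h0 : 0 ≤ θ) (h1 : θ ≤ 1) {c : ℝ} (hc : 0 ≤ c)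
    (x y z : ℝ) : ‖expI (-c * ((x - y) * (x - z))) - 1‖ ≤
      4 * c ^ θ * ((1 + x ^ 2) ^ θ * (1 + y ^ 2) ^ θ * (1 + z ^ 2) ^ θ) := by
  refine (norm_expI_sub_one_le h0 h1 _).trans ?_
  rw [abs_mul, abs_neg, abs_of_nonneg hc, Real.mul_rpow hc (abs_nonneg _)]
  have a := abs_mul_shift_rpow_le h0 x y z
  have b : (2 : ℝ) ^ θ ≤ 2 := by
    simpa using Real.rpow_le_rpow_of_exponent_le one_le_two h1
  calc 2 * (c ^ θ * |(x - y) * (x - z)| ^ θ)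
      ≤ 2 * (c ^ θ * (2 * ((1 + x ^ 2) ^ θ * (1 + y ^ 2) ^ θ * (1 + z ^ 2) ^ θ))) := by
        gcongr
        exact a.trans (by gcongr)
    _ = _ := by ring

/-- The `L¹` norm of `κ u` for the weight `κ = (1 + x²)^θ`. -/
def weightedL1 (θ : ℝ) (u : ℝ → ℂ) : ℝ≥0∞ := ∫⁻ x, ENNReal.ofReal ((1 + x ^ 2) ^ θ) * ‖u x‖ₑ

/-- After the substitution `q ↦ (x, x) - q` the phase is `c (x - q₁)(x - q₂)`. The gain `c^θ` is
paid for by a weight in each variable, and the absolute values factor. -/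
theorem enorm_integral_kernel_le {θ : ℝ} (h0 : 0 ≤ θ) (h1 : θ ≤ 1) {c : ℝ} (hc : 0 ≤ c)
    (j₁ : Integrable u₁) (j₂ : Integrable u₂) (j₃ : Integrable u₃) (ξ : ℝ) :
    ‖∫ q : ℝ × ℝ, (expI (-c * (q.1 * q.2)) - 1) * kernel u₁ u₂ u₃ ξ q‖ₑ ≤
      ENNReal.ofReal (4 * c ^ θ) *
        (weightedL1 θ u₁ * weightedL1 θ u₂ * weightedL1 θ u₃) := by
  set κ : ℝ → ℝ≥0∞ := fun x => ENNReal.ofReal ((1 + x ^ 2) ^ θ)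
  have hκ : Measurable κ := by
    have : Continuous fun x : ℝ => (1 + x ^ 2) ^ θ :=
      Continuous.rpow_const (by fun_prop) fun x => .inr h0
    exact this.measurable.ennreal_ofReal
  have hW := (integrable_wave j₁ j₂ j₃ ξ).1.enorm
  have hE : Measurable fun q : ℝ × ℝ => ‖expI (-c * (q.1 * q.2)) - 1‖ₑ :=
    (Continuous.measurable (by fun_prop)).enorm
  calc ‖∫ q : ℝ × ℝ, (expI (-c * (q.1 * q.2)) - 1) * kernel u₁ u₂ u₃ ξ q‖ₑ
      ≤ ∫⁻ q : ℝ × ℝ, ‖expI (-c * (q.1 * q.2)) - 1‖ₑ * ‖kernel u₁ u₂ u₃ ξ q‖ₑ :=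
        (enorm_integral_le_lintegral_enorm _).trans_eq (lintegral_congr fun q => enorm_mul _ _)
    _ ≤ ∫⁻ q : ℝ × ℝ, ∫⁻ x, ‖expI (-c * (q.1 * q.2)) - 1‖ₑ * ‖wave u₁ u₂ u₃ ξ x q‖ₑ := by
        refine lintegral_mono fun q => ?_
        rw [lintegral_const_mul' _ _ (by simp)]
        exact mul_le_mul_right (enorm_integral_le_lintegral_enorm _) _
    _ = ∫⁻ x, ∫⁻ q : ℝ × ℝ, ‖expI (-c * (q.1 * q.2)) - 1‖ₑ * ‖wave u₁ u₂ u₃ ξ x q‖ₑ := by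
        refine (lintegral_lintegral_swap ?_).symm
        exact (hE.comp measurable_snd).aemeasurable.mul hW
    _ = ∫⁻ x, ∫⁻ q : ℝ × ℝ, ‖expI (-c * ((x - q.1) * (x - q.2))) - 1‖ₑ *
          (‖u₂ x‖ₑ * (‖u₃ q.1‖ₑ * ‖u₁ q.2‖ₑ)) := by
        refine lintegral_congr fun x => ?_
        rw [← lintegral_sub_left_eq_self _ ((x, x) : ℝ × ℝ)]
        simp [wave, enorm_mul]
    _ ≤ ∫⁻ x, ∫⁻ q : ℝ × ℝ, (ENNReal.ofReal (4 * c ^ θ) * (κ x * ‖u₂ x‖ₑ)) *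
          ((κ q.1 * ‖u₃ q.1‖ₑ) * (κ q.2 * ‖u₁ q.2‖ₑ)) := by
        refine lintegral_mono fun x => lintegral_mono fun q => ?_
        have : ‖expI (-c * ((x - q.1) * (x - q.2))) - 1‖ₑ ≤
            ENNReal.ofReal (4 * c ^ θ) * (κ x * κ q.1 * κ q.2) := by
          simp only [κ]
          rw [← ofReal_norm, ← ENNReal.ofReal_mul (by positivity),
            ← ENNReal.ofReal_mul (by positivity), ← ENNReal.ofReal_mul (by positivity)]
          exact ENNReal.ofReal_le_ofReal (norm_expI_shift_sub_one_le h0 h1 hc x q.1 q.2)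
        calc _ ≤ ENNReal.ofReal (4 * c ^ θ) * (κ x * κ q.1 * κ q.2) *
              (‖u₂ x‖ₑ * (‖u₃ q.1‖ₑ * ‖u₁ q.2‖ₑ)) := mul_le_mul_left this _
          _ = _ := by ring
    _ = _ := by
        have m : ∀ {u : ℝ → ℂ}, Integrable u → AEMeasurable (fun x => κ x * ‖u x‖ₑ) volume :=
          fun h => hκ.aemeasurable.mul h.1.enorm
        have e : ∫⁻ q : ℝ × ℝ, (κ q.1 * ‖u₃ q.1‖ₑ) * (κ q.2 * ‖u₁ q.2‖ₑ) =
            weightedL1 θ u₃ * weightedL1 θ u₁ := lintegral_prod_mul (m j₃) (m j₁)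
        have m2 : AEMeasurable (fun q : ℝ × ℝ => (κ q.1 * ‖u₃ q.1‖ₑ) * (κ q.2 * ‖u₁ q.2‖ₑ))
            volume := (m j₃).comp_fst.mul (m j₁).comp_snd
        simp only [lintegral_const_mul'' _ m2, e]
        rw [lintegral_mul_const'' _ ((m j₂).const_mul _), lintegral_const_mul'' _ (m j₂)]
        change _ * weightedL1 θ u₂ * _ = _
        ring

end wave

end

/-! ### Chirps, Plancherel, and the remainder with one factor in `L²` -/

section

open FourierTransform SchwartzMap Convolution

/-! ### The remainder as a difference of two products, in `L²` -/

/-- Multiplication by the chirp `exp (i μ x²)`. -/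
def chirp (μ : ℝ) (u : ℝ → ℂ) (x : ℝ) : ℂ := expI (μ * x ^ 2) * u x

theorem integrable_chirp {u : ℝ → ℂ} (hu : Integrable u) (μ : ℝ) : Integrable (chirp μ u) :=
  integrable_mul_of_norm_le_one hu (Continuous.aestronglyMeasurable (by fun_prop))
    fun x => by simp

theorem norm_chirp (μ : ℝ) (u : ℝ → ℂ) (x : ℝ) : ‖chirp μ u x‖ = ‖u x‖ := by
  rw [chirp, norm_mul, norm_expI, one_mul]

theorem integral_convolution_mul {f g Ψ : ℝ → ℂ} (hf : Integrable f) (hg : Integrable g)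
    (hΨ : Continuous Ψ) (hb : ∀ x, ‖Ψ x‖ ≤ 1) :
    ∫ w, Ψ w * (f ⋆[ContinuousLinearMap.mul ℂ ℂ] g) w =
      ∫ x, f x * ∫ y, Ψ (x + y) * g y := by
  have h := hf.convolution_integrand (ContinuousLinearMap.mul ℂ ℂ) hg
  have h' : Integrable (Function.uncurry fun w x : ℝ => Ψ w * (f x * g (w - x))) :=
    integrable_mul_of_norm_le_one h
      (hΨ.comp continuous_fst).aestronglyMeasurable fun p => hb _
  calc ∫ w, Ψ w * (f ⋆[ContinuousLinearMap.mul ℂ ℂ] g) w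
      = ∫ w, ∫ x, Ψ w * (f x * g (w - x)) :=
        integral_congr_ae (.of_forall fun w => (integral_const_mul _ _).symm)
    _ = ∫ x, ∫ w, Ψ w * (f x * g (w - x)) := integral_integral_swap h'
    _ = ∫ x, f x * ∫ y, Ψ (x + y) * g y := by
        refine integral_congr_ae (.of_forall fun x => ?_)
        simp only
        rw [← integral_add_left_eq_self _ x, ← integral_const_mul]
        refine integral_congr_ae (.of_forall fun y => ?_)
        simp only [add_sub_cancel_left]
        ring

/-- The reflected conjugate `x ↦ conj (u (-x))`. -/
def reflConj (u : ℝ → ℂ) (x : ℝ) : ℂ := conj (u (-x))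

theorem integrable_reflConj {u : ℝ → ℂ} (hu : Integrable u) : Integrable (reflConj u) :=
  integrable_conj hu.comp_neg

theorem fourier_reflConj (u : ℝ → ℂ) (ξ : ℝ) : 𝓕 (reflConj u) ξ = conj (𝓕 u ξ) := by
  rw [fourier_eq_expI, fourier_eq_expI, ← integral_conj, ← integral_neg_eq_self]
  refine integral_congr_ae (.of_forall fun x => ?_)
  simp [reflConj, conj_expI]

/-- The threefold convolution that has the Fourier transform `conj V₂ · V₃ · V₁`. -/
def tripleConv (v₁ v₂ v₃ : ℝ → ℂ) : ℝ → ℂ :=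
  reflConj v₂ ⋆[ContinuousLinearMap.mul ℂ ℂ] (v₃ ⋆[ContinuousLinearMap.mul ℂ ℂ] v₁)

section tripleConv

variable {v₁ v₂ v₃ : ℝ → ℂ}

theorem integrable_tripleConv (h₁ : Integrable v₁) (h₂ : Integrable v₂) (h₃ : Integrable v₃) :
    Integrable (tripleConv v₁ v₂ v₃) :=
  (integrable_reflConj h₂).integrable_convolution _ (h₃.integrable_convolution _ h₁)

theorem fourier_tripleConv (h₁ : Integrable v₁) (h₂ : Integrable v₂) (h₃ : Integrable v₃) (ξ : ℝ) :
    𝓕 (tripleConv v₁ v₂ v₃) ξ = conj (𝓕 v₂ ξ) * (𝓕 v₃ ξ * 𝓕 v₁ ξ) := by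
  rw [tripleConv, Real.fourier_mul_convolution_eq (integrable_reflConj h₂)
    (h₃.integrable_convolution _ h₁), Real.fourier_mul_convolution_eq h₃ h₁, fourier_reflConj]

/-- Integrable and bounded functions are square integrable; one bounded factor already makes the
convolution bounded. -/
theorem memLp_tripleConv (h₁ : Integrable v₁) (h₂ : Integrable v₂) (h₃ : Integrable v₃) {B : ℝ}
    (hB : ∀ x, ‖v₂ x‖ ≤ B) : MemLp (tripleConv v₁ v₂ v₃) 2 := by
  have hi := integrable_tripleConv h₁ h₂ h₃
  set g := v₃ ⋆[ContinuousLinearMap.mul ℂ ℂ] v₁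
  have hg : Integrable g := h₃.integrable_convolution _ h₁
  have hb : ∀ w, ‖tripleConv v₁ v₂ v₃ w‖ ≤ B * ∫ x, ‖g x‖ := by
    intro w
    refine (norm_integral_le_of_norm_le ((hg.comp_sub_left w).norm.const_mul B)
      (.of_forall fun x => ?_)).trans_eq ?_
    · simp only [ContinuousLinearMap.mul_apply', norm_mul]
      gcongr
      simpa [reflConj] using hB (-x)
    · rw [integral_const_mul, integral_sub_left_eq_self (fun x => ‖g x‖)]
  rw [memLp_two_iff_integrable_sq_norm hi.1]
  refine (hi.norm.const_mul (B * ∫ x, ‖g x‖)).mono' (hi.1.norm.pow 2) (.of_forall fun w => ?_)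
  rw [Real.norm_of_nonneg (by positivity), sq]
  gcongr
  exact hb w

end tripleConv

section

variable {u₁ u₂ u₃ : ℝ → ℂ}

/-- The identity `-2μ(x - y)(x - z) = -μx² - μ(y + z - x)² + μy² + μz²` assigns one chirp to each of
the three functions and one to the convolution variable `w = y + z - x`. -/
theorem integral_expI_mul_kernel (j₁ : Integrable u₁) (j₂ : Integrable u₂) (j₃ : Integrable u₃)
    (μ ξ : ℝ) :
    ∫ q : ℝ × ℝ, expI (-(2 * μ) * (q.1 * q.2)) * kernel u₁ u₂ u₃ ξ q =
      𝓕 (chirp (-μ) (tripleConv (chirp μ u₁) (chirp μ u₂) (chirp μ u₃))) ξ := by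
  set v₁ := chirp μ u₁
  set v₂ := chirp μ u₂
  set v₃ := chirp μ u₃
  have k₁ : Integrable v₁ := integrable_chirp j₁ μ
  have k₂ : Integrable v₂ := integrable_chirp j₂ μ
  have k₃ : Integrable v₃ := integrable_chirp j₃ μ
  set Ψ : ℝ → ℂ := fun w => expI (-(μ * w ^ 2) - 2 * Real.pi * w * ξ) with hΨ
  have hΨc : Continuous Ψ := by fun_prop
  have hΨb : ∀ x, ‖Ψ x‖ ≤ 1 := fun x => by simp [Ψ]
  have hR : 𝓕 (chirp (-μ) (tripleConv v₁ v₂ v₃)) ξ =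
      ∫ x, conj (v₂ x) * ∫ y, v₃ y * ∫ z, Ψ (y + z - x) * v₁ z := by
    rw [fourier_eq_expI]
    have : ∀ w, expI (-(2 * Real.pi * w * ξ)) * chirp (-μ) (tripleConv v₁ v₂ v₃) w =
        Ψ w * tripleConv v₁ v₂ v₃ w := by
      intro w
      rw [chirp, ← mul_assoc, ← expI_add]
      simp only [Ψ]
      congr 2
      ring
    simp only [this]
    unfold tripleConv
    rw [integral_convolution_mul (integrable_reflConj k₂)
      (k₃.integrable_convolution (ContinuousLinearMap.mul ℂ ℂ) k₁) hΨc hΨb,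
      ← integral_neg_eq_self]
    refine integral_congr_ae (.of_forall fun x => ?_)
    simp only [reflConj, neg_neg]
    congr 1
    rw [integral_convolution_mul k₃ k₁ (Ψ := fun y => Ψ (-x + y)) (by fun_prop) fun y => hΨb _]
    refine integral_congr_ae (.of_forall fun y => ?_)
    simp only
    congr 1
    refine integral_congr_ae (.of_forall fun z => ?_)
    simp only
    congr 2
    ring
  rw [hR]
  have hW := integrable_wave j₁ j₂ j₃ ξ
  have hE : Integrable (Function.uncurry fun (x : ℝ) (q : ℝ × ℝ) =>
      expI (-(2 * μ) * (q.1 * q.2)) * wave u₁ u₂ u₃ ξ x q) := by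
    refine integrable_mul_of_norm_le_one hW ?_ fun p => by simp
    exact Continuous.aestronglyMeasurable (by fun_prop)
  calc ∫ q : ℝ × ℝ, expI (-(2 * μ) * (q.1 * q.2)) * kernel u₁ u₂ u₃ ξ q
      = ∫ q : ℝ × ℝ, ∫ x, expI (-(2 * μ) * (q.1 * q.2)) * wave u₁ u₂ u₃ ξ x q :=
        integral_congr_ae (.of_forall fun q => (integral_const_mul _ _).symm)
    _ = ∫ x, ∫ q : ℝ × ℝ, expI (-(2 * μ) * (q.1 * q.2)) * wave u₁ u₂ u₃ ξ x q :=
        (integral_integral_swap hE).symm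
    _ = ∫ x, conj (v₂ x) * ∫ q : ℝ × ℝ, Ψ (q.1 + q.2 - x) * (v₃ q.1 * v₁ q.2) := by
        refine integral_congr_ae (.of_forall fun x => ?_)
        simp only
        rw [← integral_sub_left_eq_self _ _ ((x, x) : ℝ × ℝ), ← integral_const_mul]
        refine integral_congr_ae (.of_forall fun q => ?_)
        simp only [wave, Prod.fst_sub, Prod.snd_sub, sub_sub_cancel, v₂, v₃, v₁, chirp, map_mul,
          conj_expI, Ψ]
        have e : expI (-(2 * μ) * ((x - q.1) * (x - q.2))) *
              expI (2 * Real.pi * (x - q.1 + (x - q.2) - x) * ξ) =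
            expI (-(μ * x ^ 2)) * expI (-(μ * (q.1 + q.2 - x) ^ 2) -
              2 * Real.pi * (q.1 + q.2 - x) * ξ) * expI (μ * q.1 ^ 2) * expI (μ * q.2 ^ 2) := by
          simp only [← expI_add]
          congr 1
          ring
        linear_combination (conj (u₂ x) * (u₃ q.1 * u₁ q.2)) * e
    _ = _ := by
        refine integral_congr_ae (.of_forall fun x => ?_)
        simp only
        congr 1
        have hi : Integrable fun q : ℝ × ℝ => Ψ (q.1 + q.2 - x) * (v₃ q.1 * v₁ q.2) :=
          integrable_mul_of_norm_le_one (k₃.mul_prod k₁)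
            (hΨc.comp (by fun_prop)).aestronglyMeasurable fun q => hΨb _
        erw [integral_prod _ hi]
        refine integral_congr_ae (.of_forall fun y => ?_)
        simp only
        rw [← integral_const_mul]
        refine integral_congr_ae (.of_forall fun z => ?_)
        simp only
        ring

/-- The outer chirp has modulus one, so it disappears between two applications of Plancherel, and
the convolution becomes a product. -/
theorem eLpNorm_integral_expI_mul_kernel (j₁ : Integrable u₁) (j₂ : Integrable u₂)
    (j₃ : Integrable u₃) {B : ℝ} (hB : ∀ x, ‖u₂ x‖ ≤ B) (μ : ℝ) :
    eLpNorm (fun ξ => ∫ q : ℝ × ℝ, expI (-(2 * μ) * (q.1 * q.2)) * kernel u₁ u₂ u₃ ξ q) 2 volume =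
      eLpNorm (fun ξ => conj (𝓕 (chirp μ u₂) ξ) * (𝓕 (chirp μ u₃) ξ * 𝓕 (chirp μ u₁) ξ)) 2
        volume := by
  simp only [integral_expI_mul_kernel j₁ j₂ j₃]
  have k₁ := integrable_chirp j₁ μ
  have k₂ := integrable_chirp j₂ μ
  have k₃ := integrable_chirp j₃ μ
  have hi := integrable_tripleConv k₁ k₂ k₃
  have h2 : MemLp (tripleConv (chirp μ u₁) (chirp μ u₂) (chirp μ u₃)) 2 :=
    memLp_tripleConv k₁ k₂ k₃ (B := B) fun x => by rw [norm_chirp]; exact hB x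
  have hn : eLpNorm (chirp (-μ) (tripleConv (chirp μ u₁) (chirp μ u₂) (chirp μ u₃))) 2 volume =
      eLpNorm (tripleConv (chirp μ u₁) (chirp μ u₂) (chirp μ u₃)) 2 volume :=
    eLpNorm_congr_norm_ae (.of_forall fun x => norm_chirp _ _ x)
  have hc : MemLp (chirp (-μ) (tripleConv (chirp μ u₁) (chirp μ u₂) (chirp μ u₃))) 2 :=
    ⟨(integrable_chirp hi _).1, hn.trans_lt h2.2⟩
  rw [eLpNorm_fourier (integrable_chirp hi _) hc, hn, ← eLpNorm_fourier hi h2]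
  congr 1
  funext ξ
  exact fourier_tripleConv k₁ k₂ k₃ ξ

end

/-- A chirp changes the Fourier transform by a small amount in `L^∞`. -/
theorem norm_fourier_chirp_sub_le {θ μ c : ℝ} (h0 : 0 ≤ θ) (h1 : θ ≤ 1) (hμ : 0 ≤ μ) (hc : 0 ≤ c)
    {u : ℝ → ℂ} (hu : Integrable u) (hw : weightedL1 θ u ≤ ENNReal.ofReal c) (ξ : ℝ) :
    ‖𝓕 (chirp μ u) ξ - 𝓕 u ξ‖ ≤ 2 * μ ^ θ * c := by
  have hi := integrable_chirp hu μ
  rw [← ENNReal.ofReal_le_ofReal_iff (by positivity), ofReal_norm]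
  have e : 𝓕 (chirp μ u) ξ - 𝓕 u ξ =
      ∫ x, expI (-(2 * Real.pi * x * ξ)) * ((expI (μ * x ^ 2) - 1) * u x) := by
    have m : ∀ {f : ℝ → ℂ}, Integrable f →
        Integrable fun x => expI (-(2 * Real.pi * x * ξ)) * f x := fun hf =>
      integrable_mul_of_norm_le_one hf (Continuous.aestronglyMeasurable (by fun_prop))
        fun x => by simp
    rw [fourier_eq_expI, fourier_eq_expI, ← integral_sub (m hi) (m hu)]
    refine integral_congr_ae (.of_forall fun x => ?_)
    simp only [chirp]
    ring
  rw [e]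
  refine (enorm_integral_le_lintegral_enorm _).trans ?_
  calc ∫⁻ x, ‖expI (-(2 * Real.pi * x * ξ)) * ((expI (μ * x ^ 2) - 1) * u x)‖ₑ
      ≤ ∫⁻ x, ENNReal.ofReal (2 * μ ^ θ) * (ENNReal.ofReal ((1 + x ^ 2) ^ θ) * ‖u x‖ₑ) := by
        refine lintegral_mono fun x => ?_
        rw [enorm_mul, enorm_expI, one_mul, enorm_mul, ← mul_assoc,
          ← ENNReal.ofReal_mul (by positivity), ← ofReal_norm (expI (μ * x ^ 2) - 1)]
        refine mul_le_mul_left (ENNReal.ofReal_le_ofReal ?_) _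
        refine (norm_expI_sub_one_le h0 h1 _).trans ?_
        rw [abs_of_nonneg (by positivity), Real.mul_rpow hμ (sq_nonneg x), ← mul_assoc]
        gcongr
        linarith
    _ = ENNReal.ofReal (2 * μ ^ θ) * weightedL1 θ u := lintegral_const_mul' _ _ ENNReal.ofReal_ne_top
    _ ≤ ENNReal.ofReal (2 * μ ^ θ) * ENNReal.ofReal c := mul_le_mul_right hw _
    _ = ENNReal.ofReal (2 * μ ^ θ * c) := (ENNReal.ofReal_mul (by positivity)).symm

theorem ProfileBd.ae_norm_fourier_chirp_le {h : ℝ → ℂ} {L N θ μ c : ℝ} (H : ProfileBd h L N)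
    (h0 : 0 ≤ θ) (h1 : θ ≤ 1) (hμ : 0 ≤ μ) (hc : 0 ≤ c)
    (hw : weightedL1 θ (𝓕⁻ h) ≤ ENNReal.ofReal c) :
    ∀ᵐ ξ, ‖𝓕 (chirp μ (𝓕⁻ h)) ξ‖ ≤ L + 2 * μ ^ θ * c := by
  filter_upwards [H.fourier_ae_eq, H.ae_norm_le] with ξ e1 e2
  have := norm_fourier_chirp_sub_le h0 h1 hμ hc H.integrable_fourierInv hw ξ
  rw [e1] at this
  have h3 := norm_le_norm_add_norm_sub' (𝓕 (chirp μ (𝓕⁻ h)) ξ) (h ξ)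
  linarith

theorem ProfileBd.eLpNorm_fourier_chirp {h : ℝ → ℂ} {L N : ℝ} (H : ProfileBd h L N) (μ : ℝ) :
    eLpNorm (𝓕 (chirp μ (𝓕⁻ h))) 2 volume = eLpNorm h 2 volume := by
  have hn : eLpNorm (chirp μ (𝓕⁻ h)) 2 volume = eLpNorm (𝓕⁻ h) 2 volume :=
    eLpNorm_congr_norm_ae (.of_forall fun x => norm_chirp _ _ x)
  have hu := memLp_fourierInv H.integrable H.memLp
  have hi := integrable_chirp H.integrable_fourierInv μ
  rw [eLpNorm_fourier hi ⟨hi.1, hn.trans_lt hu.2⟩, hn, eLpNorm_fourierInv H.integrable H.memLp]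

theorem norm_fourierInv_le {f : ℝ → ℂ} (x : ℝ) : ‖𝓕⁻ f x‖ ≤ ∫ ξ, ‖f ξ‖ := by
  rw [fourierInv_eq_expI]
  refine (norm_integral_le_integral_norm _).trans_eq ?_
  simp

/-- The remainder of three fixed functions. -/
def remFun (h₁ h₂ h₃ : ℝ → ℂ) (s ξ : ℝ) : ℂ :=
  remainder (fun _ => h₁) (fun _ => h₂) (fun _ => h₃) s ξ

theorem ae_norm_triple_le {a b : ℝ → ℂ} {A B : ℝ} (hA : ∀ᵐ x, ‖a x‖ ≤ A)
    (hB : ∀ᵐ x, ‖b x‖ ≤ B) (f g : ℝ → ℂ) (hf : ∀ x, ‖f x‖ = ‖a x‖ * ‖b x‖ * ‖g x‖) :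
    eLpNorm f 2 volume ≤ ENNReal.ofReal (A * B) * eLpNorm g 2 volume := by
  refine eLpNorm_le_mul_eLpNorm_of_ae_le_mul ?_ 2
  filter_upwards [hA, hB] with x h1 h2
  rw [hf]
  have := (norm_nonneg _).trans h1
  gcongr

/-- The product of the three Fourier transforms, after modulation by chirps. -/
def modulatedProduct (u₁ u₂ u₃ : ℝ → ℂ) (μ ξ : ℝ) : ℂ :=
  ∫ q : ℝ × ℝ, expI (-(2 * μ) * (q.1 * q.2)) * kernel u₁ u₂ u₃ ξ q

theorem continuous_modulatedProduct {u₁ u₂ u₃ : ℝ → ℂ} (j₁ : Integrable u₁) (j₂ : Integrable u₂)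
    (j₃ : Integrable u₃) (μ : ℝ) : Continuous (modulatedProduct u₁ u₂ u₃ μ) := by
  have : modulatedProduct u₁ u₂ u₃ μ =
      𝓕 (chirp (-μ) (tripleConv (chirp μ u₁) (chirp μ u₂) (chirp μ u₃))) :=
    funext fun ξ => integral_expI_mul_kernel j₁ j₂ j₃ μ ξ
  rw [this]
  exact continuous_fourier (integrable_chirp (integrable_tripleConv (integrable_chirp j₁ μ)
    (integrable_chirp j₂ μ) (integrable_chirp j₃ μ)) _)

/-- The `-1` beside the oscillating exponential is the case `μ = 0` of the same expression, so a
bound uniform over the two values of `μ` is enough. -/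
theorem remFun_eq_modulatedProduct {h₁ h₂ h₃ : ℝ → ℂ} {L₁ N₁ L₂ N₂ L₃ N₃ : ℝ}
    (H₁ : ProfileBd h₁ L₁ N₁) (H₂ : ProfileBd h₂ L₂ N₂) (H₃ : ProfileBd h₃ L₃ N₃) (s : ℝ) :
    remFun h₁ h₂ h₃ s = (-(Complex.I / (2 * s : ℝ))) •
      (modulatedProduct (𝓕⁻ h₁) (𝓕⁻ h₂) (𝓕⁻ h₃) (Real.pi ^ 2 / s) -
        modulatedProduct (𝓕⁻ h₁) (𝓕⁻ h₂) (𝓕⁻ h₃) 0) := by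
  have j₁ := H₁.integrable_fourierInv
  have j₂ := H₂.integrable_fourierInv
  have j₃ := H₃.integrable_fourierInv
  funext ξ
  rw [remFun, remainder_eq_integral_kernel H₁.integrable H₃.integrable j₂ H₂.fourier_ae_eq]
  simp only [sub_mul, one_mul]
  rw [integral_sub (integrable_expI_mul_kernel j₁ j₂ j₃ _ ξ) (integrable_kernel j₁ j₂ j₃ ξ)]
  simp [modulatedProduct]

theorem continuous_remFun {h₁ h₂ h₃ : ℝ → ℂ} {L₁ N₁ L₂ N₂ L₃ N₃ : ℝ}
    (H₁ : ProfileBd h₁ L₁ N₁) (H₂ : ProfileBd h₂ L₂ N₂) (H₃ : ProfileBd h₃ L₃ N₃) (s : ℝ) :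
    Continuous (remFun h₁ h₂ h₃ s) := by
  rw [remFun_eq_modulatedProduct H₁ H₂ H₃]
  have c := continuous_modulatedProduct H₁.integrable_fourierInv H₂.integrable_fourierInv
    H₃.integrable_fourierInv
  exact ((c _).sub (c 0)).const_smul _

/-- The `L²` bounds for the remainder: one factor in `L²`, the others bounded. -/
theorem eLpNorm_remFun_le {h₁ h₂ h₃ : ℝ → ℂ} {L₁ N₁ L₂ N₂ L₃ N₃ s : ℝ} (hs : 0 < s)
    (H₁ : ProfileBd h₁ L₁ N₁) (H₂ : ProfileBd h₂ L₂ N₂) (H₃ : ProfileBd h₃ L₃ N₃)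
    {A₁ A₂ A₃ : ℝ}
    (a₁ : ∀ μ ∈ ({0, Real.pi ^ 2 / s} : Set ℝ), ∀ᵐ ξ, ‖𝓕 (chirp μ (𝓕⁻ h₁)) ξ‖ ≤ A₁)
    (a₂ : ∀ μ ∈ ({0, Real.pi ^ 2 / s} : Set ℝ), ∀ᵐ ξ, ‖𝓕 (chirp μ (𝓕⁻ h₂)) ξ‖ ≤ A₂)
    (a₃ : ∀ μ ∈ ({0, Real.pi ^ 2 / s} : Set ℝ), ∀ᵐ ξ, ‖𝓕 (chirp μ (𝓕⁻ h₃)) ξ‖ ≤ A₃) :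
    eLpNorm (remFun h₁ h₂ h₃ s) 2 volume ≤
        ENNReal.ofReal s⁻¹ * (ENNReal.ofReal (A₂ * A₃) * eLpNorm h₁ 2 volume) ∧
      eLpNorm (remFun h₁ h₂ h₃ s) 2 volume ≤
        ENNReal.ofReal s⁻¹ * (ENNReal.ofReal (A₁ * A₃) * eLpNorm h₂ 2 volume) ∧
      eLpNorm (remFun h₁ h₂ h₃ s) 2 volume ≤
        ENNReal.ofReal s⁻¹ * (ENNReal.ofReal (A₁ * A₂) * eLpNorm h₃ 2 volume) := by
  have j₁ := H₁.integrable_fourierInv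
  have j₂ := H₂.integrable_fourierInv
  have j₃ := H₃.integrable_fourierInv
  set G : ℝ → ℝ → ℂ := modulatedProduct (𝓕⁻ h₁) (𝓕⁻ h₂) (𝓕⁻ h₃)
  have hR : remFun h₁ h₂ h₃ s = (-(Complex.I / (2 * s : ℝ))) • (G (Real.pi ^ 2 / s) - G 0) :=
    remFun_eq_modulatedProduct H₁ H₂ H₃ s
  have hGm : ∀ μ, AEStronglyMeasurable (G μ) volume := fun μ =>
    (continuous_modulatedProduct j₁ j₂ j₃ μ).aestronglyMeasurable
  -- Two terms of size `c` and a prefactor of modulus `1/(2s)` give `c/s`.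
  have key : ∀ c : ℝ≥0∞, (∀ μ ∈ ({0, Real.pi ^ 2 / s} : Set ℝ), eLpNorm (G μ) 2 volume ≤ c) →
      eLpNorm (remFun h₁ h₂ h₃ s) 2 volume ≤ ENNReal.ofReal s⁻¹ * c := by
    intro c hc
    rw [hR, eLpNorm_const_smul]
    have h1 := (eLpNorm_sub_le (hGm (Real.pi ^ 2 / s)) (hGm 0) one_le_two).trans
      (add_le_add (hc _ (by simp)) (hc 0 (by simp)))
    refine (mul_le_mul_right h1 _).trans_eq ?_
    rw [← two_mul, ← mul_assoc]
    congr 1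
    rw [← ofReal_norm, norm_neg, norm_div, Complex.norm_I, Complex.norm_real,
      Real.norm_of_nonneg (by positivity), ← ENNReal.ofReal_ofNat 2,
      ← ENNReal.ofReal_mul (by positivity)]
    congr 1
    field_simp
  have hG : ∀ μ, eLpNorm (G μ) 2 volume = _ := fun μ =>
    eLpNorm_integral_expI_mul_kernel j₁ j₂ j₃ (fun x => norm_fourierInv_le x) μ
  refine ⟨key _ fun μ hμ => ?_, key _ fun μ hμ => ?_, key _ fun μ hμ => ?_⟩
  · rw [hG, ← H₁.eLpNorm_fourier_chirp μ]
    refine ae_norm_triple_le (a₂ μ hμ) (a₃ μ hμ) _ _ fun ξ => ?_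
    simp only [norm_mul, RCLike.norm_conj]
    ring
  · rw [hG, ← H₂.eLpNorm_fourier_chirp μ]
    refine ae_norm_triple_le (a₁ μ hμ) (a₃ μ hμ) _ _ fun ξ => ?_
    simp only [norm_mul, RCLike.norm_conj]
    ring
  · rw [hG, ← H₃.eLpNorm_fourier_chirp μ]
    refine ae_norm_triple_le (a₁ μ hμ) (a₂ μ hμ) _ _ fun ξ => ?_
    simp only [norm_mul, RCLike.norm_conj]
    ring

end

/-! ### Uniform trilinear estimates and Lipschitz dependence -/

section

open FourierTransform

/-! ### Uniform bounds for the remainder -/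

/-- The bounds for the remainder with the decay exponent `θ` and the constant `C`. -/
def RemainderBd (θ C : ℝ) : Prop :=
  ∀ (h₁ h₂ h₃ : ℝ → ℂ) (L₁ N₁ L₂ N₂ L₃ N₃ s : ℝ), 0 < s →
    ProfileBd h₁ L₁ N₁ → ProfileBd h₂ L₂ N₂ → ProfileBd h₃ L₃ N₃ →
    (∀ ξ, ‖remFun h₁ h₂ h₃ s ξ‖ₑ ≤ ENNReal.ofReal (C * s ^ (-1 - θ) * (N₁ * N₂ * N₃))) ∧
    eLpNorm (remFun h₁ h₂ h₃ s) 2 volume ≤ ENNReal.ofReal (C * s⁻¹) *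
      (ENNReal.ofReal ((L₂ + s ^ (-θ) * N₂) * (L₃ + s ^ (-θ) * N₃)) * eLpNorm h₁ 2 volume) ∧
    eLpNorm (remFun h₁ h₂ h₃ s) 2 volume ≤ ENNReal.ofReal (C * s⁻¹) *
      (ENNReal.ofReal ((L₁ + s ^ (-θ) * N₁) * (L₃ + s ^ (-θ) * N₃)) * eLpNorm h₂ 2 volume) ∧
    eLpNorm (remFun h₁ h₂ h₃ s) 2 volume ≤ ENNReal.ofReal (C * s⁻¹) *
      (ENNReal.ofReal ((L₁ + s ^ (-θ) * N₁) * (L₂ + s ^ (-θ) * N₂)) * eLpNorm h₃ 2 volume)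

theorem pi_sq_div_rpow_le {θ s : ℝ} (h1 : θ ≤ 1) (hs : 0 < s) :
    (Real.pi ^ 2 / s) ^ θ ≤ 10 * s ^ (-θ) := by
  rw [Real.div_rpow (by positivity) hs.le, Real.rpow_neg hs.le, div_eq_mul_inv]
  have a : (Real.pi ^ 2) ^ θ ≤ 10 := by
    have h2 : (1 : ℝ) ≤ Real.pi ^ 2 := by nlinarith [Real.pi_gt_three]
    have h3 : Real.pi ^ 2 ≤ 10 := by nlinarith [Real.pi_lt_d2, Real.pi_gt_three]
    exact (by simpa using Real.rpow_le_rpow_of_exponent_le h2 h1 :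
      (Real.pi ^ 2) ^ θ ≤ Real.pi ^ 2).trans h3
  gcongr

theorem exists_remainderBd {θ : ℝ} (h0 : 0 < θ) (hθ : θ < 1 / 4) : ∃ C, 0 < C ∧ RemainderBd θ C := by
  obtain ⟨c, hc, hw⟩ := exists_lintegral_rpow_fourierInv_le h0.le hθ
  have h1 : θ ≤ 1 := by linarith
  -- The chirp changes the sup norm by at most `2 μ^θ c N ≤ 20 c s^(-θ) N`, as `π² ≤ 10`.
  set K : ℝ := 1 + 20 * c with hK
  have hK1 : 1 ≤ K := by linarith
  -- `K²` serves the `L²` bounds, with two factors in `L^∞`; `40 c³ = ½ · 4 · 20 · c³` serves the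
  -- pointwise bound.
  refine ⟨K ^ 2 + 40 * c ^ 3, by positivity, ?_⟩
  intro h₁ h₂ h₃ L₁ N₁ L₂ N₂ L₃ N₃ s hs H₁ H₂ H₃
  have w : ∀ {h : ℝ → ℂ} {L N : ℝ}, ProfileBd h L N →
      weightedL1 θ (𝓕⁻ h) ≤ ENNReal.ofReal (c * N) := fun H => hw _ _ _ H
  have hsθ : 0 < s ^ (-θ) := Real.rpow_pos_of_pos hs _
  have A : ∀ {h : ℝ → ℂ} {L N : ℝ}, ProfileBd h L N → ∀ μ ∈ ({0, Real.pi ^ 2 / s} : Set ℝ),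
      ∀ᵐ ξ, ‖𝓕 (chirp μ (𝓕⁻ h)) ξ‖ ≤ K * (L + s ^ (-θ) * N) := by
    intro h L N H μ hμ
    have hL := H.L_nonneg
    have hN := H.N_nonneg
    have hμ0 : 0 ≤ μ := by
      rcases hμ with rfl | rfl
      · exact le_rfl
      · positivity
    have hμθ : μ ^ θ ≤ 10 * s ^ (-θ) := by
      rcases hμ with rfl | rfl
      · rw [Real.zero_rpow h0.ne']
        positivity
      · exact pi_sq_div_rpow_le h1 hs
    filter_upwards [H.ae_norm_fourier_chirp_le h0.le h1 hμ0 (mul_nonneg hc hN) (w H)] with ξ hξ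
    refine hξ.trans ?_
    calc L + 2 * μ ^ θ * (c * N) ≤ L + 2 * (10 * s ^ (-θ)) * (c * N) := by gcongr
      _ ≤ K * (L + s ^ (-θ) * N) := by
        rw [hK]
        nlinarith [mul_nonneg hc hL, mul_nonneg hsθ.le hN]
  have a0 : ∀ {h : ℝ → ℂ} {L N : ℝ}, ProfileBd h L N → 0 ≤ L + s ^ (-θ) * N := fun H => by
    have := H.L_nonneg
    have := H.N_nonneg
    positivity
  have fin : ∀ {h h' k : ℝ → ℂ} {L N L' N' : ℝ}, ProfileBd h L N → ProfileBd h' L' N' →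
      ENNReal.ofReal s⁻¹ * (ENNReal.ofReal (K * (L + s ^ (-θ) * N) * (K * (L' + s ^ (-θ) * N'))) *
        eLpNorm k 2 volume) ≤ ENNReal.ofReal ((K ^ 2 + 40 * c ^ 3) * s⁻¹) *
          (ENNReal.ofReal ((L + s ^ (-θ) * N) * (L' + s ^ (-θ) * N')) * eLpNorm k 2 volume) := by
    intro h h' k L N L' N' H H'
    have p := mul_nonneg (a0 H) (a0 H')
    rw [← mul_assoc (ENNReal.ofReal s⁻¹), ← mul_assoc (ENNReal.ofReal (_ * s⁻¹)),
      ← ENNReal.ofReal_mul (by positivity), ← ENNReal.ofReal_mul (by positivity)]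
    refine mul_le_mul_left (ENNReal.ofReal_le_ofReal ?_) _
    have : 0 ≤ 40 * c ^ 3 * s⁻¹ * ((L + s ^ (-θ) * N) * (L' + s ^ (-θ) * N')) := by positivity
    linarith
  obtain ⟨b1, b2, b3⟩ := eLpNorm_remFun_le hs H₁ H₂ H₃ (A H₁) (A H₂) (A H₃)
  refine ⟨fun ξ => ?_, b1.trans (fin H₂ H₃), b2.trans (fin H₁ H₃), b3.trans (fin H₁ H₂)⟩
  rw [remFun, remainder_eq_integral_kernel H₁.integrable H₃.integrable H₂.integrable_fourierInv
    H₂.fourier_ae_eq, enorm_mul]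
  have e := enorm_integral_kernel_le h0.le h1 (c := 2 * (Real.pi ^ 2 / s)) (by positivity)
    H₁.integrable_fourierInv H₂.integrable_fourierInv H₃.integrable_fourierInv ξ
  have n1 := H₁.N_nonneg
  have n2 := H₂.N_nonneg
  have n3 := H₃.N_nonneg
  calc _ ≤ ENNReal.ofReal (2 * s)⁻¹ * (ENNReal.ofReal (4 * (2 * (Real.pi ^ 2 / s)) ^ θ) *
        (ENNReal.ofReal (c * N₁) * ENNReal.ofReal (c * N₂) * ENNReal.ofReal (c * N₃))) := by
        refine mul_le_mul' (le_of_eq ?_) (e.trans (mul_le_mul_right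
          (mul_le_mul' (mul_le_mul' (w H₁) (w H₂)) (w H₃)) _))
        rw [← ofReal_norm, norm_neg, norm_div, Complex.norm_I, Complex.norm_real,
          Real.norm_of_nonneg (by positivity), one_div]
    _ = ENNReal.ofReal ((2 * s)⁻¹ * (4 * (2 * (Real.pi ^ 2 / s)) ^ θ *
          (c * N₁ * (c * N₂) * (c * N₃)))) := by
        rw [ENNReal.ofReal_mul (by positivity : 0 ≤ (2 * s)⁻¹),
          ENNReal.ofReal_mul (by positivity : 0 ≤ 4 * (2 * (Real.pi ^ 2 / s)) ^ θ),
          ENNReal.ofReal_mul (by positivity : 0 ≤ c * N₁ * (c * N₂)),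
          ENNReal.ofReal_mul (by positivity : 0 ≤ c * N₁)]
    _ ≤ _ := by
        refine ENNReal.ofReal_le_ofReal ?_
        have h2 : (2 * (Real.pi ^ 2 / s)) ^ θ ≤ 20 * s ^ (-θ) := by
          rw [Real.mul_rpow zero_le_two (by positivity)]
          have b : (2 : ℝ) ^ θ ≤ 2 := by
            simpa using Real.rpow_le_rpow_of_exponent_le one_le_two h1
          calc _ ≤ 2 * (10 * s ^ (-θ)) := by
                gcongr
                exact pi_sq_div_rpow_le h1 hs
            _ = _ := by ring
        have h3 : s ^ (-1 - θ) = s⁻¹ * s ^ (-θ) := by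
          rw [sub_eq_add_neg, Real.rpow_add hs, Real.rpow_neg_one]
        rw [h3]
        calc _ ≤ (2 * s)⁻¹ * (4 * (20 * s ^ (-θ)) * (c * N₁ * (c * N₂) * (c * N₃))) := by gcongr
          _ = 40 * c ^ 3 * (s⁻¹ * s ^ (-θ)) * (N₁ * N₂ * N₃) := by
            rw [mul_inv]
            ring
          _ ≤ _ := by
            gcongr
            nlinarith [sq_nonneg K]

/-! ### Multilinearity -/

theorem ProfileBd.mono {h : ℝ → ℂ} {L N L' N' : ℝ} (H : ProfileBd h L N)
    (hL : L ≤ L') (hN : N ≤ N') : ProfileBd h L' N' where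
  integrable := H.integrable
  L_nonneg := H.L_nonneg.trans hL
  N_nonneg := H.N_nonneg.trans hN
  linf := H.linf.trans (ENNReal.ofReal_le_ofReal hL)
  l2 := H.l2.trans (ENNReal.ofReal_le_ofReal hN)
  trans := H.trans.mono (ENNReal.ofReal_le_ofReal hN)

theorem TransBd.sub {h k : ℝ → ℂ} {D E : ℝ≥0∞} (hm : AEStronglyMeasurable h volume)
    (km : AEStronglyMeasurable k volume) (H : TransBd h D) (K : TransBd k E) :
    TransBd (fun x => h x - k x) (D + E) := by
  intro r
  have q := (measurePreserving_add_right volume r).quasiMeasurePreserving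
  have e : (fun x => h (x + r) - k (x + r) - (h x - k x)) =
      (fun x => h (x + r) - h x) - fun x => k (x + r) - k x := by
    funext x
    simp only [Pi.sub_apply]
    ring
  rw [e, mul_add]
  refine (eLpNorm_sub_le ?_ ?_ one_le_two).trans (add_le_add (H r) (K r))
  · exact (hm.comp_quasiMeasurePreserving q).sub hm
  · exact (km.comp_quasiMeasurePreserving q).sub km

theorem ProfileBd.sub {h k : ℝ → ℂ} {L N L' N' : ℝ} (H : ProfileBd h L N)
    (K : ProfileBd k L' N') : ProfileBd (fun x => h x - k x) (L + L') (N + N') where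
  integrable := H.integrable.sub K.integrable
  L_nonneg := add_nonneg H.L_nonneg K.L_nonneg
  N_nonneg := add_nonneg H.N_nonneg K.N_nonneg
  linf := by
    rw [ENNReal.ofReal_add H.L_nonneg K.L_nonneg]
    exact (eLpNorm_sub_le H.integrable.1 K.integrable.1 le_top).trans (add_le_add H.linf K.linf)
  l2 := by
    rw [ENNReal.ofReal_add H.N_nonneg K.N_nonneg]
    exact (eLpNorm_sub_le H.integrable.1 K.integrable.1 one_le_two).trans (add_le_add H.l2 K.l2)
  trans := by
    rw [ENNReal.ofReal_add H.N_nonneg K.N_nonneg]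
    exact H.trans.sub H.integrable.1 K.integrable.1 K.trans

theorem ProfileBd.zero : ProfileBd (fun _ => 0) 0 0 where
  integrable := integrable_zero _ _ _
  L_nonneg := le_rfl
  N_nonneg := le_rfl
  linf := by
    change eLpNorm (0 : ℝ → ℂ) ⊤ volume ≤ _
    simp
  l2 := by
    change eLpNorm (0 : ℝ → ℂ) 2 volume ≤ _
    simp
  trans := fun k => by simp

theorem ProfileBd.translate {h : ℝ → ℂ} {L N : ℝ} (H : ProfileBd h L N) (k : ℝ) :
    ProfileBd (fun x => h (x + k)) L N where
  integrable := H.integrable.comp_add_right k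
  L_nonneg := H.L_nonneg
  N_nonneg := H.N_nonneg
  linf := (eLpNorm_comp_measurePreserving H.integrable.1
    (measurePreserving_add_right volume k)).trans_le H.linf
  l2 := (eLpNorm_comp_measurePreserving H.integrable.1
    (measurePreserving_add_right volume k)).trans_le H.l2
  trans := fun r => by
    have q := measurePreserving_add_right (volume : Measure ℝ) r
    have hm : AEStronglyMeasurable (fun x => h (x + r) - h x) volume :=
      (H.integrable.1.comp_quasiMeasurePreserving q.quasiMeasurePreserving).sub H.integrable.1
    have e := eLpNorm_comp_measurePreserving (p := 2) hm
      (measurePreserving_add_right (volume : Measure ℝ) k)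
    refine (le_of_eq ?_).trans (H.trans r)
    rw [← e]
    congr 1
    funext x
    simp [add_right_comm]

/-- The linear functional of the trilinear expression that the remainder is. -/
def remOf (s : ℝ) (F : ℝ × ℝ → ℂ) : ℂ :=
  -(Complex.I / ((4 * Real.pi * s : ℝ) : ℂ)) *
    ∫ q : ℝ × ℝ, (Complex.exp (-Complex.I * ((q.1 * q.2 / (2 * s) : ℝ) : ℂ)) - 1) * invFourier₂ F q

/-- The integrals in the definition of `remOf s F` converge absolutely. -/
structure RemConv (s : ℝ) (F : ℝ × ℝ → ℂ) : Prop where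
  left : Integrable F
  right : Integrable fun q : ℝ × ℝ =>
    (Complex.exp (-Complex.I * ((q.1 * q.2 / (2 * s) : ℝ) : ℂ)) - 1) * invFourier₂ F q

theorem invFourier₂_add {F G : ℝ × ℝ → ℂ} (hF : Integrable F) (hG : Integrable G) (q : ℝ × ℝ) :
    invFourier₂ (F + G) q = invFourier₂ F q + invFourier₂ G q := by
  unfold invFourier₂
  have m : ∀ {F : ℝ × ℝ → ℂ}, Integrable F → Integrable fun p : ℝ × ℝ =>
      Complex.exp (Complex.I * ((q.1 * p.1 + q.2 * p.2 : ℝ) : ℂ)) * F p := fun hF => by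
    refine integrable_mul_of_norm_le_one hF (Continuous.aestronglyMeasurable (by fun_prop)) ?_
    intro p
    rw [mul_comm, Complex.norm_exp_ofReal_mul_I]
  rw [← mul_add, ← integral_add (m hF) (m hG)]
  simp only [Pi.add_apply, mul_add]

theorem RemConv.add {s : ℝ} {F G : ℝ × ℝ → ℂ} (hF : RemConv s F) (hG : RemConv s G) :
    RemConv s (F + G) := by
  refine ⟨hF.1.add hG.1, ?_⟩
  simp only [invFourier₂_add hF.1 hG.1, mul_add]
  exact hF.2.add hG.2

theorem remOf_add {s : ℝ} {F G : ℝ × ℝ → ℂ} (hF : RemConv s F) (hG : RemConv s G) :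
    remOf s (F + G) = remOf s F + remOf s G := by
  unfold remOf
  simp only [invFourier₂_add hF.1 hG.1, mul_add]
  rw [integral_add hF.2 hG.2, mul_add]

section

variable {h₁ h₂ h₃ : ℝ → ℂ} {L₁ N₁ L₂ N₂ L₃ N₃ : ℝ}

theorem remConv_triple (H₁ : ProfileBd h₁ L₁ N₁) (H₂ : ProfileBd h₂ L₂ N₂)
    (H₃ : ProfileBd h₃ L₃ N₃) (s ξ : ℝ) :
    RemConv s (triple (fun _ => h₁) (fun _ => h₂) (fun _ => h₃) s ξ) :=
  ⟨integrable_triple H₁.integrable H₃.integrable H₂.integrable_fourierInv H₂.fourier_ae_eq s ξ,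
    integrable_remainderIntegrand H₁.integrable H₃.integrable H₁.integrable_fourierInv
      H₃.integrable_fourierInv H₂.integrable_fourierInv H₂.fourier_ae_eq s ξ⟩

/-- The trilinear expression telescopes pointwise; absolute convergence is what makes `remOf`
additive over the pieces. -/
theorem remFun_telescope {k₁ k₂ k₃ : ℝ → ℂ} {L₁' N₁' L₂' N₂' L₃' N₃' : ℝ}
    (H₁ : ProfileBd h₁ L₁ N₁) (H₂ : ProfileBd h₂ L₂ N₂)
    (H₃ : ProfileBd h₃ L₃ N₃) (K₁ : ProfileBd k₁ L₁' N₁') (K₂ : ProfileBd k₂ L₂' N₂')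
    (K₃ : ProfileBd k₃ L₃' N₃') (s ξ : ℝ) :
    remFun h₁ h₂ h₃ s ξ - remFun k₁ k₂ k₃ s ξ =
      remFun (fun x => h₁ x - k₁ x) h₂ h₃ s ξ + remFun k₁ (fun x => h₂ x - k₂ x) h₃ s ξ +
        remFun k₁ k₂ (fun x => h₃ x - k₃ x) s ξ := by
  have e : triple (fun _ => h₁) (fun _ => h₂) (fun _ => h₃) s ξ =
      triple (fun _ => fun x => h₁ x - k₁ x) (fun _ => h₂) (fun _ => h₃) s ξ +
      triple (fun _ => k₁) (fun _ => fun x => h₂ x - k₂ x) (fun _ => h₃) s ξ +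
      triple (fun _ => k₁) (fun _ => k₂) (fun _ => fun x => h₃ x - k₃ x) s ξ +
      triple (fun _ => k₁) (fun _ => k₂) (fun _ => k₃) s ξ := by
    funext p
    simp only [triple, Pi.add_apply, map_sub]
    ring
  have c1 := remConv_triple (H₁.sub K₁) H₂ H₃ s ξ
  have c2 := remConv_triple K₁ (H₂.sub K₂) H₃ s ξ
  have c3 := remConv_triple K₁ K₂ (H₃.sub K₃) s ξ
  have c4 := remConv_triple K₁ K₂ K₃ s ξ
  change remOf s _ - remOf s _ = remOf s _ + remOf s _ + remOf s _
  rw [e, remOf_add ((c1.add c2).add c3) c4, remOf_add (c1.add c2) c3, remOf_add c1 c2]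
  ring

end

/-- Reduces regularity in `ξ` to Lipschitz dependence on the factors, with no differentiation under
the integral. -/
theorem remFun_translate (h₁ h₂ h₃ : ℝ → ℂ) (s ξ k : ℝ) :
    remFun h₁ h₂ h₃ s (ξ + k) =
      remFun (fun x => h₁ (x + k)) (fun x => h₂ (x + k)) (fun x => h₃ (x + k)) s ξ := by
  change remOf s _ = remOf s _
  congr 1
  funext p
  simp only [triple, add_sub_right_comm]

theorem remFun_eq_zero {h₁ h₂ h₃ : ℝ → ℂ} {s ξ : ℝ}
    (h : ∀ p, triple (fun _ => h₁) (fun _ => h₂) (fun _ => h₃) s ξ p = 0) :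
    remFun h₁ h₂ h₃ s ξ = 0 := by
  change remOf s _ = 0
  rw [show triple (fun _ => h₁) (fun _ => h₂) (fun _ => h₃) s ξ = fun _ => 0 from funext h]
  simp [remOf, invFourier₂]

/-- The remainder `R(g, g, f)` depends on `g` and `f` in a Lipschitz way. -/
theorem RemainderBd.eLpNorm_sub_le {θ C : ℝ} (HC : RemainderBd θ C) {g f g' f' : ℝ → ℂ}
    {Lg Ng Lf Nf s : ℝ} (hs : 0 < s) (Hg : ProfileBd g Lg Ng) (Hf : ProfileBd f Lf Nf)
    (Hg' : ProfileBd g' Lg Ng) (Hf' : ProfileBd f' Lf Nf) :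
    eLpNorm (fun ξ => remFun g g f s ξ - remFun g' g' f' s ξ) 2 volume ≤
      ENNReal.ofReal (C * s⁻¹) *
        (ENNReal.ofReal (2 * ((Lg + s ^ (-θ) * Ng) * (Lf + s ^ (-θ) * Nf))) *
            eLpNorm (fun x => g x - g' x) 2 volume +
          ENNReal.ofReal ((Lg + s ^ (-θ) * Ng) * (Lg + s ^ (-θ) * Ng)) *
            eLpNorm (fun x => f x - f' x) 2 volume) := by
  have e : (fun ξ => remFun g g f s ξ - remFun g' g' f' s ξ) =
      remFun (fun x => g x - g' x) g f s + remFun g' (fun x => g x - g' x) f s +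
        remFun g' g' (fun x => f x - f' x) s :=
    funext fun ξ => remFun_telescope Hg Hg Hf Hg' Hg' Hf' s ξ
  have m1 := (continuous_remFun (Hg.sub Hg') Hg Hf s).aestronglyMeasurable (μ := volume)
  have m2 := (continuous_remFun Hg' (Hg.sub Hg') Hf s).aestronglyMeasurable (μ := volume)
  have m3 := (continuous_remFun Hg' Hg' (Hf.sub Hf') s).aestronglyMeasurable (μ := volume)
  -- The difference is always placed in the `L²` slot, so its sup and `H¹` bounds do not enter the
  -- estimate.
  have b1 := (HC _ _ _ _ _ _ _ _ _ s hs (Hg.sub Hg') Hg Hf).2.1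
  have b2 := (HC _ _ _ _ _ _ _ _ _ s hs Hg' (Hg.sub Hg') Hf).2.2.1
  have b3 := (HC _ _ _ _ _ _ _ _ _ s hs Hg' Hg' (Hf.sub Hf')).2.2.2
  rw [e]
  refine ((eLpNorm_add_le (m1.add m2) m3 one_le_two).trans (add_le_add
    ((eLpNorm_add_le m1 m2 one_le_two).trans (add_le_add b1 b2)) b3)).trans_eq ?_
  rw [ENNReal.ofReal_mul zero_le_two, ENNReal.ofReal_ofNat]
  ring

end

/-! ### Weighted `L²` bounds from cutoffs and tails -/

section

open FourierTransform

/-! ### Cutoffs -/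

/-- A piecewise linear cutoff, equal to `1` on `[-r, r]` and to `0` outside `[-2r, 2r]`. -/
def cutoff (r x : ℝ) : ℝ := max 0 (min 1 (2 - |x| / r))

theorem cutoff_nonneg (r x : ℝ) : 0 ≤ cutoff r x := le_max_left _ _

theorem cutoff_le_one (r x : ℝ) : cutoff r x ≤ 1 := max_le zero_le_one (min_le_left _ _)

theorem cutoff_eq_one {r x : ℝ} (hr : 0 < r) (h : |x| ≤ r) : cutoff r x = 1 := by
  have : |x| / r ≤ 1 := (div_le_one hr).2 h
  rw [cutoff, min_eq_left (by linarith), max_eq_right zero_le_one]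

theorem cutoff_eq_zero {r x : ℝ} (hr : 0 < r) (h : 2 * r < |x|) : cutoff r x = 0 := by
  have : 2 < |x| / r := (lt_div_iff₀ hr).2 h
  exact max_eq_left ((min_le_right _ _).trans (by linarith))

theorem continuous_cutoff (r : ℝ) : Continuous (cutoff r) := by
  unfold cutoff
  fun_prop

theorem abs_cutoff_sub_le {r : ℝ} (hr : 1 ≤ r) (x y : ℝ) : |cutoff r x - cutoff r y| ≤ |x - y| := by
  have h0 : 0 < r := by linarith
  have h1 : |cutoff r x - cutoff r y| ≤ |(2 - |x| / r) - (2 - |y| / r)| := by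
    unfold cutoff
    rw [max_comm 0, max_comm 0]
    refine (abs_max_sub_max_le_abs _ _ (0 : ℝ)).trans ?_
    exact (abs_min_sub_min_le_max (1 : ℝ) _ 1 _).trans (by simp)
  refine h1.trans ?_
  have e : (2 - |x| / r) - (2 - |y| / r) = (|y| - |x|) / r := by ring
  rw [e, abs_div, abs_of_pos h0]
  refine (div_le_self (abs_nonneg _) hr).trans ?_
  rw [abs_sub_comm x y]
  exact abs_abs_sub_abs_le y x

theorem ProfileBd.cutoff {h : ℝ → ℂ} {L N : ℝ} (H : ProfileBd h L N) {r : ℝ} (hr : 1 ≤ r) :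
    ProfileBd (fun x => (cutoff r x : ℂ) * h x) L (2 * N) where
  integrable := by
    refine integrable_mul_of_norm_le_one H.integrable
      (Complex.continuous_ofReal.comp (continuous_cutoff r)).aestronglyMeasurable fun x => ?_
    rw [Complex.norm_real, Real.norm_of_nonneg (cutoff_nonneg _ _)]
    exact cutoff_le_one _ _
  L_nonneg := H.L_nonneg
  N_nonneg := mul_nonneg zero_le_two H.N_nonneg
  linf := by
    refine (eLpNorm_mono fun x => ?_).trans H.linf
    rw [norm_mul, Complex.norm_real, Real.norm_of_nonneg (cutoff_nonneg _ _)]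
    exact mul_le_of_le_one_left (norm_nonneg _) (cutoff_le_one _ _)
  l2 := by
    refine (eLpNorm_mono fun x => ?_).trans
      (H.l2.trans (ENNReal.ofReal_le_ofReal (by linarith [H.N_nonneg])))
    rw [norm_mul, Complex.norm_real, Real.norm_of_nonneg (cutoff_nonneg _ _)]
    exact mul_le_of_le_one_left (norm_nonneg _) (cutoff_le_one _ _)
  trans := by
    intro k
    have q := measurePreserving_add_right (volume : Measure ℝ) k
    have hm : AEStronglyMeasurable (fun x => h (x + k) - h x) volume :=
      (H.integrable.1.comp_quasiMeasurePreserving q.quasiMeasurePreserving).sub H.integrable.1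
    -- Product rule for differences. As `r ≥ 1` the cutoff has Lipschitz constant at most `1`, and
    -- the second term costs one more `N`.
    have b : ∀ x, ‖(CoupledNLS.cutoff r (x + k) : ℂ) * h (x + k) -
        (CoupledNLS.cutoff r x : ℂ) * h x‖ ≤ ‖(‖h (x + k) - h x‖ + |k| * ‖h x‖ : ℝ)‖ := by
      intro x
      rw [Real.norm_of_nonneg (by positivity)]
      have e : (CoupledNLS.cutoff r (x + k) : ℂ) * h (x + k) - (CoupledNLS.cutoff r x : ℂ) * h x =
          (CoupledNLS.cutoff r (x + k) : ℂ) * (h (x + k) - h x) +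
            ((CoupledNLS.cutoff r (x + k) - CoupledNLS.cutoff r x : ℝ) : ℂ) * h x := by
        push_cast
        ring
      rw [e]
      refine (norm_add_le _ _).trans (add_le_add ?_ ?_)
      · rw [norm_mul, Complex.norm_real, Real.norm_of_nonneg (cutoff_nonneg _ _)]
        exact mul_le_of_le_one_left (norm_nonneg _) (cutoff_le_one _ _)
      · rw [norm_mul, Complex.norm_real]
        refine mul_le_mul_of_nonneg_right ?_ (norm_nonneg _)
        simpa using abs_cutoff_sub_le hr (x + k) x
    refine (eLpNorm_mono b).trans ?_
    have hk : eLpNorm (fun x => |k| * ‖h x‖) 2 volume ≤ ENNReal.ofReal |k| * ENNReal.ofReal N := by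
      have := eLpNorm_const_smul (|k|) (fun x => ‖h x‖) 2 (volume : Measure ℝ)
      rw [eLpNorm_norm] at this
      change eLpNorm (|k| • fun x => ‖h x‖) 2 volume ≤ _
      rw [this, Real.enorm_eq_ofReal (abs_nonneg k)]
      exact mul_le_mul_right H.l2 _
    refine (eLpNorm_add_le hm.norm (H.integrable.1.norm.const_mul |k|) one_le_two).trans ?_
    rw [two_mul, ENNReal.ofReal_add H.N_nonneg H.N_nonneg, mul_add]
    refine add_le_add ?_ hk
    rw [eLpNorm_norm]
    exact H.trans k

theorem eLpNorm_sub_cutoff_le {h : ℝ → ℂ} {r : ℝ} (hr : 0 < r) :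
    eLpNorm (fun x => h x - (cutoff r x : ℂ) * h x) 2 volume ^ 2 ≤
      ∫⁻ x in {x | r < |x|}, ‖h x‖ₑ ^ 2 := by
  rw [eLpNorm_two_sq, ← lintegral_indicator (measurableSet_lt measurable_const (by fun_prop))]
  refine lintegral_mono fun x => ?_
  by_cases hx : r < |x|
  · rw [indicator_of_mem (by exact hx)]
    refine pow_le_pow_left' ?_ 2
    have e : h x - (cutoff r x : ℂ) * h x = ((1 - cutoff r x : ℝ) : ℂ) * h x := by
      push_cast
      ring
    rw [e, ← ofReal_norm, ← ofReal_norm]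
    refine ENNReal.ofReal_le_ofReal ?_
    rw [norm_mul, Complex.norm_real, Real.norm_of_nonneg (by linarith [cutoff_le_one r x])]
    exact mul_le_of_le_one_left (norm_nonneg _) (by linarith [cutoff_nonneg r x])
  · rw [cutoff_eq_one hr (not_lt.1 hx)]
    simp

/-! ### Layer cake -/

/-- Each side is `p` times the integral of `t^(p-1)` against the measure of the superlevel sets, so
a comparison of tails is a comparison of moments. -/
theorem lintegral_rpow_le_of_measure_le {μ ν : Measure ℝ} {F G : ℝ → ℝ} (hF0 : ∀ x, 0 ≤ F x)
    (hG0 : ∀ x, 0 ≤ G x) (hF : Measurable F) (hG : Measurable G) {p : ℝ} (hp : 0 < p)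
    (h : ∀ t, 0 < t → μ {x | t < F x} ≤ ν {x | t < G x}) :
    ∫⁻ x, ENNReal.ofReal (F x ^ p) ∂μ ≤ ∫⁻ x, ENNReal.ofReal (G x ^ p) ∂ν := by
  rw [lintegral_rpow_eq_lintegral_meas_lt_mul μ (.of_forall hF0) hF.aemeasurable hp,
    lintegral_rpow_eq_lintegral_meas_lt_mul ν (.of_forall hG0) hG.aemeasurable hp]
  refine mul_le_mul_right (setLIntegral_mono' measurableSet_Ioi fun t ht => ?_) _
  exact mul_le_mul_left (h t ht) _

theorem ennreal_add_sq_le (a b : ℝ≥0∞) : (a + b) ^ 2 ≤ 4 * (a ^ 2 + b ^ 2) := by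
  rcases le_total a b with h | h
  · calc (a + b) ^ 2 ≤ (2 * b) ^ 2 := pow_le_pow_left' (by rw [two_mul]; exact add_le_add_left h b) 2
      _ = 4 * b ^ 2 := by ring
      _ ≤ _ := mul_le_mul_right le_add_self 4
  · calc (a + b) ^ 2 ≤ (2 * a) ^ 2 := pow_le_pow_left' (by rw [two_mul]; exact add_le_add_right h a) 2
      _ = 4 * a ^ 2 := by ring
      _ ≤ _ := mul_le_mul_right le_self_add 4

theorem enorm_pow_mul_sq (i : ℕ) (ξ : ℝ) (z : ℂ) :
    ‖(ξ : ℂ) ^ i * z‖ₑ ^ 2 = ENNReal.ofReal (|ξ| ^ (2 * i)) * ‖z‖ₑ ^ 2 := by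
  rw [enorm_mul, mul_pow]
  congr 1
  rw [← ofReal_norm, norm_pow, Complex.norm_real, ← ENNReal.ofReal_pow (by positivity),
    Real.norm_eq_abs, ← pow_mul, mul_comm]

/-- A weighted `L²` bound from bounds for the tails. -/
theorem eLpNorm_pow_mul_le_of_tail_le {R g f : ℝ → ℂ} (hR : Measurable R) (hg : Measurable g)
    (hf : Measurable f) {c₁ c₂ Ng Nf : ℝ} (hc₁ : 0 ≤ c₁) (hc₂ : 0 ≤ c₂)
    (hNg : 0 ≤ Ng) (hNf : 0 ≤ Nf)
    (h : ∀ t, 0 < t → ∫⁻ ξ in {ξ | t < |ξ| / 6}, ‖R ξ‖ₑ ^ 2 ≤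
      4 * (ENNReal.ofReal c₁ ^ 2 * (∫⁻ ξ in {ξ | t < max |ξ| 1}, ‖g ξ‖ₑ ^ 2) +
        ENNReal.ofReal c₂ ^ 2 * ∫⁻ ξ in {ξ | t < max |ξ| 1}, ‖f ξ‖ₑ ^ 2)) {i : ℕ} (hi : i ≠ 0)
    (hg0 : eLpNorm g 2 volume ≤ ENNReal.ofReal Ng)
    (hf0 : eLpNorm f 2 volume ≤ ENNReal.ofReal Nf)
    (hgi : eLpNorm (fun x : ℝ => (x : ℂ) ^ i * g x) 2 volume ≤ ENNReal.ofReal Ng)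
    (hfi : eLpNorm (fun x : ℝ => (x : ℂ) ^ i * f x) 2 volume ≤ ENNReal.ofReal Nf) :
    eLpNorm (fun x : ℝ => (x : ℂ) ^ i * R x) 2 volume ≤
      ENNReal.ofReal (6 ^ i * (3 * (c₁ * Ng + c₂ * Nf))) := by
  set d : ℝ → ℝ≥0∞ := fun ξ =>
    4 * (ENNReal.ofReal c₁ ^ 2 * ‖g ξ‖ₑ ^ 2 + ENNReal.ofReal c₂ ^ 2 * ‖f ξ‖ₑ ^ 2)
  have mg : Measurable fun ξ => ‖g ξ‖ₑ ^ 2 := hg.enorm.pow_const 2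
  have mf : Measurable fun ξ => ‖f ξ‖ₑ ^ 2 := hf.enorm.pow_const 2
  have mR : Measurable fun ξ => ‖R ξ‖ₑ ^ 2 := hR.enorm.pow_const 2
  have md : Measurable d := ((mg.const_mul _).add (mf.const_mul _)).const_mul _
  have id : ∀ (w : ℝ → ℝ≥0∞) (μ : Measure ℝ), Measurable w → ∫⁻ ξ, w ξ * d ξ ∂μ =
      4 * (ENNReal.ofReal c₁ ^ 2 * (∫⁻ ξ, w ξ * ‖g ξ‖ₑ ^ 2 ∂μ) +
        ENNReal.ofReal c₂ ^ 2 * ∫⁻ ξ, w ξ * ‖f ξ‖ₑ ^ 2 ∂μ) := by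
    intro w μ hw
    have e : ∀ ξ, w ξ * d ξ = 4 * (ENNReal.ofReal c₁ ^ 2 * (w ξ * ‖g ξ‖ₑ ^ 2) +
        ENNReal.ofReal c₂ ^ 2 * (w ξ * ‖f ξ‖ₑ ^ 2)) := fun ξ => by
      simp only [d]
      ring
    have m1 : Measurable fun ξ => w ξ * ‖g ξ‖ₑ ^ 2 := hw.mul mg
    have m2 : Measurable fun ξ => w ξ * ‖f ξ‖ₑ ^ 2 := hw.mul mf
    have m3 : Measurable fun ξ => ENNReal.ofReal c₁ ^ 2 * (w ξ * ‖g ξ‖ₑ ^ 2) +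
        ENNReal.ofReal c₂ ^ 2 * (w ξ * ‖f ξ‖ₑ ^ 2) := (m1.const_mul _).add (m2.const_mul _)
    simp only [e]
    rw [lintegral_const_mul _ m3,
      lintegral_add_left (m1.const_mul _), lintegral_const_mul _ m1, lintegral_const_mul _ m2]
  have mF : Measurable fun ξ : ℝ => |ξ| / 6 := by fun_prop
  have mG : Measurable fun ξ : ℝ => max |ξ| 1 := by fun_prop
  -- The measures have densities `‖R‖²` and `d`. The dilation by `6` between the tails turns into
  -- the factor `6 ^ i`; the positive exponent `2i` is where `i ≠ 0` is needed.
  have key := lintegral_rpow_le_of_measure_le (μ := volume.withDensity fun ξ => ‖R ξ‖ₑ ^ 2)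
    (ν := volume.withDensity d) (F := fun ξ => |ξ| / 6) (G := fun ξ => max |ξ| 1)
    (fun ξ => by positivity) (fun ξ => by positivity) mF mG (p := ((2 * i : ℕ) : ℝ))
    (by positivity) (fun t ht => by
      rw [withDensity_apply _ (measurableSet_lt measurable_const mF),
        withDensity_apply _ (measurableSet_lt measurable_const mG)]
      refine (h t ht).trans_eq ?_
      have := id (fun _ => 1) (volume.restrict {ξ | t < max |ξ| 1}) measurable_const
      simp only [one_mul] at this
      exact this.symm)
  simp only [Real.rpow_natCast] at key
  rw [lintegral_withDensity_eq_lintegral_mul _ mR (mF.pow_const _).ennreal_ofReal,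
    lintegral_withDensity_eq_lintegral_mul _ md (mG.pow_const _).ennreal_ofReal] at key
  rw [eLpNorm_two_le_iff]
  have e1 : ∫⁻ ξ : ℝ, ‖(ξ : ℂ) ^ i * R ξ‖ₑ ^ 2 = ENNReal.ofReal (6 ^ (2 * i)) *
      ∫⁻ ξ, ((fun ξ => ‖R ξ‖ₑ ^ 2) * fun ξ => ENNReal.ofReal ((|ξ| / 6) ^ (2 * i))) ξ := by
    rw [← lintegral_const_mul' _ _ ENNReal.ofReal_ne_top]
    refine lintegral_congr fun ξ => ?_
    rw [enorm_pow_mul_sq, Pi.mul_apply, mul_comm (‖R ξ‖ₑ ^ 2), ← mul_assoc,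
      ← ENNReal.ofReal_mul (by positivity), ← mul_pow]
    congr 3
    ring
  have mw : Measurable fun ξ : ℝ => 1 + ENNReal.ofReal (|ξ| ^ (2 * i)) := by fun_prop
  have e2 : ∫⁻ ξ, (d * fun ξ => ENNReal.ofReal (max |ξ| 1 ^ (2 * i))) ξ ≤
      ∫⁻ ξ, (1 + ENNReal.ofReal (|ξ| ^ (2 * i))) * d ξ := by
    refine lintegral_mono fun ξ => ?_
    rw [Pi.mul_apply, mul_comm]
    refine mul_le_mul_left ?_ _
    rw [← ENNReal.ofReal_one, ← ENNReal.ofReal_add zero_le_one (by positivity)]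
    refine ENNReal.ofReal_le_ofReal ?_
    rcases max_cases |ξ| 1 with ⟨h1, -⟩ | ⟨h1, -⟩ <;> rw [h1]
    · linarith
    · rw [one_pow]
      linarith [pow_nonneg (abs_nonneg ξ) (2 * i)]
  have e3 : ∀ (k : ℝ → ℂ) (N : ℝ), Measurable k → 0 ≤ N → eLpNorm k 2 volume ≤ ENNReal.ofReal N →
      eLpNorm (fun x : ℝ => (x : ℂ) ^ i * k x) 2 volume ≤ ENNReal.ofReal N →
      ∫⁻ ξ, (1 + ENNReal.ofReal (|ξ| ^ (2 * i))) * ‖k ξ‖ₑ ^ 2 ≤ ENNReal.ofReal (2 * N ^ 2) := by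
    intro k N hk hN h0 h1
    rw [eLpNorm_two_le_iff] at h0 h1
    simp only [enorm_pow_mul_sq] at h1
    simp only [add_mul, one_mul]
    rw [lintegral_add_left (hk.enorm.pow_const 2), two_mul (N ^ 2),
      ENNReal.ofReal_add (by positivity) (by positivity), ENNReal.ofReal_pow hN]
    exact add_le_add h0 h1
  rw [e1]
  refine (mul_le_mul_right (key.trans (e2.trans_eq (id _ _ mw))) _).trans ?_
  refine (mul_le_mul_right (mul_le_mul_right (add_le_add
    (mul_le_mul_right (e3 g Ng hg hNg hg0 hgi) _)
    (mul_le_mul_right (e3 f Nf hf hNf hf0 hfi) _)) _) _).trans ?_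
  rw [← ENNReal.ofReal_pow hc₁, ← ENNReal.ofReal_pow hc₂, ← ENNReal.ofReal_mul (by positivity),
    ← ENNReal.ofReal_mul (by positivity), ← ENNReal.ofReal_add (by positivity) (by positivity),
    ← ENNReal.ofReal_ofNat 4, ← ENNReal.ofReal_mul (by positivity),
    ← ENNReal.ofReal_mul (by positivity), ← ENNReal.ofReal_pow (by positivity)]
  refine ENNReal.ofReal_le_ofReal ?_
  rw [mul_pow, ← pow_mul, mul_comm i 2]
  refine mul_le_mul_of_nonneg_left ?_ (by positivity)
  -- With `a = c₁ Ng` and `b = c₂ Nf` this is `8 (a² + b²) ≤ 9 (a + b)²`.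
  nlinarith [mul_nonneg hc₁ hNg, mul_nonneg hc₂ hNf, mul_nonneg (mul_nonneg hc₁ hNg)
    (mul_nonneg hc₂ hNf), sq_nonneg (c₁ * Ng), sq_nonneg (c₂ * Nf)]

/-! ### The remainder at a fixed time -/

theorem abs_add_sub_le (a b c : ℝ) : |a + b - c| ≤ |a| + |b| + |c| :=
  (abs_sub _ _).trans (add_le_add_left (abs_add_le _ _) _)

/-- The remainder of factors cut off at `r` vanishes beyond `6r`. -/
theorem remFun_cutoff_eq_zero (g f : ℝ → ℂ) {r : ℝ} (hr : 0 < r) {s ξ : ℝ} (hξ : 6 * r < |ξ|) :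
    remFun (fun x => (cutoff r x : ℂ) * g x) (fun x => (cutoff r x : ℂ) * g x)
      (fun x => (cutoff r x : ℂ) * f x) s ξ = 0 := by
  refine remFun_eq_zero fun p => ?_
  rw [triple]
  by_contra hne
  have z : ∀ x, cutoff r x ≠ 0 → |x| ≤ 2 * r := fun x h => by
    by_contra h'
    exact h (cutoff_eq_zero hr (not_le.1 h'))
  have a1 : cutoff r (ξ - p.2) ≠ 0 := fun h => hne (by simp [h])
  have a2 : cutoff r (ξ - p.1 - p.2) ≠ 0 := fun h => hne (by simp [h])
  have a3 : cutoff r (ξ - p.1) ≠ 0 := fun h => hne (by simp [h])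
  have e : ξ = (ξ - p.2) + (ξ - p.1) - (ξ - p.1 - p.2) := by ring
  have := abs_add_sub_le (ξ - p.2) (ξ - p.1) (ξ - p.1 - p.2)
  rw [← e] at this
  linarith [z _ a1, z _ a2, z _ a3]

/-- The size in `L²` of the remainder `R(g, g, f)` at time `s`. -/
def remSize (θ s Lg Ng Lf Nf : ℝ) : ℝ :=
  s⁻¹ * ((Lg + s ^ (-θ) * Ng) * (Lf + s ^ (-θ) * Nf) * Ng + (Lg + s ^ (-θ) * Ng) ^ 2 * Nf)

theorem RemainderBd.exists_bounds {θ C : ℝ} (HC : RemainderBd θ C) (hC : 0 < C) (m : ℕ) :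
    ∃ K, 0 < K ∧ ∀ (g f : ℝ → ℂ) (Lg Ng Lf Nf s : ℝ), 0 < s → Measurable g → Measurable f →
      ProfileBd g Lg Ng → ProfileBd f Lf Nf →
      (∀ i ≤ m, eLpNorm (fun x : ℝ => (x : ℂ) ^ i * g x) 2 volume ≤ ENNReal.ofReal Ng) →
      (∀ i ≤ m, eLpNorm (fun x : ℝ => (x : ℂ) ^ i * f x) 2 volume ≤ ENNReal.ofReal Nf) →
      TransBd (remFun g g f s) (ENNReal.ofReal (K * remSize θ s Lg Ng Lf Nf)) ∧
      ∀ i ≤ m, eLpNorm (fun x : ℝ => (x : ℂ) ^ i * remFun g g f s x) 2 volume ≤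
        ENNReal.ofReal (K * remSize θ s Lg Ng Lf Nf) := by
  -- `24 = 3 · 8`, with `3` from the tail lemma and `8` from `c₁` below; `6 ^ m` bounds the dilation
  -- factors of all weights.
  refine ⟨24 * 6 ^ m * C, by positivity, ?_⟩
  intro g f Lg Ng Lf Nf s hs mg mf Hg Hf wg wf
  have hLg := Hg.L_nonneg
  have hLf := Hf.L_nonneg
  have hNg := Hg.N_nonneg
  have hNf := Hf.N_nonneg
  have hsθ : 0 < s ^ (-θ) := Real.rpow_pos_of_pos hs _
  set ag : ℝ := Lg + s ^ (-θ) * Ng with hag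
  set af : ℝ := Lf + s ^ (-θ) * Nf with haf
  have ag0 : 0 ≤ ag := by positivity
  have af0 : 0 ≤ af := by positivity
  have h6 : (1 : ℝ) ≤ 6 ^ m := one_le_pow₀ (by norm_num)
  have mR := (continuous_remFun Hg Hg Hf s).measurable
  -- Cutting off doubles `Ng` and `Nf`, hence at most doubles `ag` and `af`: the Lipschitz
  -- coefficients `2` and `1` become `8` and `4`.
  set c₁ : ℝ := C * s⁻¹ * (8 * (ag * af)) with hc₁
  set c₂ : ℝ := C * s⁻¹ * (4 * ag ^ 2) with hc₂
  have c₁0 : 0 ≤ c₁ := by positivity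
  have c₂0 : 0 ≤ c₂ := by positivity
  have htot : 3 * (c₁ * Ng + c₂ * Nf) ≤ 24 * C * remSize θ s Lg Ng Lf Nf := by
    rw [remSize, ← hag, ← haf, hc₁, hc₂]
    have : 0 ≤ C * s⁻¹ * (ag ^ 2 * Nf) := by positivity
    nlinarith
  have hrem0 : 0 ≤ remSize θ s Lg Ng Lf Nf := by
    rw [remSize]
    positivity
  have h24 : 24 * C * remSize θ s Lg Ng Lf Nf ≤ 24 * 6 ^ m * C * remSize θ s Lg Ng Lf Nf := by
    have : 0 ≤ 24 * C * remSize θ s Lg Ng Lf Nf := by positivity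
    nlinarith
  -- the Lipschitz bound, for competitors of at most twice the size
  have lip : ∀ g' f' : ℝ → ℂ, ProfileBd g' Lg (2 * Ng) → ProfileBd f' Lf (2 * Nf) →
      eLpNorm (fun ξ => remFun g g f s ξ - remFun g' g' f' s ξ) 2 volume ≤
        ENNReal.ofReal c₁ * eLpNorm (fun x => g x - g' x) 2 volume +
          ENNReal.ofReal c₂ * eLpNorm (fun x => f x - f' x) 2 volume := by
    intro g' f' Hg' Hf'
    refine (HC.eLpNorm_sub_le hs (Hg.mono le_rfl (by linarith)) (Hf.mono le_rfl (by linarith))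
      Hg' Hf').trans ?_
    have b1 : Lg + s ^ (-θ) * (2 * Ng) ≤ 2 * ag := by
      rw [hag]
      nlinarith
    have b2 : Lf + s ^ (-θ) * (2 * Nf) ≤ 2 * af := by
      rw [haf]
      nlinarith
    rw [mul_add, ← mul_assoc (ENNReal.ofReal (C * s⁻¹)), ← mul_assoc (ENNReal.ofReal (C * s⁻¹)),
      ← ENNReal.ofReal_mul (by positivity), ← ENNReal.ofReal_mul (by positivity)]
    refine add_le_add (mul_le_mul_left (ENNReal.ofReal_le_ofReal ?_) _)
      (mul_le_mul_left (ENNReal.ofReal_le_ofReal ?_) _)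
    · calc _ ≤ C * s⁻¹ * (2 * (2 * ag * (2 * af))) := by gcongr
        _ = c₁ := by rw [hc₁]; ring
    · calc _ ≤ C * s⁻¹ * (2 * ag * (2 * ag)) := by gcongr
        _ = c₂ := by rw [hc₂]; ring
  have lip0 : eLpNorm (remFun g g f s) 2 volume ≤
      ENNReal.ofReal c₁ * eLpNorm g 2 volume + ENNReal.ofReal c₂ * eLpNorm f 2 volume := by
    have := lip (fun _ => 0) (fun _ => 0) (ProfileBd.zero.mono hLg (by positivity))
      (ProfileBd.zero.mono hLf (by positivity))
    have z : ∀ ξ, remFun (fun _ => 0) (fun _ => 0) (fun _ => 0) s ξ = 0 := fun ξ =>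
      remFun_eq_zero fun p => by simp [triple]
    simpa only [z, sub_zero] using this
  have tot : ∀ {dg df : ℝ≥0∞} {k : ℝ}, 0 ≤ k → dg ≤ ENNReal.ofReal (k * Ng) →
      df ≤ ENNReal.ofReal (k * Nf) → ENNReal.ofReal c₁ * dg + ENNReal.ofReal c₂ * df ≤
        ENNReal.ofReal k * ENNReal.ofReal (24 * 6 ^ m * C * remSize θ s Lg Ng Lf Nf) := by
    intro dg df k hk h1 h2
    refine (add_le_add (mul_le_mul_right h1 _) (mul_le_mul_right h2 _)).trans ?_
    rw [← ENNReal.ofReal_mul c₁0, ← ENNReal.ofReal_mul c₂0, ← ENNReal.ofReal_mul hk,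
      ← ENNReal.ofReal_add (by positivity) (by positivity)]
    refine ENNReal.ofReal_le_ofReal ?_
    have h0 : 0 ≤ c₁ * Ng + c₂ * Nf := by positivity
    calc _ = k * (c₁ * Ng + c₂ * Nf) := by ring
      _ ≤ _ := mul_le_mul_of_nonneg_left (by linarith) hk
  refine ⟨fun k => ?_, fun i hi => ?_⟩
  · simp only [remFun_translate]
    have e := lip (fun x => g (x + k)) (fun x => f (x + k))
      ((Hg.translate k).mono le_rfl (by linarith)) ((Hf.translate k).mono le_rfl (by linarith))
    have sw : ∀ a b : ℝ → ℂ, eLpNorm (fun x => a x - b x) 2 volume =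
        eLpNorm (fun x => b x - a x) 2 volume := fun a b =>
      eLpNorm_congr_norm_ae (.of_forall fun x => norm_sub_rev _ _)
    rw [sw, sw g, sw f] at e
    refine e.trans (tot (abs_nonneg k) ?_ ?_)
    · rw [ENNReal.ofReal_mul (abs_nonneg k)]
      exact Hg.trans k
    · rw [ENNReal.ofReal_mul (abs_nonneg k)]
      exact Hf.trans k
  · rcases eq_or_ne i 0 with rfl | hi0
    · simp only [pow_zero, one_mul]
      have := tot (k := 1) (dg := eLpNorm g 2 volume) (df := eLpNorm f 2 volume)
        zero_le_one (by rw [one_mul]; exact Hg.l2) (by rw [one_mul]; exact Hf.l2)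
      rw [ENNReal.ofReal_one, one_mul] at this
      exact lip0.trans this
    · have tail : ∀ t, 0 < t → ∫⁻ ξ in {ξ | t < |ξ| / 6}, ‖remFun g g f s ξ‖ₑ ^ 2 ≤
          4 * (ENNReal.ofReal c₁ ^ 2 * (∫⁻ ξ in {ξ | t < max |ξ| 1}, ‖g ξ‖ₑ ^ 2) +
            ENNReal.ofReal c₂ ^ 2 * ∫⁻ ξ in {ξ | t < max |ξ| 1}, ‖f ξ‖ₑ ^ 2) := by
        intro t ht
        have comb : ∀ {x a b a' b' : ℝ≥0∞}, x ≤ ENNReal.ofReal c₁ * a + ENNReal.ofReal c₂ * b →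
            a ^ 2 ≤ a' → b ^ 2 ≤ b' →
            x ^ 2 ≤ 4 * (ENNReal.ofReal c₁ ^ 2 * a' + ENNReal.ofReal c₂ ^ 2 * b') := by
          intro x a b a' b' h1 h2 h3
          refine (pow_le_pow_left' h1 2).trans ((ennreal_add_sq_le _ _).trans ?_)
          rw [mul_pow, mul_pow]
          exact mul_le_mul_right (add_le_add (mul_le_mul_right h2 _) (mul_le_mul_right h3 _)) _
        -- For `t < 1` the cutoff would be too steep, but then `t < max |ξ| 1` holds everywhere and
        -- the unweighted bound suffices.
        rcases lt_or_ge t 1 with h1 | h1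
        · have : {ξ : ℝ | t < max |ξ| 1} = univ :=
            eq_univ_of_forall fun ξ => lt_max_of_lt_right h1
          rw [this, setLIntegral_univ, setLIntegral_univ]
          refine (setLIntegral_le_lintegral _ _).trans ?_
          rw [← eLpNorm_two_sq]
          exact comb lip0 (eLpNorm_two_sq _ _).le (eLpNorm_two_sq _ _).le
        · have : {ξ : ℝ | t < max |ξ| 1} = {ξ | t < |ξ|} := by
            ext ξ
            simp [not_lt.2 h1]
          rw [this]
          -- Beyond `6t` the remainder of the cut-off factors vanishes, so there the remainder
          -- equals the difference, which the tails of `g` and `f` beyond `t` control.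
          have e := lip _ _ (Hg.cutoff h1) (Hf.cutoff h1)
          refine le_trans ?_ (comb e (eLpNorm_sub_cutoff_le ht) (eLpNorm_sub_cutoff_le ht))
          rw [eLpNorm_two_sq]
          refine le_trans (le_of_eq ?_) (setLIntegral_le_lintegral {ξ | t < |ξ| / 6} _)
          refine setLIntegral_congr_fun (measurableSet_lt measurable_const (by fun_prop))
            fun ξ hξ => ?_
          have h6' : 6 * t < |ξ| := by
            have : t < |ξ| / 6 := hξ
            linarith
          rw [remFun_cutoff_eq_zero g f ht h6', sub_zero]
      refine (eLpNorm_pow_mul_le_of_tail_le mR mg mf c₁0 c₂0 hNg hNf tail hi0 Hg.l2 Hf.l2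
        (wg i hi) (wf i hi)).trans (ENNReal.ofReal_le_ofReal ?_)
      have hp : (6 : ℝ) ^ i ≤ 6 ^ m := pow_le_pow_right₀ (by norm_num) hi
      calc _ ≤ 6 ^ m * (24 * C * remSize θ s Lg Ng Lf Nf) := by gcongr
        _ = _ := by ring

end

/-! ### Measurability, phases, and the profiles of functions in `X_T` -/

section

/-! ### Integrals in time -/

theorem lintegral_Ioc_rpow {r t : ℝ} (hr : r ≠ 0) (ht : 1 ≤ t) :
    ∫⁻ s in Ioc 1 t, ENNReal.ofReal (s ^ (r - 1)) = ENNReal.ofReal ((t ^ r - 1) / r) := by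
  have h0 : (0 : ℝ) ∉ uIcc 1 t := by
    rw [uIcc_of_le ht]
    exact fun h => absurd h.1 (by norm_num)
  have hi : IntervalIntegrable (fun s : ℝ => s ^ (r - 1)) volume 1 t :=
    intervalIntegral.intervalIntegrable_rpow (Or.inr h0)
  have e := integral_rpow (a := 1) (b := t) (r := r - 1)
    (Or.inr ⟨fun h => hr (by linarith), h0⟩)
  rw [sub_add_cancel, Real.one_rpow, intervalIntegral.integral_of_le ht] at e
  rw [← e, ofReal_integral_eq_lintegral_ofReal ((intervalIntegrable_iff_integrableOn_Ioc_of_le ht).1 hi)]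
  filter_upwards [ae_restrict_mem measurableSet_Ioc] with s hs
  have : 0 < s := one_pos.trans hs.1
  exact (Real.rpow_pos_of_pos this _).le

theorem measurable_intervalIntegral {E : Type*} [NormedAddCommGroup E] [NormedSpace ℝ E]
    [MeasurableSpace E] [BorelSpace E] [SecondCountableTopology E] {F : ℝ → ℝ → E}
    (hF : Measurable (Function.uncurry F)) :
    Measurable fun p : ℝ × ℝ => ∫ s in (1 : ℝ)..p.1, F s p.2 := by
  have key : ∀ S : Set (ℝ × ℝ), MeasurableSet S →
      Measurable fun p : ℝ × ℝ => ∫ s in {s | (p.1, s) ∈ S}, F s p.2 := by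
    intro S hS
    have m : StronglyMeasurable (Function.uncurry fun (p : ℝ × ℝ) (s : ℝ) =>
        {q : (ℝ × ℝ) × ℝ | (q.1.1, q.2) ∈ S}.indicator (fun q => F q.2 q.1.2) (p, s)) := by
      refine Measurable.stronglyMeasurable ?_
      refine Measurable.indicator (hF.comp (measurable_snd.prodMk measurable_fst.snd)) ?_
      exact (measurable_fst.fst.prodMk measurable_snd) hS
    have e : (fun p : ℝ × ℝ => ∫ s in {s | (p.1, s) ∈ S}, F s p.2) = fun p => ∫ s,
        {q : (ℝ × ℝ) × ℝ | (q.1.1, q.2) ∈ S}.indicator (fun q => F q.2 q.1.2) (p, s) := by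
      funext p
      have hp : MeasurableSet {s | (p.1, s) ∈ S} := measurable_prodMk_left hS
      rw [← integral_indicator hp]
      rfl
    rw [e]
    exact (m.integral_prod_right (ν := volume)).measurable
  have h1 := key {q | 1 < q.2 ∧ q.2 ≤ q.1}
    ((measurableSet_lt measurable_const measurable_snd).inter
      (measurableSet_le measurable_snd measurable_fst))
  have h2 := key {q | q.1 < q.2 ∧ q.2 ≤ 1}
    ((measurableSet_lt measurable_fst measurable_snd).inter
      (measurableSet_le measurable_snd measurable_const))
  exact h1.sub h2

theorem measurable_phase {h : ℝ → ℝ → ℂ} (hh : Measurable (Function.uncurry h)) :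
    Measurable (Function.uncurry (phase h)) := by
  have m : Measurable (Function.uncurry fun (s ξ : ℝ) => 1 / s * ‖h s ξ‖ ^ 2) :=
    (measurable_const.div measurable_fst).mul (hh.norm.pow_const 2)
  have := measurable_intervalIntegral m
  exact Complex.measurable_exp.comp (measurable_const.mul
    (Complex.measurable_ofReal.comp (measurable_const.mul this)))

theorem measurable_profile {w v : ℝ → ℝ → ℂ} (hw : Measurable (Function.uncurry w))
    (hv : Measurable (Function.uncurry v)) : Measurable (Function.uncurry (profile w v)) :=
  hw.mul (Complex.continuous_conj.measurable.comp (measurable_phase hv))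

theorem measurable_remainder {h₁ h₂ h₃ : ℝ → ℝ → ℂ} (m₁ : Measurable (Function.uncurry h₁))
    (m₂ : Measurable (Function.uncurry h₂)) (m₃ : Measurable (Function.uncurry h₃)) :
    Measurable (Function.uncurry (remainder h₁ h₂ h₃)) := by
  have mt : Measurable fun r : ((ℝ × ℝ) × ℝ × ℝ) × ℝ × ℝ => triple h₁ h₂ h₃ r.1.1.1 r.1.1.2 r.2 := by
    have a₁ : Measurable fun r : ((ℝ × ℝ) × ℝ × ℝ) × ℝ × ℝ => (r.1.1.1, r.1.1.2 - r.2.2) := by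
      fun_prop
    have a₂ : Measurable fun r : ((ℝ × ℝ) × ℝ × ℝ) × ℝ × ℝ =>
        (r.1.1.1, r.1.1.2 - r.2.1 - r.2.2) := by fun_prop
    have a₃ : Measurable fun r : ((ℝ × ℝ) × ℝ × ℝ) × ℝ × ℝ => (r.1.1.1, r.1.1.2 - r.2.1) := by
      fun_prop
    exact ((m₁.comp a₁).mul (Complex.continuous_conj.measurable.comp (m₂.comp a₂))).mul
      (m₃.comp a₃)
  have me : Measurable fun r : ((ℝ × ℝ) × ℝ × ℝ) × ℝ × ℝ =>
      Complex.exp (Complex.I * ((r.1.2.1 * r.2.1 + r.1.2.2 * r.2.2 : ℝ) : ℂ)) := by fun_prop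
  have mi := (me.mul mt).stronglyMeasurable.integral_prod_right' (ν := volume)
  have mc : Measurable fun r : (ℝ × ℝ) × ℝ × ℝ =>
      Complex.exp (-Complex.I * ((r.2.1 * r.2.2 / (2 * r.1.1) : ℝ) : ℂ)) - 1 := by fun_prop
  have mr : Measurable fun r : (ℝ × ℝ) × ℝ × ℝ =>
      remainderIntegrand h₁ h₂ h₃ r.1.1 r.1.2 r.2 :=
    mc.mul (measurable_const.mul mi.measurable)
  have mo := mr.stronglyMeasurable.integral_prod_right' (ν := volume)
  have mp : Measurable fun r : ℝ × ℝ => -(Complex.I / ((4 * Real.pi * r.1 : ℝ) : ℂ)) := by fun_prop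
  exact mp.mul mo.measurable

theorem measurable_duhamelIntegrand {w v : ℝ → ℝ → ℂ} (hw : Measurable (Function.uncurry w))
    (hv : Measurable (Function.uncurry v)) :
    Measurable (Function.uncurry (duhamelIntegrand w v)) :=
  (measurable_phase (measurable_profile hv hw)).mul
    (measurable_remainder (measurable_profile hv hw) (measurable_profile hv hw)
      (measurable_profile hw hv))

theorem measurable_duhamel {w v : ℝ → ℝ → ℂ} (hw : Measurable (Function.uncurry w))
    (hv : Measurable (Function.uncurry v)) :
    Measurable (Function.uncurry (duhamel w v)) := by
  have m1 : Measurable fun p : ℝ × ℝ => w 1 p.2 := hw.comp (measurable_const.prodMk measurable_snd)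
  exact m1.add (measurable_intervalIntegral (measurable_duhamelIntegrand hw hv))

/-! ### Products and integrals of functions with translation bounds -/

/-- A function that is square integrable with the weight `1 + |x|` is integrable. -/
theorem integrable_of_weight {f : ℝ → ℂ} (hf : AEStronglyMeasurable f volume)
    (h0 : eLpNorm f 2 volume < ⊤)
    (h1 : eLpNorm (fun x : ℝ => (x : ℂ) ^ 1 * f x) 2 volume < ⊤) : Integrable f := by
  have ne : ∀ x : ℝ, (x : ℂ) + Complex.I ≠ 0 := fun x h => by
    simpa using congrArg Complex.im h
  have m : MemLp (fun x : ℝ => ((x : ℂ) + Complex.I)⁻¹) 2 volume := by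
    rw [memLp_two_iff_integrable_sq_norm (Measurable.aestronglyMeasurable (by fun_prop))]
    refine integrable_inv_one_add_sq.congr (.of_forall fun x => ?_)
    simp only
    rw [norm_inv, inv_pow, ← Complex.normSq_eq_norm_sq, Complex.normSq_apply]
    simp only [Complex.add_re, Complex.ofReal_re, Complex.I_re, Complex.add_im, Complex.ofReal_im,
      Complex.I_im]
    congr 1
    ring
  have mx : MemLp (fun x : ℝ => (x : ℂ) ^ 1 * f x) 2 volume :=
    ⟨(Measurable.aestronglyMeasurable (by fun_prop)).mul hf, h1⟩
  have m2 : MemLp (fun x : ℝ => (x : ℂ) ^ 1 * f x + Complex.I * f x) 2 volume :=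
    mx.add (MemLp.const_mul ⟨hf, h0⟩ Complex.I)
  refine (m.integrable_mul m2).congr (.of_forall fun x => ?_)
  simp only [Pi.mul_apply]
  rw [pow_one, ← add_mul, ← mul_assoc, inv_mul_cancel₀ (ne x), one_mul]

/-- Product rule for differences: the modulus of `b` is one where `h` is differenced, and `h` is at
most `L` where `b` is. -/
theorem TransBd.mul {h b : ℝ → ℂ} {L : ℝ} {D E : ℝ≥0∞} (hm : AEStronglyMeasurable h volume)
    (bm : AEStronglyMeasurable b volume) (hL : ∀ᵐ x, ‖h x‖ ≤ L)
    (b1 : ∀ x, ‖b x‖ = 1) (H : TransBd h D) (B : TransBd b E) :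
    TransBd (fun x => h x * b x) (D + ENNReal.ofReal L * E) := by
  intro k
  have q := (measurePreserving_add_right volume k).quasiMeasurePreserving
  have hm' := hm.comp_quasiMeasurePreserving q
  have bm' := bm.comp_quasiMeasurePreserving q
  have e : (fun x => h (x + k) * b (x + k) - h x * b x) =
      (fun x => (h (x + k) - h x) * b (x + k)) + fun x => h x * (b (x + k) - b x) := by
    funext x
    simp only [Pi.add_apply]
    ring
  rw [e, mul_add]
  refine (eLpNorm_add_le ((hm'.sub hm).mul bm') (hm.mul (bm'.sub bm)) one_le_two).trans
    (add_le_add ?_ ?_)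
  · refine le_trans (le_of_eq (eLpNorm_congr_norm_ae (.of_forall fun x => ?_))) (H k)
    simp [b1]
  · rw [mul_left_comm]
    refine le_trans ?_ (mul_le_mul_right (B k) _)
    refine eLpNorm_le_mul_eLpNorm_of_ae_le_mul ?_ 2
    filter_upwards [hL] with x hx
    change ‖h x * (b (x + k) - b x)‖ ≤ _
    rw [norm_mul]
    exact mul_le_mul_of_nonneg_right hx (norm_nonneg _)

theorem TransBd.add {h k : ℝ → ℂ} {D E : ℝ≥0∞} (hm : AEStronglyMeasurable h volume)
    (km : AEStronglyMeasurable k volume) (H : TransBd h D) (K : TransBd k E) :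
    TransBd (fun x => h x + k x) (D + E) := by
  have K' : TransBd (fun x => -k x) E := fun r => by
    refine le_trans (le_of_eq (eLpNorm_congr_norm_ae (.of_forall fun x => ?_))) (K r)
    rw [← norm_neg]
    congr 1
    ring
  simpa only [Pi.neg_apply, sub_neg_eq_add] using H.sub hm km.neg K'

/-! ### Quantitative membership in `X_T` -/

/-- `w` is measurable, and each part of the norm of `X_T`, with the weights up to `m`, is at
most `X`. -/
structure XBound (m : ℕ) (α T : ℝ) (w : ℝ → ℝ → ℂ) (X : ℝ) : Prop where
  meas : Measurable (Function.uncurry w)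
  nonneg : 0 ≤ X
  linf : ∀ t ∈ Icc 1 T, normLinf (w t) ≤ ENNReal.ofReal X
  trans : ∀ t ∈ Icc 1 T, TransBd (w t) (ENNReal.ofReal (t ^ α * X))
  weight : ∀ t ∈ Icc 1 T, ∀ i ≤ m,
    eLpNorm (fun x : ℝ => (x : ℂ) ^ i * w t x) 2 volume ≤ ENNReal.ofReal (t ^ α * X)

namespace XBound

variable {m : ℕ} {α T X : ℝ} {w : ℝ → ℝ → ℂ}

theorem meas_at (H : XBound m α T w X) (t : ℝ) : Measurable (w t) :=
  H.meas.comp measurable_prodMk_left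

theorem ae_le (H : XBound m α T w X) {t : ℝ} (ht : t ∈ Icc 1 T) :
    ∀ᵐ ξ, ‖w t ξ‖ₑ ≤ ENNReal.ofReal X := by
  have := ae_le_eLpNormEssSup (f := w t) (μ := volume)
  filter_upwards [this] with ξ hξ
  refine hξ.trans ?_
  have h := H.linf t ht
  rwa [normLinf, eLpNorm_exponent_top] at h

theorem ae_norm_le (H : XBound m α T w X) {t : ℝ} (ht : t ∈ Icc 1 T) :
    ∀ᵐ ξ, ‖w t ξ‖ ≤ X := by
  filter_upwards [H.ae_le ht] with ξ hξ
  rwa [← ofReal_norm, ENNReal.ofReal_le_ofReal_iff H.nonneg] at hξ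

/-- The exceptional null set of `ξ` depends on `t`. Joint measurability allows the two
almost-everywhere quantifiers to be exchanged, which makes the phase integrals converge for almost
every `ξ`. -/
theorem ae_ae_norm_le (H : XBound m α T w X) :
    ∀ᵐ ξ, ∀ᵐ t ∂volume.restrict (Icc 1 T), ‖w t ξ‖ ≤ X := by
  have ms : MeasurableSet {p : ℝ × ℝ | ‖w p.1 p.2‖ ≤ X} :=
    measurableSet_le H.meas.norm measurable_const
  rw [← Measure.ae_ae_comm ms]
  filter_upwards [ae_restrict_mem measurableSet_Icc] with t ht
  exact H.ae_norm_le ht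

theorem ae_integrableOn (H : XBound m α T w X) :
    ∀ᵐ ξ, IntegrableOn (fun s => 1 / s * ‖w s ξ‖ ^ 2) (Icc 1 T) := by
  filter_upwards [H.ae_ae_norm_le] with ξ hξ
  have mw : Measurable fun s => w s ξ := H.meas.comp measurable_prodMk_right
  refine Measure.integrableOn_of_bounded (M := X ^ 2) measure_Icc_lt_top.ne
    (Measurable.aestronglyMeasurable (by fun_prop)) ?_
  filter_upwards [hξ, ae_restrict_mem measurableSet_Icc] with s hs h1
  have : (0 : ℝ) < s := one_pos.trans_le h1.1
  rw [Real.norm_of_nonneg (by positivity)]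
  have h2 : 1 / s ≤ 1 := by rw [div_le_one this]; exact h1.1
  have h3 : ‖w s ξ‖ ^ 2 ≤ X ^ 2 := pow_le_pow_left₀ (norm_nonneg _) hs 2
  nlinarith [sq_nonneg ‖w s ξ‖]

theorem ae_intervalIntegrable (H : XBound m α T w X) (hT : 1 ≤ T) :
    ∀ᵐ ξ, IntervalIntegrable (fun s => 1 / s * ‖w s ξ‖ ^ 2) volume 1 T := by
  filter_upwards [H.ae_integrableOn] with ξ hξ
  rw [intervalIntegrable_iff_integrableOn_Icc_of_le hT]
  exact hξ

/-- The exponential is 1-Lipschitz on the imaginary axis, so the difference of phases is at most a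
time integral of differences of `|w|²/s`. Minkowski bounds its `L²` norm by the integral of `|k| X²
s^(α-1)`. -/
theorem transBd_phase (H : XBound m α T w X) (hα : 0 < α) {t : ℝ} (ht : t ∈ Icc 1 T) :
    TransBd (phase w t) (ENNReal.ofReal (α⁻¹ * (t ^ α * X ^ 2))) := by
  intro k
  set c : ℝ := 1 / (2 * Real.sqrt (2 * Real.pi)) with hc
  have c0 : 0 ≤ c := by positivity
  -- Absorbs the factor `2X` that bounds the sum of moduli in `|w|² - |w'|² = (|w| + |w'|)(|w| -
  -- |w'|)`.
  have c2 : 2 * c ≤ 1 := by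
    have : 1 ≤ Real.sqrt (2 * Real.pi) := by
      rw [Real.one_le_sqrt]
      linarith [Real.pi_gt_three]
    rw [hc, ← mul_div_assoc, div_le_one (by positivity)]
    linarith
  set F : ℝ → ℝ → ℝ := fun s ξ =>
    c * (1 / s * ‖w s (ξ + k)‖ ^ 2 - 1 / s * ‖w s ξ‖ ^ 2) with hF
  have mF : Measurable (Function.uncurry F) := by
    have m1 : Measurable fun p : ℝ × ℝ => ‖w p.1 (p.2 + k)‖ ^ 2 :=
      (H.meas.comp (measurable_fst.prodMk (measurable_snd.add_const k))).norm.pow_const 2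
    have m2 : Measurable fun p : ℝ × ℝ => ‖w p.1 p.2‖ ^ 2 := H.meas.norm.pow_const 2
    have m3 : Measurable fun p : ℝ × ℝ => 1 / p.1 := by fun_prop
    exact measurable_const.mul ((m3.mul m1).sub (m3.mul m2))
  have q := (measurePreserving_add_right volume k).quasiMeasurePreserving
  have sub : Ioc 1 t ⊆ Icc 1 T := fun s hs => ⟨hs.1.le, hs.2.trans ht.2⟩
  have pt : ∀ᵐ ξ, ‖phase w t (ξ + k) - phase w t ξ‖ ≤ ‖∫ s in Ioc 1 t, F s ξ‖ := by
    filter_upwards [H.ae_integrableOn, q.ae H.ae_integrableOn] with ξ h1 h2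
    have e : ∫ s in Ioc 1 t, F s ξ = c * (∫ s in (1 : ℝ)..t, 1 / s * ‖w s (ξ + k)‖ ^ 2) -
        c * ∫ s in (1 : ℝ)..t, 1 / s * ‖w s ξ‖ ^ 2 := by
      rw [intervalIntegral.integral_of_le ht.1, intervalIntegral.integral_of_le ht.1, ← mul_sub,
        ← integral_sub (h2.mono_set sub) (h1.mono_set sub), ← integral_const_mul]
    rw [e]
    simp only [phase, ← hc]
    set a := c * ∫ s in (1 : ℝ)..t, 1 / s * ‖w s (ξ + k)‖ ^ 2
    set b := c * ∫ s in (1 : ℝ)..t, 1 / s * ‖w s ξ‖ ^ 2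
    have e2 : Complex.exp (Complex.I * (a : ℂ)) - Complex.exp (Complex.I * (b : ℂ)) =
        Complex.exp (Complex.I * (b : ℂ)) * (Complex.exp (Complex.I * ((a - b : ℝ) : ℂ)) - 1) := by
      rw [mul_sub, ← Complex.exp_add, mul_one]
      congr 2
      push_cast
      ring
    rw [e2, norm_mul, Complex.norm_exp_I_mul_ofReal, one_mul]
    exact Real.norm_exp_I_mul_ofReal_sub_one_le
  refine (eLpNorm_mono_ae pt).trans ((eLpNorm_integral_le mF.stronglyMeasurable).trans ?_)
  have bd : ∀ s ∈ Ioc 1 t, eLpNorm (F s) 2 volume ≤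
      ENNReal.ofReal (|k| * X ^ 2) * ENNReal.ofReal (s ^ (α - 1)) := by
    intro s hs
    have s0 : 0 < s := one_pos.trans hs.1
    have b1 : ∀ᵐ ξ, ‖F s ξ‖ ≤ s⁻¹ * X * ‖w s (ξ + k) - w s ξ‖ := by
      filter_upwards [H.ae_norm_le (sub hs), q.ae (H.ae_norm_le (sub hs))] with ξ h1 h2
      have X0 := H.nonneg
      have e : F s ξ = c * s⁻¹ * (‖w s (ξ + k)‖ + ‖w s ξ‖) * (‖w s (ξ + k)‖ - ‖w s ξ‖) := by
        rw [hF]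
        simp only
        ring
      rw [e, norm_mul, Real.norm_of_nonneg (by positivity), Real.norm_eq_abs]
      refine mul_le_mul ?_ (abs_norm_sub_norm_le _ _) (abs_nonneg _) (by positivity)
      calc _ ≤ c * s⁻¹ * (X + X) := by gcongr
        _ = 2 * c * (s⁻¹ * X) := by ring
        _ ≤ 1 * (s⁻¹ * X) := by gcongr
        _ = _ := one_mul _
    refine (eLpNorm_le_mul_eLpNorm_of_ae_le_mul b1 2).trans ?_
    refine (mul_le_mul_right (H.trans s (sub hs) k) _).trans_eq ?_
    have X0 := H.nonneg
    rw [← ENNReal.ofReal_mul (abs_nonneg k), ← ENNReal.ofReal_mul (by positivity),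
      ← ENNReal.ofReal_mul (by positivity), Real.rpow_sub_one s0.ne']
    congr 1
    ring
  refine (setLIntegral_mono' measurableSet_Ioc bd).trans ?_
  rw [lintegral_const_mul' _ _ ENNReal.ofReal_ne_top, lintegral_Ioc_rpow hα.ne' ht.1,
    ← ENNReal.ofReal_mul (by positivity), ← ENNReal.ofReal_mul (abs_nonneg k)]
  refine ENNReal.ofReal_le_ofReal ?_
  have : (t ^ α - 1) / α ≤ α⁻¹ * t ^ α := by
    rw [div_eq_inv_mul]
    exact mul_le_mul_of_nonneg_left (by linarith) (by positivity)
  calc _ ≤ |k| * X ^ 2 * (α⁻¹ * t ^ α) := by gcongr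
    _ = _ := by ring

theorem weight_zero (H : XBound m α T w X) {t : ℝ} (ht : t ∈ Icc 1 T) :
    eLpNorm (w t) 2 volume ≤ ENNReal.ofReal (t ^ α * X) := by
  simpa using H.weight t ht 0 (Nat.zero_le _)

theorem integrable (H : XBound m α T w X) (hm : 1 ≤ m) {t : ℝ} (ht : t ∈ Icc 1 T) :
    Integrable (w t) :=
  integrable_of_weight (H.meas_at t).aestronglyMeasurable
    ((H.weight_zero ht).trans_lt ENNReal.ofReal_lt_top)
    ((H.weight t ht 1 hm).trans_lt ENNReal.ofReal_lt_top)

variable {v : ℝ → ℝ → ℂ} {Y : ℝ}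

theorem eLpNorm_profile (w v : ℝ → ℝ → ℂ) (t : ℝ) (p : ℝ≥0∞) :
    eLpNorm (profile w v t) p volume = eLpNorm (w t) p volume :=
  eLpNorm_congr_norm_ae (.of_forall fun x => norm_profile w v t x)

theorem rpow_mul_le {t : ℝ} (hα : 0 < α) (hα1 : α ≤ 1) (ht : 1 ≤ t) (hX : 0 ≤ X) (Y : ℝ) :
    t ^ α * X ≤ α⁻¹ * t ^ α * (X * (1 + Y ^ 2)) := by
  have tα : 0 < t ^ α := Real.rpow_pos_of_pos (one_pos.trans_le ht) _
  have a1 : 1 ≤ α⁻¹ := (one_le_inv₀ hα).2 hα1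
  have h1 : t ^ α * X ≤ α⁻¹ * (t ^ α * X) := le_mul_of_one_le_left (by positivity) a1
  have h2 : 0 ≤ α⁻¹ * (t ^ α * X * Y ^ 2) := by positivity
  linarith [h1, h2, (by ring : α⁻¹ * t ^ α * (X * (1 + Y ^ 2)) =
    α⁻¹ * (t ^ α * X) + α⁻¹ * (t ^ α * X * Y ^ 2))]

theorem measurable_conj_phase (H : XBound m α T v Y) (t : ℝ) :
    Measurable fun ξ => conj (phase v t ξ) := by
  have m : Measurable fun ξ => Function.uncurry (phase v) (t, ξ) :=
    (measurable_phase H.meas).comp measurable_prodMk_left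
  have m' : Measurable fun ξ => phase v t ξ := m
  exact Complex.continuous_conj.measurable.comp m'

theorem norm_conj_phase (v : ℝ → ℝ → ℂ) (t ξ : ℝ) : ‖conj (phase v t ξ)‖ = 1 := by
  rw [RCLike.norm_conj, norm_phase]

theorem integrable_profile (H : XBound m α T w X) (H' : XBound m α T v Y) (hm : 1 ≤ m) {t : ℝ}
    (ht : t ∈ Icc 1 T) : Integrable (profile w v t) := by
  have := (H.integrable hm ht).mul_bdd (c := 1) (H'.measurable_conj_phase t).aestronglyMeasurable
    (.of_forall fun ξ => (norm_conj_phase v t ξ).le)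
  exact this

theorem transBd_profile (H : XBound m α T w X) (H' : XBound m α T v Y) (hα : 0 < α) (hα1 : α ≤ 1)
    {t : ℝ} (ht : t ∈ Icc 1 T) :
    TransBd (profile w v t) (ENNReal.ofReal (α⁻¹ * t ^ α * (X * (1 + Y ^ 2)))) := by
  have X0 := H.nonneg
  have tα : 0 < t ^ α := Real.rpow_pos_of_pos (one_pos.trans_le ht.1) _
  have a1 : 1 ≤ α⁻¹ := (one_le_inv₀ hα).2 hα1
  have Tb : TransBd (fun ξ => conj (phase v t ξ)) (ENNReal.ofReal (α⁻¹ * (t ^ α * Y ^ 2))) := by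
    intro k
    refine le_trans (le_of_eq (eLpNorm_congr_norm_ae (.of_forall fun x => ?_)))
      (H'.transBd_phase hα ht k)
    rw [← map_sub, RCLike.norm_conj]
  refine ((H.trans t ht).mul (H.meas_at t).aestronglyMeasurable
    (H'.measurable_conj_phase t).aestronglyMeasurable
    (H.ae_norm_le ht) (norm_conj_phase v t) Tb).mono ?_
  rw [← ENNReal.ofReal_mul X0, ← ENNReal.ofReal_add (by positivity) (by positivity)]
  refine ENNReal.ofReal_le_ofReal ?_
  have h1 : t ^ α * X ≤ α⁻¹ * (t ^ α * X) := le_mul_of_one_le_left (by positivity) a1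
  linarith [(by ring : α⁻¹ * t ^ α * (X * (1 + Y ^ 2)) =
    α⁻¹ * (t ^ α * X) + X * (α⁻¹ * (t ^ α * Y ^ 2)))]

/-- The profile has the bounds of `w`, up to the growth of the phase. -/
theorem profileBd (H : XBound m α T w X) (H' : XBound m α T v Y) (hα : 0 < α) (hα1 : α ≤ 1)
    (hm : 1 ≤ m) {t : ℝ} (ht : t ∈ Icc 1 T) :
    ProfileBd (profile w v t) X (α⁻¹ * t ^ α * (X * (1 + Y ^ 2))) where
  integrable := H.integrable_profile H' hm ht
  L_nonneg := H.nonneg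
  N_nonneg := le_trans (mul_nonneg (Real.rpow_nonneg (zero_le_one.trans ht.1) _) H.nonneg)
    (rpow_mul_le hα hα1 ht.1 H.nonneg Y)
  linf := (eLpNorm_profile w v t ⊤).trans_le (H.linf t ht)
  l2 := (eLpNorm_profile w v t 2).trans_le ((H.weight_zero ht).trans
    (ENNReal.ofReal_le_ofReal (rpow_mul_le hα hα1 ht.1 H.nonneg Y)))
  trans := H.transBd_profile H' hα hα1 ht

theorem weight_profile (H : XBound m α T w X) (hα : 0 < α) (hα1 : α ≤ 1) {t : ℝ}
    (ht : t ∈ Icc 1 T) {i : ℕ} (hi : i ≤ m) (Y : ℝ) :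
    eLpNorm (fun x : ℝ => (x : ℂ) ^ i * profile w v t x) 2 volume ≤
      ENNReal.ofReal (α⁻¹ * t ^ α * (X * (1 + Y ^ 2))) := by
  refine (le_of_eq (eLpNorm_congr_norm_ae (.of_forall fun x => ?_))).trans
    ((H.weight t ht i hi).trans (ENNReal.ofReal_le_ofReal
      (rpow_mul_le hα hα1 ht.1 H.nonneg Y)))
  rw [norm_mul, norm_mul, norm_profile]

end XBound

end

/-! ### Time decay and time integration of the Duhamel integrand -/

section

/-! ### The Duhamel integrand at a fixed time -/

/-- The polynomial factor in the estimate for the Duhamel map. -/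
def growth (X Y : ℝ) : ℝ := X * Y ^ 2 * (1 + X ^ 4) * (1 + Y ^ 4)

theorem growth_nonneg {X : ℝ} (hX : 0 ≤ X) (Y : ℝ) : 0 ≤ growth X Y := by
  rw [growth]
  positivity

/-- The left side is the product of the `H¹` sizes of the three profiles, without powers of `s` and
`α`. -/
theorem profile_product_le {X : ℝ} (hX : 0 ≤ X) (Y : ℝ) :
    (Y * (1 + X ^ 2)) ^ 2 * (X * (1 + Y ^ 2)) ≤ 4 * growth X Y := by
  have h1 : (1 + X ^ 2) ^ 2 ≤ 2 * (1 + X ^ 4) := by nlinarith [sq_nonneg (X ^ 2 - 1)]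
  have h2 : 1 + Y ^ 2 ≤ 2 * (1 + Y ^ 4) := by nlinarith [sq_nonneg (Y ^ 2 - 1)]
  calc _ = X * Y ^ 2 * ((1 + X ^ 2) ^ 2 * (1 + Y ^ 2)) := by ring
    _ ≤ X * Y ^ 2 * (2 * (1 + X ^ 4) * (2 * (1 + Y ^ 4))) := by gcongr
    _ = _ := by rw [growth]; ring

/-- The additional `Y ^ 2` comes from differencing the phase. There is room for it, since `1 + Y ^
2` falls two degrees short of `1 + Y ^ 4`. -/
theorem sq_mul_profile_product_le {X : ℝ} (hX : 0 ≤ X) (Y : ℝ) :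
    Y ^ 2 * ((Y * (1 + X ^ 2)) ^ 2 * (X * (1 + Y ^ 2))) ≤ 4 * growth X Y := by
  have h1 : (1 + X ^ 2) ^ 2 ≤ 2 * (1 + X ^ 4) := by nlinarith [sq_nonneg (X ^ 2 - 1)]
  have h2 : Y ^ 2 * (1 + Y ^ 2) ≤ 2 * (1 + Y ^ 4) := by nlinarith [sq_nonneg (Y ^ 2 - 1)]
  calc _ = X * Y ^ 2 * ((1 + X ^ 2) ^ 2 * (Y ^ 2 * (1 + Y ^ 2))) := by ring
    _ ≤ X * Y ^ 2 * (2 * (1 + X ^ 4) * (2 * (1 + Y ^ 4))) := by gcongr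
    _ = _ := by rw [growth]; ring

/-- As `α ≤ θ`, the decay `s^(-θ)` cancels the growth `s^α` in the factors taken in `L^∞`; one power
`s^α` remains, from the factor in `L²`. -/
theorem remSize_le {α θ s A X Y : ℝ} (hs : 1 ≤ s) (hαθ : α ≤ θ) (hA : 1 ≤ A) (hX : 0 ≤ X)
    (hY : 0 ≤ Y) :
    remSize θ s Y (A * s ^ α * (Y * (1 + X ^ 2))) X (A * s ^ α * (X * (1 + Y ^ 2))) ≤
      32 * A ^ 3 * growth X Y * s ^ (α - 1) := by
  have s0 : 0 < s := one_pos.trans_le hs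
  set G := Y * (1 + X ^ 2) with hG
  set F := X * (1 + Y ^ 2) with hF
  have hGF : G ^ 2 * F ≤ 4 * growth X Y := profile_product_le hX Y
  have G0 : 0 ≤ G := by positivity
  have F0 : 0 ≤ F := by positivity
  have YG : Y ≤ G := by rw [hG]; nlinarith [mul_nonneg hY (sq_nonneg X)]
  have XF : X ≤ F := by rw [hF]; nlinarith [mul_nonneg hX (sq_nonneg Y)]
  have p0 : 0 < s ^ α := Real.rpow_pos_of_pos s0 _
  have σ0 : 0 < s ^ (-θ) := Real.rpow_pos_of_pos s0 _
  have hσ : s ^ (-θ) * s ^ α ≤ 1 := by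
    rw [← Real.rpow_add s0]
    exact Real.rpow_le_one_of_one_le_of_nonpos hs (by linarith)
  have bound : ∀ L N : ℝ, 0 ≤ N → L ≤ N → L + s ^ (-θ) * (A * s ^ α * N) ≤ 2 * (A * N) := by
    intro L N hN hL
    have h1 : s ^ (-θ) * (A * s ^ α * N) ≤ A * N := by
      calc _ = s ^ (-θ) * s ^ α * (A * N) := by ring
        _ ≤ 1 * (A * N) := by gcongr
        _ = _ := one_mul _
    have h2 : N ≤ A * N := le_mul_of_one_le_left hN hA
    linarith
  have b1 := bound Y G G0 YG
  have b2 := bound X F F0 XF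
  rw [remSize, Real.rpow_sub_one s0.ne']
  calc _ ≤ s⁻¹ * (2 * (A * G) * (2 * (A * F)) * (A * s ^ α * G) +
        (2 * (A * G)) ^ 2 * (A * s ^ α * F)) := by gcongr
    _ = 8 * A ^ 3 * (G ^ 2 * F) * (s ^ α / s) := by ring
    _ ≤ 8 * A ^ 3 * (4 * growth X Y) * (s ^ α / s) := by gcongr
    _ = _ := by ring

theorem remainder_eq_remFun (h₁ h₂ h₃ : ℝ → ℝ → ℂ) (s ξ : ℝ) :
    remainder h₁ h₂ h₃ s ξ = remFun (h₁ s) (h₂ s) (h₃ s) s ξ := rfl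

theorem duhamelIntegrand_eq (w v : ℝ → ℝ → ℂ) (s : ℝ) : duhamelIntegrand w v s = fun ξ =>
    remFun (profile v w s) (profile v w s) (profile w v s) s ξ * phase v s ξ := by
  funext ξ
  rw [duhamelIntegrand, phase_profile, mul_comm, remainder_eq_remFun]

theorem enorm_duhamelIntegrand (w v : ℝ → ℝ → ℂ) (s ξ : ℝ) : ‖duhamelIntegrand w v s ξ‖ₑ =
    ‖remFun (profile v w s) (profile v w s) (profile w v s) s ξ‖ₑ := by
  rw [duhamelIntegrand_eq, ← ofReal_norm, norm_mul, norm_phase, mul_one, ofReal_norm]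

theorem rpow_mul_pow_three {α δ s : ℝ} (hs : 0 < s) :
    s ^ (-1 - (3 * α + δ)) * (s ^ α * s ^ α * s ^ α) = s ^ (-δ - 1) := by
  rw [← Real.rpow_add hs, ← Real.rpow_add hs, ← Real.rpow_add hs]
  congr 1
  ring

section

variable {m : ℕ} {α δ C T X Y s : ℝ} {w v : ℝ → ℝ → ℂ}

/-- The decay of the remainder in time, with room `δ` for integration. -/
theorem RemainderBd.enorm_profiles_le (HC : RemainderBd (3 * α + δ) C) (hm : 1 ≤ m) (hα : 0 < α)
    (hα1 : α ≤ 1) (Hw : XBound m α T w X) (Hv : XBound m α T v Y) (hs : s ∈ Icc 1 T) (ξ : ℝ) :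
    ‖remFun (profile v w s) (profile v w s) (profile w v s) s ξ‖ₑ ≤ ENNReal.ofReal
      (C * α⁻¹ ^ 3 * ((Y * (1 + X ^ 2)) ^ 2 * (X * (1 + Y ^ 2))) * s ^ (-δ - 1)) := by
  have Pv := Hv.profileBd Hw hα hα1 hm hs
  have Pw := Hw.profileBd Hv hα hα1 hm hs
  obtain ⟨HP, -⟩ := HC _ _ _ _ _ _ _ _ _ s (one_pos.trans_le hs.1) Pv Pv Pw
  refine (HP ξ).trans_eq (congrArg _ ?_)
  rw [← rpow_mul_pow_three (α := α) (δ := δ) (one_pos.trans_le hs.1)]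
  ring

theorem measurable_profile_at (Hw : XBound m α T w X) (Hv : XBound m α T v Y) (s : ℝ) :
    Measurable (profile w v s) := by
  have m : Measurable fun ξ => Function.uncurry (profile w v) (s, ξ) :=
    (measurable_profile Hw.meas Hv.meas).comp measurable_prodMk_left
  exact m

theorem measurable_phase_at (Hv : XBound m α T v Y) (s : ℝ) : Measurable (phase v s) := by
  have m : Measurable fun ξ => Function.uncurry (phase v) (s, ξ) :=
    (measurable_phase Hv.meas).comp measurable_prodMk_left
  exact m

theorem decay_le (hα : 0 < α) (hα1 : α ≤ 1) (hC : 0 ≤ C) {K₁ : ℝ} (hK : 0 ≤ K₁) (hs : 0 < s)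
    (hX : 0 ≤ X) (Y : ℝ) :
    C * α⁻¹ ^ 3 * ((Y * (1 + X ^ 2)) ^ 2 * (X * (1 + Y ^ 2))) * s ^ (-δ - 1) ≤
      (K₁ * (32 * α⁻¹ ^ 3) + 4 * C * α⁻¹ ^ 4) * growth X Y * s ^ (-δ - 1) := by
  have A1 : 1 ≤ α⁻¹ := (one_le_inv₀ hα).2 hα1
  generalize α⁻¹ = A at *
  have A0 : 0 < A := one_pos.trans_le A1
  have Q0 := growth_nonneg hX Y
  have P1 := profile_product_le hX Y
  refine mul_le_mul_of_nonneg_right ?_ (Real.rpow_nonneg hs.le _)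
  have h34 : A ^ 3 ≤ A ^ 4 := pow_le_pow_right₀ A1 (by norm_num)
  have h0 : 0 ≤ K₁ * (32 * A ^ 3) * growth X Y := by positivity
  have h1 : C * A ^ 3 * ((Y * (1 + X ^ 2)) ^ 2 * (X * (1 + Y ^ 2))) ≤
      C * A ^ 4 * (4 * growth X Y) := by gcongr
  linarith

/-- The second summand is the sup bound of the remainder times the translation bound of the phase.
Its power `s^(α-1-δ)` is dominated by `s^(α-1)`. -/
theorem transBd_le (hα : 0 < α) (hC : 0 ≤ C) {K₁ r : ℝ} (hs : 1 ≤ s) (hδ : 0 ≤ δ)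
    (hX : 0 ≤ X) (Y : ℝ) (hr : K₁ * r ≤ K₁ * (32 * α⁻¹ ^ 3) * growth X Y * s ^ (α - 1)) :
    K₁ * r + C * α⁻¹ ^ 3 * ((Y * (1 + X ^ 2)) ^ 2 * (X * (1 + Y ^ 2))) * s ^ (-δ - 1) *
      (α⁻¹ * (s ^ α * Y ^ 2)) ≤
      (K₁ * (32 * α⁻¹ ^ 3) + 4 * C * α⁻¹ ^ 4) * growth X Y * s ^ (α - 1) := by
  have s0 : 0 < s := one_pos.trans_le hs
  have A0 : 0 < α⁻¹ := inv_pos.2 hα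
  generalize α⁻¹ = A at *
  have Q0 := growth_nonneg hX Y
  have P2 := sq_mul_profile_product_le hX Y
  have h2 : s ^ (-δ - 1) * s ^ α ≤ s ^ (α - 1) := by
    rw [← Real.rpow_add s0]
    exact Real.rpow_le_rpow_of_exponent_le hs (by linarith)
  have p1 : 0 ≤ s ^ (-δ - 1) * s ^ α :=
    mul_nonneg (Real.rpow_nonneg s0.le _) (Real.rpow_nonneg s0.le _)
  generalize hP : (Y * (1 + X ^ 2)) ^ 2 * (X * (1 + Y ^ 2)) = P at *
  have h3 : C * A ^ 4 * (Y ^ 2 * P) * (s ^ (-δ - 1) * s ^ α) ≤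
      C * A ^ 4 * (4 * growth X Y) * s ^ (α - 1) := by gcongr
  linarith [(by ring : C * A ^ 3 * P * s ^ (-δ - 1) * (A * (s ^ α * Y ^ 2)) =
    C * A ^ 4 * (Y ^ 2 * P) * (s ^ (-δ - 1) * s ^ α))]

end

theorem exists_duhamelIntegrand_bounds {m : ℕ} {α : ℝ} (hm : 1 ≤ m) (hα : 0 < α)
    (hα' : α < 1 / 12) : ∃ K, 0 < K ∧ ∀ (T X Y : ℝ) (w v : ℝ → ℝ → ℂ),
      XBound m α T w X → XBound m α T v Y → ∀ s ∈ Icc 1 T,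
      (∀ ξ, ‖duhamelIntegrand w v s ξ‖ₑ ≤
        ENNReal.ofReal (K * growth X Y * s ^ (-((1 / 4 - 3 * α) / 2) - 1))) ∧
      TransBd (duhamelIntegrand w v s) (ENNReal.ofReal (K * growth X Y * s ^ (α - 1))) ∧
      ∀ i ≤ m, eLpNorm (fun x : ℝ => (x : ℂ) ^ i * duhamelIntegrand w v s x) 2 volume ≤
        ENNReal.ofReal (K * growth X Y * s ^ (α - 1)) := by
  -- `3α + δ` is the midpoint of `3α` and `1/4`: large enough to beat the growth `s^(3α)` of three
  -- profiles with `s^(-δ)` to spare, and below the threshold `1/4`. This is where `α < 1/12` is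
  -- decisive.
  obtain ⟨δ, hδ⟩ : ∃ δ, δ = (1 / 4 - 3 * α) / 2 := ⟨_, rfl⟩
  rw [← hδ]
  have δ0 : 0 < δ := by linarith
  obtain ⟨C, C0, HC⟩ := exists_remainderBd (θ := 3 * α + δ) (by positivity) (by linarith)
  obtain ⟨K₁, K₁0, HK⟩ := HC.exists_bounds C0 m
  have hα1 : α ≤ 1 := by linarith
  have A1 : 1 ≤ α⁻¹ := (one_le_inv₀ hα).2 hα1
  refine ⟨K₁ * (32 * α⁻¹ ^ 3) + 4 * C * α⁻¹ ^ 4, by positivity, ?_⟩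
  intro T X Y w v Hw Hv s hs
  have X0 := Hw.nonneg
  have s0 : 0 < s := one_pos.trans_le hs.1
  have Pv := Hv.profileBd Hw hα hα1 hm hs
  have Pw := Hw.profileBd Hv hα hα1 hm hs
  have hsize := remSize_le (α := α) (θ := 3 * α + δ) hs.1 (by linarith) A1 X0 Hv.nonneg
  obtain ⟨HT, HW⟩ := HK _ _ _ _ _ _ s s0 (measurable_profile_at Hv Hw s)
    (measurable_profile_at Hw Hv s) Pv Pw
    (fun i hi => Hv.weight_profile hα hα1 hs hi X) (fun i hi => Hw.weight_profile hα hα1 hs hi Y)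
  have r0 : 0 ≤ remSize (3 * α + δ) s Y (α⁻¹ * s ^ α * (Y * (1 + X ^ 2))) X
      (α⁻¹ * s ^ α * (X * (1 + Y ^ 2))) := by
    have a1 := Pv.N_nonneg
    have a2 := Pw.N_nonneg
    have a3 := Hv.nonneg
    rw [remSize]
    positivity
  generalize remSize (3 * α + δ) s Y (α⁻¹ * s ^ α * (Y * (1 + X ^ 2))) X
    (α⁻¹ * s ^ α * (X * (1 + Y ^ 2))) = r at *
  have hr : K₁ * r ≤ K₁ * (32 * α⁻¹ ^ 3) * growth X Y * s ^ (α - 1) := by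
    refine (mul_le_mul_of_nonneg_left hsize K₁0.le).trans_eq ?_
    ring
  have HP := HC.enorm_profiles_le hm hα hα1 Hw Hv hs
  have L0 : 0 ≤ C * α⁻¹ ^ 3 * ((Y * (1 + X ^ 2)) ^ 2 * (X * (1 + Y ^ 2))) * s ^ (-δ - 1) := by
    positivity
  have E0 : 0 ≤ α⁻¹ * (s ^ α * Y ^ 2) := by positivity
  have hsum := transBd_le hα C0.le hs.1 δ0.le X0 Y hr
  refine ⟨fun ξ => ?_, ?_, fun i hi => ?_⟩
  · rw [enorm_duhamelIntegrand]
    exact (HP ξ).trans (ENNReal.ofReal_le_ofReal (decay_le hα hα1 C0.le K₁0.le s0 X0 Y))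
  · have bR : ∀ ξ, ‖remFun (profile v w s) (profile v w s) (profile w v s) s ξ‖ ≤
        C * α⁻¹ ^ 3 * ((Y * (1 + X ^ 2)) ^ 2 * (X * (1 + Y ^ 2))) * s ^ (-δ - 1) := fun ξ => by
      have := HP ξ
      rwa [← ofReal_norm, ENNReal.ofReal_le_ofReal_iff L0] at this
    rw [duhamelIntegrand_eq]
    refine (TransBd.mul (continuous_remFun Pv Pv Pw s).aestronglyMeasurable
      (measurable_phase_at Hv s).aestronglyMeasurable (.of_forall bR)
      (norm_phase v s) HT (Hv.transBd_phase hα hs)).mono ?_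
    rw [← ENNReal.ofReal_mul L0,
      ← ENNReal.ofReal_add (mul_nonneg K₁0.le r0) (mul_nonneg L0 E0)]
    exact ENNReal.ofReal_le_ofReal hsum
  · refine (le_of_eq (eLpNorm_congr_enorm_ae (.of_forall fun x => ?_))).trans ((HW i hi).trans
      (ENNReal.ofReal_le_ofReal (le_trans (le_add_of_nonneg_right (mul_nonneg L0 E0)) hsum)))
    rw [enorm_mul, enorm_mul, enorm_duhamelIntegrand]

/-! ### The Duhamel integral -/

theorem eLpNorm_intervalIntegral_le {F : ℝ → ℝ → ℂ} (hF : Measurable (Function.uncurry F))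
    {α c t : ℝ} (hα : 0 < α) (hc : 0 ≤ c) (ht : 1 ≤ t)
    (h : ∀ s ∈ Icc 1 t, eLpNorm (F s) 2 volume ≤ ENNReal.ofReal (c * s ^ (α - 1))) :
    eLpNorm (fun ξ => ∫ s in (1 : ℝ)..t, F s ξ) 2 volume ≤ ENNReal.ofReal (c * (α⁻¹ * t ^ α)) := by
  simp only [intervalIntegral.integral_of_le ht]
  refine (eLpNorm_integral_le hF.stronglyMeasurable).trans ?_
  refine (setLIntegral_mono' measurableSet_Ioc fun s hs => h s ⟨hs.1.le, hs.2⟩).trans ?_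
  simp only [ENNReal.ofReal_mul hc]
  rw [lintegral_const_mul' _ _ ENNReal.ofReal_ne_top, lintegral_Ioc_rpow hα.ne' ht]
  refine mul_le_mul_right (ENNReal.ofReal_le_ofReal ?_) _
  rw [div_eq_inv_mul]
  exact mul_le_mul_of_nonneg_left (by linarith) (by positivity)

theorem lintegral_Ioc_rpow_neg_le {δ t : ℝ} (hδ : 0 < δ) (ht : 1 ≤ t) :
    ∫⁻ s in Ioc 1 t, ENNReal.ofReal (s ^ (-δ - 1)) ≤ ENNReal.ofReal δ⁻¹ := by
  rw [lintegral_Ioc_rpow (neg_ne_zero.2 hδ.ne') ht]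
  refine ENNReal.ofReal_le_ofReal ?_
  have : 0 ≤ t ^ (-δ) := Real.rpow_nonneg (zero_le_one.trans ht) _
  rw [div_neg, neg_div', inv_eq_one_div]
  gcongr
  linarith

/-- The sup norm integrates `s^(-δ-1)`, with total at most `1/δ` uniformly in time. The `L²`
quantities integrate `s^(α-1)` by Minkowski, which yields the growth `t^α/α` that `X_T` permits. -/
theorem exists_duhamel_integral_bounds {m : ℕ} {α : ℝ} (hm : 1 ≤ m) (hα : 0 < α)
    (hα' : α < 1 / 12) : ∃ K, 0 < K ∧ ∀ (T X Y : ℝ) (w v : ℝ → ℝ → ℂ), 1 ≤ T →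
      XBound m α T w X → XBound m α T v Y →
      (∀ ξ, IntervalIntegrable (fun s => duhamelIntegrand w v s ξ) volume 1 T) ∧
      ∀ t ∈ Icc 1 T,
      (∀ ξ, ‖∫ s in (1 : ℝ)..t, duhamelIntegrand w v s ξ‖ₑ ≤ ENNReal.ofReal (K * growth X Y)) ∧
      TransBd (fun ξ => ∫ s in (1 : ℝ)..t, duhamelIntegrand w v s ξ)
        (ENNReal.ofReal (K * growth X Y * t ^ α)) ∧
      ∀ i ≤ m, eLpNorm (fun x : ℝ => (x : ℂ) ^ i * ∫ s in (1 : ℝ)..t, duhamelIntegrand w v s x) 2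
        volume ≤ ENNReal.ofReal (K * growth X Y * t ^ α) := by
  obtain ⟨K, K0, HK⟩ := exists_duhamelIntegrand_bounds hm hα hα'
  set δ : ℝ := (1 / 4 - 3 * α) / 2 with hδ
  have δ0 : 0 < δ := by rw [hδ]; linarith
  refine ⟨K * (δ⁻¹ + α⁻¹), by positivity, ?_⟩
  intro T X Y w v hT Hw Hv
  have Q0 := growth_nonneg Hw.nonneg Y
  have KQ : 0 ≤ K * growth X Y := by positivity
  have md := measurable_duhamelIntegrand Hw.meas Hv.meas
  have pt : ∀ t ∈ Icc 1 T, ∀ ξ, ∫⁻ s in Ioc 1 t, ‖duhamelIntegrand w v s ξ‖ₑ ≤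
      ENNReal.ofReal (K * growth X Y * δ⁻¹) := by
    intro t ht ξ
    refine (setLIntegral_mono' measurableSet_Ioc fun s hs =>
      (HK T X Y w v Hw Hv s ⟨hs.1.le, hs.2.trans ht.2⟩).1 ξ).trans ?_
    simp only [ENNReal.ofReal_mul KQ]
    rw [lintegral_const_mul' _ _ ENNReal.ofReal_ne_top]
    exact mul_le_mul_right (lintegral_Ioc_rpow_neg_le δ0 ht.1) _
  have ii : ∀ ξ, IntegrableOn (fun s => duhamelIntegrand w v s ξ) (Ioc 1 T) := fun ξ =>
    ⟨(md.comp measurable_prodMk_right).aestronglyMeasurable,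
      (pt T ⟨hT, le_rfl⟩ ξ).trans_lt ENNReal.ofReal_lt_top⟩
  have α0 : 0 < α⁻¹ := inv_pos.2 hα
  have δ1 : 0 < δ⁻¹ := inv_pos.2 δ0
  refine ⟨fun ξ => (intervalIntegrable_iff_integrableOn_Ioc_of_le hT).2 (ii ξ), fun t ht => ?_⟩
  have tα : 0 < t ^ α := Real.rpow_pos_of_pos (one_pos.trans_le ht.1) _
  have hK : ∀ c : ℝ, 0 ≤ c → c * (K * growth X Y) * (α⁻¹ * t ^ α) ≤
      c * (K * (δ⁻¹ + α⁻¹) * growth X Y * t ^ α) := by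
    intro c hc
    have : 0 ≤ K * growth X Y * (δ⁻¹ * t ^ α) := by positivity
    rw [mul_assoc]
    exact mul_le_mul_of_nonneg_left (by linarith) hc
  have it : ∀ ξ, IntervalIntegrable (fun s => duhamelIntegrand w v s ξ) volume 1 t := fun ξ =>
    (intervalIntegrable_iff_integrableOn_Ioc_of_le ht.1).2
      ((ii ξ).mono_set (Ioc_subset_Ioc_right ht.2))
  refine ⟨fun ξ => ?_, fun k => ?_, fun i hi => ?_⟩
  · rw [intervalIntegral.integral_of_le ht.1]
    refine (enorm_integral_le_lintegral_enorm _).trans ((pt t ht ξ).trans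
      (ENNReal.ofReal_le_ofReal ?_))
    have : 0 ≤ K * growth X Y * α⁻¹ := by positivity
    linarith
  · simp only [← intervalIntegral.integral_sub (it _) (it _)]
    have mk : Measurable (Function.uncurry fun s ξ =>
        duhamelIntegrand w v s (ξ + k) - duhamelIntegrand w v s ξ) :=
      (md.comp (measurable_fst.prodMk (measurable_snd.add_const k))).sub md
    refine (eLpNorm_intervalIntegral_le mk hα (mul_nonneg (abs_nonneg k) KQ) ht.1
      fun s hs => ?_).trans ?_
    · refine ((HK T X Y w v Hw Hv s ⟨hs.1, hs.2.trans ht.2⟩).2.1 k).trans_eq ?_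
      rw [← ENNReal.ofReal_mul (abs_nonneg k)]
      congr 1
      ring
    · rw [← ENNReal.ofReal_mul (abs_nonneg k)]
      exact ENNReal.ofReal_le_ofReal (hK _ (abs_nonneg k))
  · simp only [← intervalIntegral.integral_const_mul]
    have mi : Measurable (Function.uncurry fun (s x : ℝ) =>
        (x : ℂ) ^ i * duhamelIntegrand w v s x) :=
      ((Complex.measurable_ofReal.comp measurable_snd).pow_const i).mul md
    refine (eLpNorm_intervalIntegral_le mi hα KQ ht.1 fun s hs =>
      (HK T X Y w v Hw Hv s ⟨hs.1, hs.2.trans ht.2⟩).2.2 i hi).trans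
      (ENNReal.ofReal_le_ofReal ?_)
    simpa using hK 1 zero_le_one

end

/-! ### The initial datum, restriction in time, and the final estimate -/

section

/-! ### The Duhamel map on measurable data -/

theorem eLpNorm_le_normHWeight (m : ℕ) (φ : ℝ → ℂ) {i : ℕ} (hi : i ≤ m) :
    eLpNorm (fun x : ℝ => (x : ℂ) ^ i * φ x) 2 volume ≤ normHWeight m φ :=
  Finset.single_le_sum (f := fun i => eLpNorm (fun x : ℝ => (x : ℂ) ^ i * φ x) 2 volume)
    (fun _ _ => zero_le) (Finset.mem_range.2 (Nat.lt_succ_of_le hi))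

theorem normHDeriv_one (φ : ℝ → ℂ) : normHDeriv 1 φ = derivL2 0 φ + derivL2 1 φ := by
  simp [normHDeriv, Finset.sum_range_succ]

theorem ofReal_rpow_neg_mul_le {α t : ℝ} (ht : 1 ≤ t) (hα : 0 ≤ α) {N a b : ℝ≥0∞} {c : ℝ}
    (h : N ≤ a + b * ENNReal.ofReal (c * t ^ α)) :
    ENNReal.ofReal (t ^ (-α)) * N ≤ a + b * ENNReal.ofReal c := by
  have t0 : 0 < t := one_pos.trans_le ht
  have h1 : ENNReal.ofReal (t ^ (-α)) ≤ 1 := by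
    rw [← ENNReal.ofReal_one]
    exact ENNReal.ofReal_le_ofReal (Real.rpow_le_one_of_one_le_of_nonpos ht (by linarith))
  refine (mul_le_mul_right h _).trans ?_
  rw [mul_add, mul_left_comm, ← ENNReal.ofReal_mul (Real.rpow_nonneg t0.le _)]
  have e : t ^ (-α) * (c * t ^ α) = c := by
    rw [mul_left_comm, ← Real.rpow_add t0, neg_add_cancel, Real.rpow_zero, mul_one]
  rw [e]
  exact add_le_add_left ((mul_le_mul_left h1 _).trans_eq (one_mul _)) _

/-- The norm of `X_T` of a perturbation of a fixed function. -/
theorem normXT_add_le {n : ℕ} {α T c : ℝ} {φ : ℝ → ℂ} {I : ℝ → ℝ → ℂ} {ε : ℝ≥0} (hα : 0 < α)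
    (mφ : AEStronglyMeasurable φ volume) (mI : ∀ t, AEStronglyMeasurable (I t) volume)
    (hε : normHDeriv 1 φ + normHWeight (2 * n + 1) φ ≤ (ε : ℝ≥0∞))
    (hlinf : ∀ t ∈ Icc 1 T, ∀ ξ, ‖I t ξ‖ₑ ≤ ENNReal.ofReal c)
    (htrans : ∀ t ∈ Icc 1 T, TransBd (I t) (ENNReal.ofReal (c * t ^ α)))
    (hwt : ∀ t ∈ Icc 1 T, ∀ i ≤ 2 * n + 1,
      eLpNorm (fun x : ℝ => (x : ℂ) ^ i * I t x) 2 volume ≤ ENNReal.ofReal (c * t ^ α)) :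
    normXT n α T (fun t => φ + I t) ≤
      3 / 2 * (ε : ℝ≥0∞) + (((2 * n + 1 : ℕ) : ℝ≥0∞) + 4) * ENNReal.ofReal c := by
  have hm : 1 ≤ 2 * n + 1 := Nat.le_add_left 1 _
  obtain ⟨q, hq⟩ : ∃ q, q = ENNReal.ofReal c := ⟨_, rfl⟩
  obtain ⟨a, ha⟩ : ∃ a, a = eLpNorm φ 2 volume := ⟨_, rfl⟩
  obtain ⟨d, hd⟩ : ∃ d, d = derivL2 1 φ := ⟨_, rfl⟩
  have a_le : a ≤ derivL2 0 φ := ha.trans_le (eLpNorm_le_derivL2_zero _)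
  have a_le' : a ≤ normHWeight (2 * n + 1) φ := by
    have := eLpNorm_le_normHWeight (2 * n + 1) φ (Nat.zero_le _)
    simp only [pow_zero, one_mul] at this
    exact ha.trans_le this
  have hWε : normHWeight (2 * n + 1) φ ≤ ε := le_add_self.trans hε
  have hDε : normHDeriv 1 φ ≤ ε := le_self_add.trans hε
  have hdε : d ≤ ε := by
    rw [normHDeriv_one, ← hd] at hDε
    exact le_add_self.trans hDε
  have w1 : eLpNorm (fun x : ℝ => (x : ℂ) ^ 1 * φ x) 2 volume < ⊤ :=
    ((eLpNorm_le_normHWeight _ _ hm).trans hWε).trans_lt ENNReal.coe_lt_top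
  have m2 : MemLp φ 2 volume :=
    ⟨mφ, (ha.symm.trans_le (a_le'.trans hWε)).trans_lt ENNReal.coe_lt_top⟩
  have iφ : Integrable φ := integrable_of_weight mφ m2.2 w1
  have wt : ∀ t ∈ Icc 1 T, ∀ i ≤ 2 * n + 1,
      eLpNorm (fun x : ℝ => (x : ℂ) ^ i * (φ + I t) x) 2 volume ≤
        eLpNorm (fun x : ℝ => (x : ℂ) ^ i * φ x) 2 volume + ENNReal.ofReal (c * t ^ α) := by
    intro t ht i hi
    have mp : AEStronglyMeasurable (fun x : ℝ => (x : ℂ) ^ i) volume :=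
      Measurable.aestronglyMeasurable (by fun_prop)
    have e : (fun x : ℝ => (x : ℂ) ^ i * (φ + I t) x) = (fun x : ℝ => (x : ℂ) ^ i * φ x) +
        fun x : ℝ => (x : ℂ) ^ i * I t x :=
      funext fun x => mul_add _ _ _
    rw [e]
    exact (eLpNorm_add_le (mp.mul mφ) (mp.mul (mI t)) one_le_two).trans
      (add_le_add_right (hwt t ht i hi) _)
  have linf : ∀ t ∈ Icc 1 T, normLinf (φ + I t) ≤ (a + 2⁻¹ * d) + q := by
    intro t ht
    refine (eLpNorm_add_le mφ (mI t) le_top).trans (add_le_add ?_ ?_)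
    · rw [ha, hd]
      exact normLinf_le iφ m2 (transBd_derivL2 _)
    · rw [eLpNorm_exponent_top, hq]
      exact eLpNormEssSup_le_of_ae_enorm_bound (.of_forall (hlinf t ht))
  have hderiv : ∀ t ∈ Icc 1 T, ENNReal.ofReal (t ^ (-α)) * normHDeriv 1 (φ + I t) ≤
      normHDeriv 1 φ + 2 * q := by
    intro t ht
    rw [hq]
    refine ofReal_rpow_neg_mul_le ht.1 hα.le ?_
    have w0 : eLpNorm (φ + I t) 2 volume ≤ a + ENNReal.ofReal (c * t ^ α) := by
      have := wt t ht 0 (Nat.zero_le _)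
      simp only [pow_zero, one_mul] at this
      rwa [ha]
    have t1 := wt t ht 1 hm
    have T1 := htrans t ht
    have W0 := hwt t ht 0 (Nat.zero_le _)
    simp only [pow_zero, one_mul] at W0
    have hr : ENNReal.ofReal (c * t ^ α) < ⊤ := ENNReal.ofReal_lt_top
    generalize ENNReal.ofReal (c * t ^ α) = r at *
    have md : AEStronglyMeasurable (φ + I t) volume := mφ.add (mI t)
    have fin0 : eLpNorm (φ + I t) 2 volume < ⊤ := 
      eLpNorm_add_lt_top m2 ⟨mI t, W0.trans_lt hr⟩
    have id : Integrable (φ + I t) :=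
      integrable_of_weight md fin0 (t1.trans_lt (ENNReal.add_lt_top.2 ⟨w1, hr⟩))
    -- Translation bounds add, and `derivL2_one_le` then provides the weak derivative of the sum.
    have hT' : TransBd (φ + I t) (d + r) := by
      rw [hd]
      exact (transBd_derivL2 φ).add mφ (mI t) T1
    have d1 : derivL2 1 (φ + I t) ≤ d + r := derivL2_one_le id ⟨md, fin0⟩ hT'
      (ENNReal.add_lt_top.2 ⟨hdε.trans_lt ENNReal.coe_lt_top, hr⟩).ne
    have d0 : derivL2 0 (φ + I t) ≤ derivL2 0 φ + r :=
      (derivL2_zero_le id.locallyIntegrable).trans (w0.trans (add_le_add_left a_le _))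
    rw [normHDeriv_one, normHDeriv_one, ← hd]
    refine (add_le_add d0 d1).trans_eq ?_
    ring
  have hweight : ∀ t ∈ Icc 1 T,
      ENNReal.ofReal (t ^ (-α)) * normHWeight (2 * n + 1) (φ + I t) ≤
      normHWeight (2 * n + 1) φ + (((2 * n + 1 : ℕ) : ℝ≥0∞) + 1) * q := by
    intro t ht
    rw [hq]
    refine ofReal_rpow_neg_mul_le ht.1 hα.le ?_
    rw [normHWeight]
    refine (Finset.sum_le_sum fun i hi =>
      wt t ht i (Nat.lt_succ_iff.1 (Finset.mem_range.1 hi))).trans_eq ?_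
    rw [Finset.sum_add_distrib, Finset.sum_const, Finset.card_range, nsmul_eq_mul, normHWeight,
      Nat.cast_succ]
  -- The integral contributes `q` once to the sup norm, twice to `H^{1,0}`, and once for each of the
  -- `2n + 2` weights.
  have total : normXT n α T (fun t => φ + I t) ≤ (a + 2⁻¹ * d) + q + (normHDeriv 1 φ + 2 * q) +
      (normHWeight (2 * n + 1) φ + (((2 * n + 1 : ℕ) : ℝ≥0∞) + 1) * q) :=
    add_le_add (add_le_add (iSup₂_le linf) (iSup₂_le hderiv)) (iSup₂_le hweight)
  have init : (a + 2⁻¹ * d) + (normHDeriv 1 φ + normHWeight (2 * n + 1) φ) ≤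
      3 / 2 * (ε : ℝ≥0∞) := by
    -- The norm `a` occurs in both `H^{1,0}` and `H^{0,2n+1}`, and `a + d/2` is half of `a + d + a`.
    -- So the sup norm of the datum costs `ε/2` beyond the `ε` of the other two norms.
    have e1 : a + 2⁻¹ * d ≤ 2⁻¹ * (normHDeriv 1 φ + normHWeight (2 * n + 1) φ) := by
      have : a + 2⁻¹ * d = 2⁻¹ * (a + d + a) := by
        rw [add_right_comm, mul_add, ← two_mul, ← mul_assoc,
          ENNReal.inv_mul_cancel two_ne_zero ENNReal.ofNat_ne_top, one_mul]
      rw [this, normHDeriv_one, ← hd]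
      exact mul_le_mul_right (add_le_add (add_le_add_left a_le _) a_le') _
    refine (add_le_add (e1.trans (mul_le_mul_right hε _)) hε).trans_eq ?_
    have : (3 / 2 : ℝ≥0∞) = 2⁻¹ + 1 := by
      rw [← ENNReal.inv_two_add_inv_two, ENNReal.div_eq_inv_mul,
        show (3 : ℝ≥0∞) = 1 + 1 + 1 by norm_num]
      ring
    rw [this, add_mul, one_mul]
  rw [← hq]
  refine total.trans ((le_of_eq ?_).trans (add_le_add_left init _))
  ring

theorem duhamel_eq_add (w v : ℝ → ℝ → ℂ) : duhamel w v =
    fun t => w 1 + fun ξ => ∫ s in (1 : ℝ)..t, duhamelIntegrand w v s ξ := by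
  funext t ξ
  rw [duhamel, Pi.add_apply]

theorem triple_time (h₁ h₂ h₃ : ℝ → ℝ → ℂ) (s ξ : ℝ) : triple h₁ h₂ h₃ s ξ =
    triple (fun _ => h₁ s) (fun _ => h₂ s) (fun _ => h₃ s) s ξ := rfl

theorem remainderIntegrand_time (h₁ h₂ h₃ : ℝ → ℝ → ℂ) (s ξ : ℝ) :
    remainderIntegrand h₁ h₂ h₃ s ξ =
      remainderIntegrand (fun _ => h₁ s) (fun _ => h₂ s) (fun _ => h₃ s) s ξ := rfl

theorem integrable_remainder_time {h₁ h₂ h₃ : ℝ → ℝ → ℂ} {s L₁ N₁ L₂ N₂ L₃ N₃ : ℝ}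
    (H₁ : ProfileBd (h₁ s) L₁ N₁) (H₂ : ProfileBd (h₂ s) L₂ N₂) (H₃ : ProfileBd (h₃ s) L₃ N₃)
    (ξ : ℝ) :
    Integrable (triple h₁ h₂ h₃ s ξ) ∧ Integrable (remainderIntegrand h₁ h₂ h₃ s ξ) := by
  rw [triple_time, remainderIntegrand_time]
  exact ⟨integrable_triple H₁.integrable H₃.integrable H₂.integrable_fourierInv H₂.fourier_ae_eq
    s ξ, integrable_remainderIntegrand H₁.integrable H₃.integrable H₁.integrable_fourierInv
      H₃.integrable_fourierInv H₂.integrable_fourierInv H₂.fourier_ae_eq s ξ⟩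

theorem exists_normXT_duhamel_le (n : ℕ) {α : ℝ} (hα : 0 < α) (hα' : α < 1 / 12) :
    ∃ K, 0 < K ∧ ∀ (T X Y : ℝ) (w v : ℝ → ℝ → ℂ) (ε : ℝ≥0), 1 ≤ T →
      XBound (2 * n + 1) α T w X → XBound (2 * n + 1) α T v Y →
      normHDeriv 1 (w 1) + normHWeight (2 * n + 1) (w 1) ≤ (ε : ℝ≥0∞) →
      DuhamelConverges T w v ∧
      normXT n α T (duhamel w v) ≤ 3 / 2 * (ε : ℝ≥0∞) + ENNReal.ofReal (K * growth X Y) := by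
  have hm : 1 ≤ 2 * n + 1 := Nat.le_add_left 1 _
  obtain ⟨K, K0, HK⟩ := exists_duhamel_integral_bounds hm hα hα'
  refine ⟨((2 * n + 1 : ℕ) + 4) * K, by positivity, ?_⟩
  intro T X Y w v ε hT Hw Hv hε
  obtain ⟨hint, HI⟩ := HK T X Y w v hT Hw Hv
  have hα1 : α ≤ 1 := by linarith
  refine ⟨⟨?_, fun ξ s hs => ?_, hint⟩, ?_⟩
  · filter_upwards [Hw.ae_intervalIntegrable hT, Hv.ae_intervalIntegrable hT] with ξ a b
    exact ⟨a, b⟩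
  · have Pv := Hv.profileBd Hw hα hα1 hm hs
    have Pw := Hw.profileBd Hv hα hα1 hm hs
    exact integrable_remainder_time Pv Pv Pw ξ
  · have mI : ∀ t, AEStronglyMeasurable
        (fun ξ => ∫ s in (1 : ℝ)..t, duhamelIntegrand w v s ξ) volume := fun t => by
      have := (measurable_intervalIntegral (measurable_duhamelIntegrand Hw.meas Hv.meas)).comp
        (measurable_prodMk_left (x := t))
      exact this.aestronglyMeasurable
    have := normXT_add_le hα (Hw.meas_at 1).aestronglyMeasurable mI hε
      (fun t ht => (HI t ht).1) (fun t ht => (HI t ht).2.1) (fun t ht => (HI t ht).2.2)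
    rw [← duhamel_eq_add] at this
    refine this.trans_eq (congrArg _ ?_)
    rw [mul_assoc _ K, ENNReal.ofReal_mul (p := ((2 * n + 1 : ℕ) : ℝ) + 4) (by positivity),
      ENNReal.ofReal_add (by positivity) (by positivity), ENNReal.ofReal_natCast,
      ENNReal.ofReal_ofNat]

/-! ### Restriction to the time interval -/

/-- `w`, set to zero outside the time interval `[1, T]`. -/
def cutTime (T : ℝ) (w : ℝ → ℝ → ℂ) (t ξ : ℝ) : ℂ :=
  (Icc (1 : ℝ) T ×ˢ (univ : Set ℝ)).indicator (Function.uncurry w) (t, ξ)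

theorem cutTime_eq {T t : ℝ} (w : ℝ → ℝ → ℂ) (ht : t ∈ Icc 1 T) : cutTime T w t = w t := by
  funext ξ
  exact indicator_of_mem (show (t, ξ) ∈ Icc (1 : ℝ) T ×ˢ (univ : Set ℝ) from ⟨ht, mem_univ _⟩) _

theorem measurable_cutTime {T : ℝ} (hT : 1 ≤ T) {w : ℝ → ℝ → ℂ}
    (h : Measurable fun p : Icc (1 : ℝ) T × ℝ => w p.1 p.2) :
    Measurable (Function.uncurry (cutTime T w)) := by
  have hS : MeasurableSet (Icc (1 : ℝ) T ×ˢ (univ : Set ℝ)) := measurableSet_Icc.prod .univ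
  -- Projecting the time onto `[1, T]` extends `w` measurably to the plane; the indicator then
  -- removes the extension.
  have mp : Measurable fun p : ℝ × ℝ => (projIcc 1 T hT p.1, p.2) :=
    ((continuous_projIcc.measurable).comp measurable_fst).prodMk measurable_snd
  have e : Function.uncurry (cutTime T w) = (Icc (1 : ℝ) T ×ˢ (univ : Set ℝ)).indicator
      fun p => w (projIcc 1 T hT p.1) p.2 := by
    refine indicator_congr fun p hp => ?_
    rw [projIcc_of_mem hT hp.1]
    rfl
  rw [e]
  exact (h.comp mp).indicator hS

variable {T t : ℝ}

theorem uIcc_subset_of_mem (ht : t ∈ Icc 1 T) : uIcc 1 t ⊆ Icc 1 T := by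
  rw [uIcc_of_le ht.1]
  exact Icc_subset_Icc_right ht.2

theorem phase_cutTime (v : ℝ → ℝ → ℂ) (ht : t ∈ Icc 1 T) :
    phase (cutTime T v) t = phase v t := by
  funext ξ
  have : ∫ s in (1 : ℝ)..t, 1 / s * ‖cutTime T v s ξ‖ ^ 2 =
      ∫ s in (1 : ℝ)..t, 1 / s * ‖v s ξ‖ ^ 2 :=
    intervalIntegral.integral_congr fun s hs => by
      simp only [cutTime_eq v (uIcc_subset_of_mem ht hs)]
  rw [phase, phase, this]

theorem profile_cutTime (w v : ℝ → ℝ → ℂ) (ht : t ∈ Icc 1 T) :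
    profile (cutTime T w) (cutTime T v) t = profile w v t := by
  funext ξ
  rw [profile, profile, cutTime_eq w ht, phase_cutTime v ht]

theorem duhamelIntegrand_cutTime (w v : ℝ → ℝ → ℂ) (ht : t ∈ Icc 1 T) :
    duhamelIntegrand (cutTime T w) (cutTime T v) t = duhamelIntegrand w v t := by
  rw [duhamelIntegrand_eq, duhamelIntegrand_eq, profile_cutTime w v ht, profile_cutTime v w ht,
    phase_cutTime v ht]

theorem duhamel_cutTime (w v : ℝ → ℝ → ℂ) (ht : t ∈ Icc 1 T) :
    duhamel (cutTime T w) (cutTime T v) t = duhamel w v t := by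
  funext ξ
  rw [duhamel, duhamel, cutTime_eq w ⟨le_rfl, ht.1.trans ht.2⟩]
  congr 1
  exact intervalIntegral.integral_congr fun s hs => by
    simp only [duhamelIntegrand_cutTime w v (uIcc_subset_of_mem ht hs)]

theorem normXT_congr {n : ℕ} {α : ℝ} {φ ψ : ℝ → ℝ → ℂ} (h : ∀ t ∈ Icc 1 T, φ t = ψ t) :
    normXT n α T φ = normXT n α T ψ := by
  have e : ∀ F : ℝ → (ℝ → ℂ) → ℝ≥0∞,
      (⨆ t ∈ Icc (1 : ℝ) T, F t (φ t)) = ⨆ t ∈ Icc (1 : ℝ) T, F t (ψ t) := fun F =>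
    iSup_congr fun t => iSup_congr fun ht => by rw [h t ht]
  rw [normXT, normXT, e fun _ => normLinf, e fun t f => ENNReal.ofReal (t ^ (-α)) * normHDeriv 1 f,
    e fun t f => ENNReal.ofReal (t ^ (-α)) * normHWeight (2 * n + 1) f]

theorem DuhamelConverges.of_cutTime {w v : ℝ → ℝ → ℂ} (hT : 1 ≤ T)
    (h : DuhamelConverges T (cutTime T w) (cutTime T v)) : DuhamelConverges T w v := by
  have cg : ∀ {E : Type} [NormedAddCommGroup E] {F G : ℝ → E}, (∀ s ∈ Icc 1 T, F s = G s) →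
      IntervalIntegrable F volume 1 T → IntervalIntegrable G volume 1 T := by
    intro E _ F G e hF
    refine hF.congr fun s hs => ?_
    rw [uIoc_of_le hT] at hs
    exact e s ⟨hs.1.le, hs.2⟩
  have sq : ∀ (u : ℝ → ℝ → ℂ) (ξ : ℝ), ∀ s ∈ Icc 1 T,
      1 / s * ‖cutTime T u s ξ‖ ^ 2 = 1 / s * ‖u s ξ‖ ^ 2 := fun u ξ s hs => by
    rw [cutTime_eq u hs]
  obtain ⟨h1, h2, h3⟩ := h
  refine ⟨?_, fun ξ s hs => ?_, fun ξ => ?_⟩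
  · filter_upwards [h1] with ξ hξ
    exact ⟨cg (sq w ξ) hξ.1, cg (sq v ξ) hξ.2⟩
  · obtain ⟨a, b⟩ := h2 ξ s hs
    have et : triple (profile (cutTime T v) (cutTime T w)) (profile (cutTime T v) (cutTime T w))
        (profile (cutTime T w) (cutTime T v)) s ξ =
        triple (profile v w) (profile v w) (profile w v) s ξ := by
      funext p
      simp only [triple, profile_cutTime w v hs, profile_cutTime v w hs]
    have er : remainderIntegrand (profile (cutTime T v) (cutTime T w))
        (profile (cutTime T v) (cutTime T w)) (profile (cutTime T w) (cutTime T v)) s ξ =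
        remainderIntegrand (profile v w) (profile v w) (profile w v) s ξ := by
      funext p
      simp only [remainderIntegrand, et]
    rw [et] at a
    rw [er] at b
    exact ⟨a, b⟩
  · exact cg (fun s hs => by rw [duhamelIntegrand_cutTime w v hs]) (h3 ξ)

/-- Nothing is known of `w` outside `[1, T]`, not even measurability, so the bounds are stated for
the function cut off in time. By causality the Duhamel map on `[1, T]` is the same for both
(`duhamel_cutTime`). -/
theorem MemXT.xBound {n : ℕ} {α : ℝ} {w : ℝ → ℝ → ℂ} (hT : 1 ≤ T) (h : MemXT n α T w) :
    XBound (2 * n + 1) α T (cutTime T w) (normXT n α T w).toReal := by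
  have e : ENNReal.ofReal (normXT n α T w).toReal = normXT n α T w :=
    ENNReal.ofReal_toReal h.2.ne
  have scale : ∀ t ∈ Icc 1 T, ∀ N : ℝ≥0∞, ENNReal.ofReal (t ^ (-α)) * N ≤ normXT n α T w →
      N ≤ ENNReal.ofReal (t ^ α * (normXT n α T w).toReal) := by
    intro t ht N hN
    have t0 : 0 < t := one_pos.trans_le ht.1
    have := mul_le_mul_right hN (ENNReal.ofReal (t ^ α))
    rwa [← mul_assoc, ← ENNReal.ofReal_mul (Real.rpow_nonneg t0.le _), ← Real.rpow_add t0,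
      add_neg_cancel, Real.rpow_zero, ENNReal.ofReal_one, one_mul, ← e,
      ← ENNReal.ofReal_mul (Real.rpow_nonneg t0.le _)] at this
  have b1 : ∀ t ∈ Icc 1 T, normLinf (w t) ≤ normXT n α T w := fun t ht =>
    (le_iSup₂ (f := fun t (_ : t ∈ Icc 1 T) => normLinf (w t)) t ht).trans
      (le_self_add.trans le_self_add)
  have b2 : ∀ t ∈ Icc 1 T, ENNReal.ofReal (t ^ (-α)) * normHDeriv 1 (w t) ≤ normXT n α T w :=
    fun t ht => (le_iSup₂ (f := fun t (_ : t ∈ Icc 1 T) =>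
      ENNReal.ofReal (t ^ (-α)) * normHDeriv 1 (w t)) t ht).trans (le_add_self.trans le_self_add)
  have b3 : ∀ t ∈ Icc 1 T, ENNReal.ofReal (t ^ (-α)) * normHWeight (2 * n + 1) (w t) ≤
      normXT n α T w :=
    fun t ht => (le_iSup₂ (f := fun t (_ : t ∈ Icc 1 T) =>
      ENNReal.ofReal (t ^ (-α)) * normHWeight (2 * n + 1) (w t)) t ht).trans le_add_self
  refine ⟨measurable_cutTime hT h.1, ENNReal.toReal_nonneg, fun t ht => ?_, fun t ht => ?_,
    fun t ht i hi => ?_⟩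
  · rw [cutTime_eq w ht, e]
    exact b1 t ht
  · rw [cutTime_eq w ht]
    refine (transBd_derivL2 (w t)).mono (le_trans ?_ (scale t ht _ (b2 t ht)))
    rw [normHDeriv_one]
    exact le_add_self
  · rw [cutTime_eq w ht]
    exact (eLpNorm_le_normHWeight _ _ hi).trans (scale t ht _ (b3 t ht))

/-- The estimate for one of the Duhamel maps. -/
theorem exists_duhamel_estimate (n : ℕ) {α : ℝ} (hα : 0 < α) (hα' : α < 1 / 12) :
    ∃ M : ℝ≥0, 0 < M ∧ ∀ (T : ℝ) (ε : ℝ≥0) (w v : ℝ → ℝ → ℂ), 1 ≤ T →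
      MemXT n α T w → MemXT n α T v →
      normHDeriv 1 (w 1) + normHWeight (2 * n + 1) (w 1) ≤ (ε : ℝ≥0∞) →
      DuhamelConverges T w v ∧ MemXT n α T (duhamel w v) ∧
      normXT n α T (duhamel w v) ≤ 3 / 2 * (ε : ℝ≥0∞) +
        (M : ℝ≥0∞) * normXT n α T w * normXT n α T v ^ 2 * (1 + normXT n α T w ^ 4) *
          (1 + normXT n α T v ^ 4) := by
  obtain ⟨K, K0, HK⟩ := exists_normXT_duhamel_le n hα hα'
  refine ⟨K.toNNReal, Real.toNNReal_pos.2 K0, ?_⟩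
  intro T ε w v hT Mw Mv hε
  have Hw := Mw.xBound hT
  have Hv := Mv.xBound hT
  have h1 : (1 : ℝ) ∈ Icc 1 T := ⟨le_rfl, hT⟩
  obtain ⟨hc, hn⟩ := HK T _ _ _ _ ε hT Hw Hv (by rwa [cutTime_eq w h1])
  have ed : ∀ t ∈ Icc 1 T, duhamel (cutTime T w) (cutTime T v) t = duhamel w v t :=
    fun t ht => duhamel_cutTime w v ht
  rw [normXT_congr ed] at hn
  refine ⟨hc.of_cutTime hT, ⟨?_, hn.trans_lt ?_⟩, hn.trans_eq ?_⟩
  · have e : (fun p : Icc (1 : ℝ) T × ℝ => duhamel w v p.1 p.2) =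
        fun p => Function.uncurry (duhamel (cutTime T w) (cutTime T v)) ((p.1 : ℝ), p.2) :=
      funext fun p => (congrFun (ed p.1 p.1.2) p.2).symm
    rw [e]
    exact (measurable_duhamel Hw.meas Hv.meas).comp
      ((measurable_subtype_coe.comp measurable_fst).prodMk measurable_snd)
  · exact ENNReal.add_lt_top.2 ⟨ENNReal.mul_lt_top (ENNReal.div_lt_top ENNReal.ofNat_ne_top
      two_ne_zero) ENNReal.coe_lt_top, ENNReal.ofReal_lt_top⟩
  · congr 1
    have X0 := Hw.nonneg
    have Y0 := Hv.nonneg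
    have eX : normXT n α T w = ENNReal.ofReal (normXT n α T w).toReal :=
      (ENNReal.ofReal_toReal Mw.2.ne).symm
    have eY : normXT n α T v = ENNReal.ofReal (normXT n α T v).toReal :=
      (ENNReal.ofReal_toReal Mv.2.ne).symm
    rw [eX, eY, ENNReal.toReal_ofReal X0, ENNReal.toReal_ofReal Y0]
    generalize (normXT n α T w).toReal = x at *
    generalize (normXT n α T v).toReal = y at *
    have p4 : ∀ z : ℝ, 0 ≤ z → 1 + ENNReal.ofReal z ^ 4 = ENNReal.ofReal (1 + z ^ 4) := by
      intro z hz
      rw [ENNReal.ofReal_add zero_le_one (by positivity), ENNReal.ofReal_one,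
        ENNReal.ofReal_pow hz]
    rw [p4 x X0, p4 y Y0, ← ENNReal.ofReal_pow Y0]
    -- The coercion of `K.toNNReal` is `ENNReal.ofReal K` by definition.
    change _ = ENNReal.ofReal K * _ * _ * _ * _
    rw [← ENNReal.ofReal_mul (by positivity), ← ENNReal.ofReal_mul (by positivity),
      ← ENNReal.ofReal_mul (by positivity), ← ENNReal.ofReal_mul (by positivity), growth]
    congr 1
    ring

end

end CoupledNLS

end

theorem proposition2 (n : ℕ) (α : ℝ) (hα : 0 < α) (hα' : α < 1 / 12) :
    ∃ M : NNReal, 0 < M ∧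
      ∀ (T : ℝ) (ε : NNReal) (wf wg : ℝ → ℝ → ℂ), 1 ≤ T →
        CoupledNLS.MemXT n α T wf → CoupledNLS.MemXT n α T wg →
        CoupledNLS.normHDeriv 1 (wf 1) + CoupledNLS.normHWeight (2 * n + 1) (wf 1)
            + CoupledNLS.normHDeriv 1 (wg 1) + CoupledNLS.normHWeight (2 * n + 1) (wg 1)
          ≤ (ε : ENNReal) →
        (CoupledNLS.DuhamelConverges T wf wg ∧
          CoupledNLS.MemXT n α T (CoupledNLS.Phi₁ wf wg) ∧
          CoupledNLS.normXT n α T (CoupledNLS.Phi₁ wf wg) ≤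
            3 / 2 * (ε : ENNReal)
              + (M : ENNReal) * CoupledNLS.normXT n α T wf * CoupledNLS.normXT n α T wg ^ 2
                * (1 + CoupledNLS.normXT n α T wf ^ 4) * (1 + CoupledNLS.normXT n α T wg ^ 4)) ∧
        (CoupledNLS.DuhamelConverges T wg wf ∧
          CoupledNLS.MemXT n α T (CoupledNLS.Phi₂ wf wg) ∧
          CoupledNLS.normXT n α T (CoupledNLS.Phi₂ wf wg) ≤
            3 / 2 * (ε : ENNReal)
              + (M : ENNReal) * CoupledNLS.normXT n α T wg * CoupledNLS.normXT n α T wf ^ 2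
                * (1 + CoupledNLS.normXT n α T wg ^ 4) * (1 + CoupledNLS.normXT n α T wf ^ 4)) := by
  obtain ⟨M, hM, H⟩ := CoupledNLS.exists_duhamel_estimate n hα hα'
  refine ⟨M, hM, fun T ε wf wg hT hf hg hε => ⟨?_, ?_⟩⟩
  · refine H T ε wf wg hT hf hg (le_trans ?_ hε)
    rw [add_assoc]
    exact le_self_add
  · refine H T ε wg wf hT hg hf (le_trans ?_ hε)
    rw [add_assoc (_ + _)]
    exact le_add_self
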